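/- **Conventions.** Everything is over $\mathbb C$; $\mathcal I$ is a finite set, small Latin indices run over $\mathcal I$, and repeated indices are summed. For a Hopf algebra $(\mathcal A,\Delta)$ with counit $\epsilon$ and antipode $S$, and $a\in\mathcal A$, $\rho\in\mathcal A'$, put $a*\rho=(\rho\otimes\mathrm{id})\Delta a$, $\rho*a=(\mathrm{id}\otimes\rho)\Delta a$. A representation is a matrix $v\in M_N(\mathcal A)$ with $\Delta v_{ij}=v_{ik}\otimes v_{kj}$, $\epsilon(v_{ij})=\delta_{ij}$; $(v\otimes w)_{ij,kl}=v_{ik}w_{jl}$; $\mathrm{Mor}(v,w)=\{X\in M_{\dim w\times\dim v}(\mathbb C): Xv=wX\}$; $I$ is the unit and also the trivial representation. A Hopf $*$-algebra is a Hopf algebra with a conjugate-linear antimultiplicative involution $*$ satisfying $\Delta\circ *=(*\otimes *)\circ\Delta$; $\bar v_{ij}=v_{ij}^*$. Consider the following conditions on $(\mathcal A,\Delta)$ and a representation $\Lambda=(\Lambda_{ij})_{i,j\in\mathcal I}$ (the antipode of $\mathcal A$ being invertible): (a) every representation of $\mathcal A$ is completely reducible; (b) $\Lambda$ is irreducible;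 (c) $\mathrm{Mor}(v\otimes w,\Lambda\otimes v\otimes w)=\{0\}$ for all irreducible representations $v,w$ of $\mathcal A$. We say that $\mathcal B,\mathcal A,\Delta,\Lambda,p,f,\eta,T$ *describe an inhomogeneous quantum group* if $(\mathcal A,\Delta),\Lambda$ satisfy (a)–(c), $(\mathcal B,\Delta)$ is a Hopf algebra, $p_i\in\mathcal B$, $f_{ij},\eta_i\in\mathcal A'$, $T_{ij}\in\mathbb C$, and * $\mathcal A$ is a sub-bialgebra of $\mathcal B$; $\mathcal B$ is generated as an algebra by $\mathcal A$ and the $p_i$; $\Delta p_i=\Lambda_{ij}\otimes p_j+p_i\otimes I$, $\epsilon(p_i)=0$; some $p_i\notin\mathcal A$; $\mathcal B^1\mathcal A\subset\mathcal B^1$, where $\mathcal B^1=\mathcal A\cdot\mathrm{span}\{p_i\}+\mathcal A$; * $f_{st}(ab)=f_{sm}(a)f_{mt}(b)$, $f_{st}(I)=\delta_{st}$, $\eta_s(ab)=\eta_s(a)\epsilon(b)+f_{st}(a)\eta_t(b)$, $\eta_s(I)=0$, $\Lambda_{st}(f_{tr}*a)=(a*f_{st})\Lambda_{tr}$ and $p_sa=(a*f_{st})p_t+a*\eta_s-\Lambda_{st}(\eta_t*a)$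 for $a,b\in\mathcal A$; * with $R_{ij,sm}=f_{im}(\Lambda_{js})$ one has $R^2=\mathbf 1$, and for $x=(x_{ij})$, $x_{ij}\in\mathbb C$: $x(R+\mathbf 1)=0$ if and only if $x_{ij}p_ip_j+b_ip_i+c=0$ for some $b_i,c\in\mathcal A$; * $RT=-T$ and $(R-\mathbf 1)_{kl,ij}\,(p_ip_j-\eta_i(\Lambda_{js})p_s+T_{ij}-\Lambda_{im}\Lambda_{jn}T_{mn})=0$. **Proposition.** Let $\mathcal B,\mathcal A,\Delta,\Lambda,p,f,\eta,T$ describe an inhomogeneous quantum group, where $(\mathcal A,\Delta)$ is a Hopf $*$-algebra with $\bar\Lambda=\Lambda$. 1) Let $(\mathcal B,\Delta)$ be a Hopf $*$-algebra with $*|_{\mathcal A}=*_{\mathcal A}$. Then there exist $m\in\mathbb C\setminus\{0\}$ and $n_i\in\mathbb C$ such that $p'_i=mp_i+n_i-\Lambda_{ij}n_j$ satisfy $p_i'^*=p'_i$. In particular there exist $\hat{\mathcal B},\hat{\mathcal A}=\mathcal A,\hat\Delta,\hat\Lambda=\Lambda,\hat p,\hat f,\hat\eta,\hat T$ describing an inhomogeneous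 quantum group, where $\hat{\mathcal B}$ is a Hopf $*$-algebra with $*|_{\mathcal A}=*_{\mathcal A}$, and a Hopf $*$-algebra isomorphism $\phi:\mathcal B\to\hat{\mathcal B}$ with $\phi|_{\mathcal A}=\mathrm{id}$, $\phi(p'_i)=\hat p_i$, $\hat p_i^*=\hat p_i$. 2) There exists a Hopf $*$-algebra structure in $\mathcal B$ such that $*|_{\mathcal A}=*_{\mathcal A}$ and $p_i^*=p_i$ ($i\in\mathcal I$) if and only if $$f_{ij}(S(a^*))=\overline{f_{ij}(a)},\qquad \eta_i(S(a^*))=\overline{\eta_i(a)}\quad(a\in\mathcal A),\qquad \tilde T-T\in\mathrm{Mor}(I,\Lambda\otimes\Lambda),$$ where $\tilde T_{ij}=\overline{T_{ji}}$. Moreover such a $*$ is unique. 3) Let $\mathcal B$ be a Hopf $*$-algebra with $*|_{\mathcal A}=*_{\mathcal A}$ and $p_i^*=p_i$. 3.1) Let $\hat{\mathcal B},\hat{\mathcal A},\hat\Delta,\hat\Lambda,\hat p,\hat f,\hat\eta,\hat T$ also describe an inhomogeneous quantum group (possibly with another finite index set), where $\hat{\mathcal A},\hat{\mathcal B}$ are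 Hopf $*$-algebras, $*_{\hat{\mathcal B}}$ extends $*_{\hat{\mathcal A}}$ and $\hat p_i^*=\hat p_i$, and let $\phi:\mathcal B\to\hat{\mathcal B}$ be an isomorphism of Hopf $*$-algebras. Then $\phi(\mathcal A)=\hat{\mathcal A}$, $\phi(\mathcal B^1)=\hat{\mathcal B}^1$, $\phi_{\mathcal A}=\phi|_{\mathcal A}:\mathcal A\to\hat{\mathcal A}$ is an isomorphism of Hopf $*$-algebras, and $\overline{\hat\Lambda}=\hat\Lambda$. 3.2) Let moreover the index sets be equal and $\phi(\Lambda)=M\hat\Lambda M^{-1}$ for an invertible matrix $M=\bar M$. Then, for some $c\in\mathbb R\setminus\{0\}$, $h_i\in\mathbb R$, $$\phi(p)=M(c\hat p+h-\hat\Lambda h),\tag{i}$$ and one can choose (i.e. $\hat{\mathcal B},\hat{\mathcal A},\hat\Delta,\hat\Lambda,\hat p$ together with the following $\hat f,\hat\eta,\hat T$ describe an inhomogeneous quantum group) $$\hat f=(M^{-1}fM)\circ\phi_{\mathcal A}^{-1},\qquad \hat\eta=\tfrac1cM^{-1}(\eta+fMh-\epsilon Mh)\circ\phi_{\mathcal A}^{-1},\tag{ii}$$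 $$\hat T=\tfrac1{c^2}(M^{-1}\otimes M^{-1})T+\tfrac1{2c^2}(\mathbf 1-\hat R)\,[-(M^{-1}\otimes M^{-1})ZMh+h\otimes h],\tag{iii}$$ where $Z_{ij,m}=\eta_i(\Lambda_{jm})$ and $\hat R_{ij,sm}=\hat f_{im}(\hat\Lambda_{js})$, $\hat R=(M^{-1}\otimes M^{-1})R(M\otimes M)$. 3.3) Let $\hat{\mathcal A},\hat\Delta,\hat\Lambda$ satisfy (a)–(c), where $\hat{\mathcal A}$ is a Hopf $*$-algebra and $\hat\Lambda$ is indexed by $\mathcal I$; let $\phi_{\mathcal A}:\mathcal A\to\hat{\mathcal A}$ be an isomorphism of Hopf $*$-algebras such that $\phi_{\mathcal A}(\Lambda)=M\hat\Lambda M^{-1}$ for an invertible matrix $M=\bar M$, and let $c\in\mathbb R\setminus\{0\}$, $h_i\in\mathbb R$. Then $\overline{\hat\Lambda}=\hat\Lambda$, and there exist an inhomogeneous quantum group described by $\hat{\mathcal B},\hat{\mathcal A},\hat\Delta,\hat\Lambda,\hat p,\hat f,\hat\eta,\hat T$, with $\hat f,\hat\eta,\hat T$ given by (ii), (iii), where $\hat{\mathcal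 B}$ is a Hopf $*$-algebra whose $*$ extends that of $\hat{\mathcal A}$ and $\hat p_i^*=\hat p_i$, and an isomorphism of Hopf $*$-algebras $\phi:\mathcal B\to\hat{\mathcal B}$ such that $\phi|_{\mathcal A}=\phi_{\mathcal A}$ and (i) holds. -/

import Mathlib

open scoped TensorProduct Kronecker ComplexConjugate

universe u v u' v' w w'

namespace InhomQG

section HopfAlgebraNotions

variable {A : Type*} [Ring A] [HopfAlgebra ℂ A]

/-- The element `a * ρ = (ρ ⊗ id) Δ(a)`. -/
noncomputable def convRight (a : A) (ρ : Module.Dual ℂ A) : A :=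
  TensorProduct.lid ℂ A (ρ.rTensor A (Coalgebra.comul a))

/-- The element `ρ * a = (id ⊗ ρ) Δ(a)`. -/
noncomputable def convLeft (ρ : Module.Dual ℂ A) (a : A) : A :=
  TensorProduct.rid ℂ A (ρ.lTensor A (Coalgebra.comul a))

/-- A (matrix) representation: `Δ v_ij = ∑_k v_ik ⊗ v_kj` and `ε(v_ij) = δ_ij`. -/
def IsRep {n : Type*} [Fintype n] [DecidableEq n] (v : Matrix n n A) : Prop :=
  ∀ i j, Coalgebra.comul (R := ℂ) (v i j) = ∑ k, v i k ⊗ₜ[ℂ] v k j ∧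
    Coalgebra.counit (R := ℂ) (v i j) = if i = j then 1 else 0

/-- A subspace `W` of the carrier space `ℂⁿ` of `v` is invariant if `v x ∈ A ⊗ W` for `x ∈ W`,
i.e. if it is mapped into itself by all the matrices `φ(v)`, `φ` a linear functional on `A`. -/
def IsInvariant {n : Type*} [Fintype n] (v : Matrix n n A) (W : Submodule ℂ (n → ℂ)) : Prop :=
  ∀ φ : Module.Dual ℂ A, ∀ x ∈ W, (v.map φ).mulVec x ∈ W

/-- Irreducible representations (of nonzero dimension). -/
def IsIrrep {n : Type*} [Fintype n] [DecidableEq n] (v : Matrix n n A) : Prop :=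
  IsRep v ∧ Nonempty n ∧ ∀ W : Submodule ℂ (n → ℂ), IsInvariant v W → W = ⊥ ∨ W = ⊤

/-- Complete reducibility: every invariant subspace has an invariant complement. -/
def IsCompletelyReducible {n : Type*} [Fintype n] (v : Matrix n n A) : Prop :=
  ∀ W : Submodule ℂ (n → ℂ), IsInvariant v W → ∃ W', IsInvariant v W' ∧ IsCompl W W'

/-- `X ∈ Mor(v, w)`: the scalar matrix `X` satisfies `X v = w X`. The tensor product
`(v ⊗ w)_{ij,kl} = v_ik w_jl` of representations is the Kronecker product `v ⊗ₖ w`. -/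
def IsMor {n m : Type*} [Fintype n] [Fintype m] (v : Matrix n n A) (w : Matrix m m A)
    (X : Matrix m n ℂ) : Prop :=
  X.map (algebraMap ℂ A) * v = w * X.map (algebraMap ℂ A)

variable (A) in
/-- A Hopf `*`-algebra structure on the complex Hopf algebra `A`: a conjugate-linear,
antimultiplicative involution `*` with `Δ ∘ * = (* ⊗ *) ∘ Δ`. -/
structure HopfStar where
  /-- the involution -/
  star : A →ₛₗ[starRingEnd ℂ] A
  star_mul : ∀ a b, star (a * b) = star b * star a
  star_star : ∀ a, star (star a) = a
  comul_star : ∀ a, Coalgebra.comul (R := ℂ) (star a) =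
    TensorProduct.map star star (Coalgebra.comul (R := ℂ) a)

/-- The standing assumptions on the homogeneous part: `A` has an invertible antipode, every
representation is completely reducible, `Λ` is an irreducible representation, and
`Mor(v ⊗ w, Λ ⊗ v ⊗ w) = 0` for all irreducible representations `v`, `w`. -/
structure IsHomogeneousPart {I : Type*} [Fintype I] [DecidableEq I] (Λ : Matrix I I A) :
    Prop where
  antipode_bijective : Function.Bijective (HopfAlgebra.antipode ℂ : A →ₗ[ℂ] A)
  completelyReducible : ∀ (n : ℕ) (v : Matrix (Fin n) (Fin n) A),
    IsRep v → IsCompletelyReducible v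
  irrep : IsIrrep Λ
  mor_eq_zero : ∀ (n m : ℕ) (v : Matrix (Fin n) (Fin n) A) (w : Matrix (Fin m) (Fin m) A),
    IsIrrep v → IsIrrep w →
      ∀ X : Matrix (I × (Fin n × Fin m)) (Fin n × Fin m) ℂ,
        IsMor (v ⊗ₖ w) (Λ ⊗ₖ (v ⊗ₖ w)) X → X = 0

end HopfAlgebraNotions

section Coefficients

variable {I : Type*} {A : Type*} [Ring A] [HopfAlgebra ℂ A]

/-- `R_{ij,sm} = f_im(Λ_js)`. -/
def Rmat (Λ : Matrix I I A) (f : Matrix I I (Module.Dual ℂ A)) : Matrix (I × I) (I × I) ℂ :=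
  Matrix.of fun ij sm => f ij.1 sm.2 (Λ ij.2 sm.1)

/-- `Z_{ij,m} = η_i(Λ_jm)`. -/
def Zmat (Λ : Matrix I I A) (η : I → Module.Dual ℂ A) : Matrix (I × I) I ℂ :=
  Matrix.of fun ij m => η ij.1 (Λ ij.2 m)

end Coefficients

section InhomogeneousQuantumGroup

variable {I : Type*} [Fintype I] [DecidableEq I]
variable {A : Type*} [Ring A] [HopfAlgebra ℂ A] {B : Type*} [Ring B] [HopfAlgebra ℂ B]

/-- `B¹ = A · span{p_i, 1 : i ∈ I} ⊆ B`, where `A` is embedded in `B` by `ι`. -/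
def firstFiltration (ι : A →ₐc[ℂ] B) (p : I → B) : Submodule ℂ B :=
  Submodule.span ℂ (Set.range ι ∪ Set.range fun x : A × I => ι x.1 * p x.2)

/-- `B, A, Δ, Λ, p, f, η, T` describe an inhomogeneous quantum group. The Hopf algebra `A` is
embedded in `B` by `ι`.

Apart from the standing assumptions on `(A, Λ)`, the first block of fields says that `B` is
generated by the sub-bialgebra `A` and by elements `p_i`, not all in `A`, such that
`(Λ p; 0 1)` is a representation and `A·span{p_i} + A` is a right `A`-module.
The second block says that `f` and `η` are the coefficients of the commutation relations between
the `p_i` and `A`; the third one that `R² = 1` and that there are as many quadratic relations among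
the `p_i` as possible: a scalar row vector `x` is the leading coefficient of such a relation iff
`x (R + 1) = 0`. The last block says that `T`, normalized by `R T = -T`, gives the inhomogeneous
terms of the quadratic relations
`(R - 1)_{kl,ij} (p_i p_j - η_i(Λ_js) p_s + T_ij - Λ_im Λ_jn T_mn) = 0`. -/
structure IsInhomogeneousQG (Λ : Matrix I I A) (ι : A →ₐc[ℂ] B) (p : I → B)
    (f : Matrix I I (Module.Dual ℂ A)) (η : I → Module.Dual ℂ A) (T : I × I → ℂ) : Prop
    extends IsHomogeneousPart Λ where
  generated : Algebra.adjoin ℂ (Set.range ι ∪ Set.range p) = ⊤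
  injective : Function.Injective ι
  comul_p : ∀ i, Coalgebra.comul (R := ℂ) (p i) =
    ∑ j, ι (Λ i j) ⊗ₜ[ℂ] p j + p i ⊗ₜ[ℂ] (1 : B)
  counit_p : ∀ i, Coalgebra.counit (R := ℂ) (p i) = 0
  exists_notMem : ∃ i, p i ∉ Set.range ι
  bimodule : ∀ x ∈ firstFiltration ι p, ∀ a : A, x * ι a ∈ firstFiltration ι p
  f_one : ∀ s t, f s t 1 = if s = t then 1 else 0
  f_mul : ∀ s t a b, f s t (a * b) = ∑ m, f s m a * f m t b
  η_one : ∀ s, η s 1 = 0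
  η_mul : ∀ s a b, η s (a * b) = η s a * Coalgebra.counit (R := ℂ) b + ∑ t, f s t a * η t b
  Λ_f : ∀ s r a, ∑ t, Λ s t * convLeft (f t r) a = ∑ t, convRight a (f s t) * Λ t r
  p_mul : ∀ s a, p s * ι a = ∑ t, ι (convRight a (f s t)) * p t +
    (ι (convRight a (η s)) - ∑ t, ι (Λ s t * convLeft (η t) a))
  R_sq : Rmat Λ f * Rmat Λ f = 1
  quadratic : ∀ x : I × I → ℂ, Matrix.vecMul x (Rmat Λ f + 1) = 0 ↔
    ∃ (b : I → A) (c : A),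
      ∑ ij : I × I, x ij • (p ij.1 * p ij.2) + ∑ i, ι (b i) * p i + ι c = 0
  R_T : Matrix.mulVec (Rmat Λ f) T = -T
  p_mul_p : ∀ kl : I × I, ∑ ij : I × I, (Rmat Λ f - 1) kl ij •
    (p ij.1 * p ij.2 - ∑ s, η ij.1 (Λ ij.2 s) • p s + algebraMap ℂ B (T ij)
      - ∑ mn : I × I, T mn • ι (Λ ij.1 mn.1 * Λ ij.2 mn.2)) = 0

/-- The involution of `B` restricts to that of `A`. -/
def ExtendsStar (ι : A →ₐc[ℂ] B) (sA : HopfStar A) (sB : HopfStar B) : Prop :=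
  ∀ a, sB.star (ι a) = ι (sA.star a)

/-- An isomorphism of Hopf algebras which is compatible with the involutions. -/
def IsStarIso (sA : HopfStar A) (sB : HopfStar B) (φ : A ≃ₐc[ℂ] B) : Prop :=
  ∀ a, φ (sA.star a) = sB.star (φ a)

/-- `p'_i = m p_i + n_i - Λ_ij n_j`. -/
noncomputable def shiftedGenerator (Λ : Matrix I I A) (ι : A →ₐc[ℂ] B) (p : I → B) (m : ℂ)
    (n : I → ℂ) (i : I) : B :=
  m • p i + algebraMap ℂ B (n i) - ∑ j, n j • ι (Λ i j)

end InhomogeneousQuantumGroup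

section ChangeOfData

variable {I : Type*} [Fintype I] [DecidableEq I]
variable {A : Type*} [Ring A] [HopfAlgebra ℂ A] {A' : Type*} [Ring A'] [HopfAlgebra ℂ A']

/-- `(M⁻¹ ⊗ M⁻¹) R (M ⊗ M)`. -/
noncomputable def hatR (M : Matrix I I ℂ) (R : Matrix (I × I) (I × I) ℂ) :
    Matrix (I × I) (I × I) ℂ :=
  (M⁻¹ ⊗ₖ M⁻¹) * R * (M ⊗ₖ M)

/-- `(M⁻¹ f M) ∘ φ⁻¹`. -/
noncomputable def hatF (φ : A ≃ₐc[ℂ] A') (M : Matrix I I ℂ) (f : Matrix I I (Module.Dual ℂ A)) :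
    Matrix I I (Module.Dual ℂ A') :=
  Matrix.of fun i j => (∑ k, ∑ l, (M⁻¹ i k * M l j) • f k l) ∘ₗ
    ((φ.symm : A' ≃ₐ[ℂ] A).toLinearMap)

/-- `c⁻¹ M⁻¹ (η + f M h - ε M h) ∘ φ⁻¹`. -/
noncomputable def hatEta (φ : A ≃ₐc[ℂ] A') (M : Matrix I I ℂ) (c : ℂ) (h : I → ℂ)
    (f : Matrix I I (Module.Dual ℂ A)) (η : I → Module.Dual ℂ A) : I → Module.Dual ℂ A' :=
  fun i => (c⁻¹ • ∑ j, M⁻¹ i j • (η j + ∑ k, M.mulVec h k • f j k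
    - M.mulVec h j • (Coalgebra.counit : A →ₗ[ℂ] ℂ))) ∘ₗ
      ((φ.symm : A' ≃ₐ[ℂ] A).toLinearMap)

/-- `c⁻² (M⁻¹ ⊗ M⁻¹) T + (2c²)⁻¹ (1 - R') [-(M⁻¹ ⊗ M⁻¹) Z M h + h ⊗ h]` with
`R' = (M⁻¹ ⊗ M⁻¹) R (M ⊗ M)`. -/
noncomputable def hatT (M : Matrix I I ℂ) (c : ℂ) (h : I → ℂ) (R : Matrix (I × I) (I × I) ℂ)
    (Z : Matrix (I × I) I ℂ) (T : I × I → ℂ) : I × I → ℂ :=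
  (c ^ 2)⁻¹ • (M⁻¹ ⊗ₖ M⁻¹).mulVec T +
    (2 * c ^ 2)⁻¹ • (1 - hatR M R).mulVec
      (-(M⁻¹ ⊗ₖ M⁻¹).mulVec (Z.mulVec (M.mulVec h)) + fun ij => h ij.1 * h ij.2)

/-- `φ(Λ) = M Λ' M⁻¹`. -/
def Intertwines (φ : A ≃ₐc[ℂ] A') (M : Matrix I I ℂ) (Λ : Matrix I I A) (Λ' : Matrix I I A') :
    Prop :=
  Λ.map φ = M.map (algebraMap ℂ A') * Λ' * M⁻¹.map (algebraMap ℂ A')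

end ChangeOfData

end InhomQG

open InhomQG

set_option linter.unusedSectionVars false

/-! Everything rests on two structural facts about `B`: it is presented by its defining relations,
and the solutions `x` of `Δ x_i = Λ_ij ⊗ x_j + x_i ⊗ 1` are exactly the vectors `m p + n - Λ n`.

Presentation (`SatisfiesRelations.exists_lift`). In any algebra containing a solution of the
relations, `q_i q_s = R_{is,mt} q_m q_t` modulo shorter words. The quantum symmetrizer of degree `n`
built from `R` therefore acts on words of length `n` as the number `n!`, modulo shorter words, so a
combination whose leading part it kills can be shortened (`polyEval_mem_filt`). Conversely,
irreducibility of `Λ` and the presence of some `p_i` outside `A` give functionals `g_k` on `B` that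
vanish on `A` and are dual to the `p_i` over `A` (`exists_dual`). Contracting the right leg of `Δ`
with `g_k` differentiates a word and lowers its degree, and by induction a combination that reduces
in `B` must have its leading part killed by the symmetrizer
(`SatisfiesRelations.symmetrizer_eq_zero`). Comparing `B` with `B × D` shows that every relation
valid in `B` is valid in every other solution `D`. The same argument makes the maximality of the
quadratic relations automatic (`quadratic_iff`), so new data need only be checked against the
relations themselves. The symmetrizer is defined by recursion rather than by reduced words, so no
braid equation enters.

Solutions of the coproduct equation (`exists_eq_shiftedGenerator`). Contractions of `x_i` with the
`g_k` lie in `A`, so `x_i` has degree at most one; contraction on the other side makes its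
coefficients scalar, Schur's lemma makes the coefficient matrix `m · 1`, and complete reducibility
splits the remaining cocycle in `A`.

Part 1. The elements `p_i^*` solve the coproduct equation, so `p^* = m p + n - Λ n`; one of `p +
p^*` and `i (p - p^*)` has nonzero coefficient at `p`.

Part 2. An involution is an algebra homomorphism from `B` to its conjugate opposite algebra `ConjOp
B`. By the presentation it exists as soon as the `p_i` satisfy the relations there. These relations
amount to the stated reality conditions: for `f` by uniqueness of the convolution inverse, for `η`
by the vanishing of `Mor(v ⊗ w, Λ ⊗ v ⊗ w)`, for `T` because `R - 1` equals `-2` on the vectors in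
question (`star_conditions`, `quad_star_iff`).

Part 3. A Hopf algebra with completely reducible representations that embeds in `B` lies in `A`
(`apply_mem_range`), so isomorphisms preserve `A`, and the degree criterion shows that they preserve
`B¹`. For (i), `M⁻¹ φ(p)` solves the coproduct equation for the new matrix. The formulas (ii) and
(iii) follow by composing transport along `φ`, a change of basis by `M` and a shift by `(c, h)`
(`changeOfData`). -/

namespace InhomQG

/-! ### Convolution of functionals with elements and with each other. -/

section Convolution

variable {A : Type*} [Ring A] [HopfAlgebra ℂ A]

/-- The convolution product of linear functionals. -/
noncomputable def conv (ρ σ : Module.Dual ℂ A) : Module.Dual ℂ A :=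
  LinearMap.mul' ℂ ℂ ∘ₗ TensorProduct.map ρ σ ∘ₗ Coalgebra.comul

/-- `convRight` as a linear map in its first argument. -/
noncomputable def convRightL (ρ : Module.Dual ℂ A) : A →ₗ[ℂ] A :=
  (TensorProduct.lid ℂ A).toLinearMap ∘ₗ ρ.rTensor A ∘ₗ Coalgebra.comul

/-- `convLeft` as a linear map in its second argument. -/
noncomputable def convLeftL (ρ : Module.Dual ℂ A) : A →ₗ[ℂ] A :=
  (TensorProduct.rid ℂ A).toLinearMap ∘ₗ ρ.lTensor A ∘ₗ Coalgebra.comul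

@[simp] lemma convRightL_apply (ρ : Module.Dual ℂ A) (a : A) : convRightL ρ a = convRight a ρ := rfl

@[simp] lemma convLeftL_apply (ρ : Module.Dual ℂ A) (a : A) : convLeftL ρ a = convLeft ρ a := rfl

lemma convLeft_add (ρ : Module.Dual ℂ A) (a b : A) :
    convLeft ρ (a + b) = convLeft ρ a + convLeft ρ b := map_add (convLeftL ρ) a b

variable {ι : Type*} {a : A}

lemma convRight_repr (r : Coalgebra.Repr ℂ a ι) (ρ : Module.Dual ℂ A) :
    convRight a ρ = ∑ i ∈ r.index, ρ (r.left i) • r.right i := by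
  rw [convRight, ← r.eq]; simp [map_sum]

lemma convLeft_repr (r : Coalgebra.Repr ℂ a ι) (ρ : Module.Dual ℂ A) :
    convLeft ρ a = ∑ i ∈ r.index, ρ (r.right i) • r.left i := by
  rw [convLeft, ← r.eq]; simp [map_sum]

lemma conv_repr (r : Coalgebra.Repr ℂ a ι) (ρ σ : Module.Dual ℂ A) :
    conv ρ σ a = ∑ i ∈ r.index, ρ (r.left i) * σ (r.right i) := by
  simp only [conv, LinearMap.comp_apply]; rw [← r.eq]; simp [map_sum]

lemma convRight_add_right (a : A) (ρ σ : Module.Dual ℂ A) :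
    convRight a (ρ + σ) = convRight a ρ + convRight a σ := by
  simp [convRight_repr (Coalgebra.Repr.arbitrary ℂ a), add_smul, Finset.sum_add_distrib]

lemma convLeft_add_left (a : A) (ρ σ : Module.Dual ℂ A) :
    convLeft (ρ + σ) a = convLeft ρ a + convLeft σ a := by
  simp [convLeft_repr (Coalgebra.Repr.arbitrary ℂ a), add_smul, Finset.sum_add_distrib]

lemma convRight_smul_right (a : A) (z : ℂ) (ρ : Module.Dual ℂ A) :
    convRight a (z • ρ) = z • convRight a ρ := by
  simp [convRight_repr (Coalgebra.Repr.arbitrary ℂ a), mul_smul, Finset.smul_sum]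

lemma convLeft_smul_left (a : A) (z : ℂ) (ρ : Module.Dual ℂ A) :
    convLeft (z • ρ) a = z • convLeft ρ a := by
  simp [convLeft_repr (Coalgebra.Repr.arbitrary ℂ a), mul_smul, Finset.smul_sum]

lemma convRight_sub_right (a : A) (ρ σ : Module.Dual ℂ A) :
    convRight a (ρ - σ) = convRight a ρ - convRight a σ := by
  simp [convRight_repr (Coalgebra.Repr.arbitrary ℂ a), sub_smul, Finset.sum_sub_distrib]

lemma convLeft_sub_left (a : A) (ρ σ : Module.Dual ℂ A) :
    convLeft (ρ - σ) a = convLeft ρ a - convLeft σ a := by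
  simp [convLeft_repr (Coalgebra.Repr.arbitrary ℂ a), sub_smul, Finset.sum_sub_distrib]

lemma convRight_sum_right {κ : Type*} (s : Finset κ) (a : A) (ρ : κ → Module.Dual ℂ A) :
    convRight a (∑ k ∈ s, ρ k) = ∑ k ∈ s, convRight a (ρ k) := by
  simp only [convRight_repr (Coalgebra.Repr.arbitrary ℂ a), LinearMap.sum_apply, Finset.sum_smul]
  exact Finset.sum_comm

lemma convLeft_sum_left {κ : Type*} (s : Finset κ) (a : A) (ρ : κ → Module.Dual ℂ A) :
    convLeft (∑ k ∈ s, ρ k) a = ∑ k ∈ s, convLeft (ρ k) a := by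
  simp only [convLeft_repr (Coalgebra.Repr.arbitrary ℂ a), LinearMap.sum_apply, Finset.sum_smul]
  exact Finset.sum_comm

lemma conv_eq_convRight (ρ σ : Module.Dual ℂ A) (a : A) : conv ρ σ a = σ (convRight a ρ) := by
  simp [conv_repr (Coalgebra.Repr.arbitrary ℂ a), convRight_repr (Coalgebra.Repr.arbitrary ℂ a),
    map_sum]

lemma conv_eq_convLeft (ρ σ : Module.Dual ℂ A) (a : A) : conv ρ σ a = ρ (convLeft σ a) := by
  simp [conv_repr (Coalgebra.Repr.arbitrary ℂ a), convLeft_repr (Coalgebra.Repr.arbitrary ℂ a),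
    map_sum, mul_comm]

@[simp] lemma convRight_counit (a : A) : convRight a (Coalgebra.counit : A →ₗ[ℂ] ℂ) = a := by
  simp [convRight]

@[simp] lemma convLeft_counit (a : A) : convLeft (Coalgebra.counit : A →ₗ[ℂ] ℂ) a = a := by
  simp [convLeft]

@[simp] lemma counit_convRight (a : A) (ρ : Module.Dual ℂ A) :
    Coalgebra.counit (R := ℂ) (convRight a ρ) = ρ a := by
  have := conv_eq_convRight ρ (Coalgebra.counit : A →ₗ[ℂ] ℂ) a
  rw [conv_eq_convLeft, convLeft_counit] at this
  exact this.symm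

/-- Applying functionals to two of the three legs of the iterated coproduct. -/
lemma triple_aux (a : A) {N : Type*} [AddCommGroup N] [Module ℂ N]
    (Φ : A ⊗[ℂ] (A ⊗[ℂ] A) →ₗ[ℂ] N) (L R : A ⊗[ℂ] A →ₗ[ℂ] N)
    (hL : Φ ∘ₗ (Coalgebra.comul (R := ℂ) (A := A)).lTensor A = L)
    (hR : Φ ∘ₗ (TensorProduct.assoc ℂ A A A).toLinearMap ∘ₗ
      (Coalgebra.comul (R := ℂ) (A := A)).rTensor A = R) :
    L (Coalgebra.comul a) = R (Coalgebra.comul a) := by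
  rw [← hL, ← hR]
  simp only [LinearMap.comp_apply, LinearEquiv.coe_coe]
  rw [Coalgebra.coassoc_apply]

lemma convRight_convRight (a : A) (ρ σ : Module.Dual ℂ A) :
    convRight (convRight a ρ) σ = convRight a (conv ρ σ) := by
  refine triple_aux a
    ((TensorProduct.lid ℂ A).toLinearMap ∘ₗ TensorProduct.map ρ
      ((TensorProduct.lid ℂ A).toLinearMap ∘ₗ σ.rTensor A))
    (convRightL σ ∘ₗ (TensorProduct.lid ℂ A).toLinearMap ∘ₗ ρ.rTensor A)
    ((TensorProduct.lid ℂ A).toLinearMap ∘ₗ (conv ρ σ).rTensor A) ?_ ?_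
  · ext x y
    simp [convRight]
  · ext x y
    simp only [TensorProduct.AlgebraTensorModule.curry_apply, LinearMap.restrictScalars_self,
      TensorProduct.curry_apply, LinearMap.comp_apply, LinearMap.rTensor_tmul,
      LinearEquiv.coe_coe]
    rw [conv_repr (Coalgebra.Repr.arbitrary ℂ x), ← (Coalgebra.Repr.arbitrary ℂ x).eq]
    simp only [map_sum, TensorProduct.sum_tmul, TensorProduct.assoc_tmul, TensorProduct.map_tmul,
      LinearMap.comp_apply, LinearMap.rTensor_tmul, LinearEquiv.coe_coe, TensorProduct.lid_tmul,
      mul_smul]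

lemma convLeft_convLeft (a : A) (ρ σ : Module.Dual ℂ A) :
    convLeft ρ (convLeft σ a) = convLeft (conv ρ σ) a := by
  refine (triple_aux a
    ((TensorProduct.rid ℂ A).toLinearMap ∘ₗ TensorProduct.map LinearMap.id
      (LinearMap.mul' ℂ ℂ ∘ₗ TensorProduct.map ρ σ))
    ((TensorProduct.rid ℂ A).toLinearMap ∘ₗ (conv ρ σ).lTensor A)
    (convLeftL ρ ∘ₗ (TensorProduct.rid ℂ A).toLinearMap ∘ₗ σ.lTensor A) ?_ ?_).symm
  · ext x y
    simp [conv]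
  · ext x y
    simp only [TensorProduct.AlgebraTensorModule.curry_apply, LinearMap.restrictScalars_self,
      TensorProduct.curry_apply, LinearMap.comp_apply, LinearMap.rTensor_tmul,
      LinearEquiv.coe_coe, LinearMap.lTensor_tmul, TensorProduct.rid_tmul, convLeftL_apply]
    rw [← convLeftL_apply, map_smul, convLeftL_apply,
      convLeft_repr (Coalgebra.Repr.arbitrary ℂ x), ← (Coalgebra.Repr.arbitrary ℂ x).eq]
    simp [TensorProduct.sum_tmul, Finset.smul_sum, smul_smul, mul_comm]

lemma convRight_convLeft (a : A) (ρ σ : Module.Dual ℂ A) :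
    convRight (convLeft σ a) ρ = convLeft σ (convRight a ρ) := by
  refine (triple_aux a
    ((TensorProduct.lid ℂ A).toLinearMap ∘ₗ TensorProduct.map ρ
      ((TensorProduct.rid ℂ A).toLinearMap ∘ₗ σ.lTensor A))
    (convLeftL σ ∘ₗ (TensorProduct.lid ℂ A).toLinearMap ∘ₗ ρ.rTensor A)
    (convRightL ρ ∘ₗ (TensorProduct.rid ℂ A).toLinearMap ∘ₗ σ.lTensor A) ?_ ?_).symm
  · ext x y
    simp [convLeft]
  · ext x y
    simp only [TensorProduct.AlgebraTensorModule.curry_apply, LinearMap.restrictScalars_self,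
      TensorProduct.curry_apply, LinearMap.comp_apply, LinearMap.rTensor_tmul,
      LinearEquiv.coe_coe, LinearMap.lTensor_tmul, TensorProduct.rid_tmul, convRightL_apply]
    rw [← convRightL_apply, map_smul, convRightL_apply,
      convRight_repr (Coalgebra.Repr.arbitrary ℂ x), ← (Coalgebra.Repr.arbitrary ℂ x).eq]
    simp [TensorProduct.sum_tmul, Finset.smul_sum, smul_smul, mul_comm]

lemma conv_assoc (ρ σ τ : Module.Dual ℂ A) : conv (conv ρ σ) τ = conv ρ (conv σ τ) := by
  ext a
  rw [conv_eq_convRight, conv_eq_convRight ρ, ← convRight_convRight, conv_eq_convRight]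

lemma conv_sum_left {κ : Type*} (s : Finset κ) (ρ : κ → Module.Dual ℂ A) (σ : Module.Dual ℂ A) :
    conv (∑ k ∈ s, ρ k) σ = ∑ k ∈ s, conv (ρ k) σ := by
  ext a
  simp [conv_eq_convLeft]

lemma conv_sum_right {κ : Type*} (s : Finset κ) (ρ : κ → Module.Dual ℂ A) (σ : Module.Dual ℂ A) :
    conv σ (∑ k ∈ s, ρ k) = ∑ k ∈ s, conv σ (ρ k) := by
  ext a
  simp [conv_eq_convRight]

@[simp] lemma counit_conv (ρ : Module.Dual ℂ A) :
    conv (Coalgebra.counit : A →ₗ[ℂ] ℂ) ρ = ρ := by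
  ext a; simp [conv_eq_convRight]

@[simp] lemma conv_counit (ρ : Module.Dual ℂ A) :
    conv ρ (Coalgebra.counit : A →ₗ[ℂ] ℂ) = ρ := by
  ext a; simp [conv_eq_convLeft]

/-- A linear functional on `A` is determined by its values; separation of points. -/
lemma eq_of_forall_dual {V : Type*} [AddCommGroup V] [Module ℂ V] {x y : V}
    (h : ∀ φ : Module.Dual ℂ V, φ x = φ y) : x = y :=
  (Module.forall_dual_apply_eq_zero_iff ℂ (x - y)).1 (fun φ => by simp [h φ]) |> sub_eq_zero.1

end Convolution

/-! ### Matrix representations and the antipode. -/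

section Representations

variable {A : Type*} [Ring A] [HopfAlgebra ℂ A] {n : Type*} [Fintype n] [DecidableEq n]
  {v : Matrix n n A}

lemma IsRep.convRight (hv : IsRep v) (ρ : Module.Dual ℂ A) (i j : n) :
    convRight (v i j) ρ = ∑ k, ρ (v i k) • v k j := by
  rw [InhomQG.convRight, (hv i j).1]; simp [map_sum]

lemma IsRep.convLeft (hv : IsRep v) (ρ : Module.Dual ℂ A) (i j : n) :
    convLeft ρ (v i j) = ∑ k, ρ (v k j) • v i k := by
  rw [InhomQG.convLeft, (hv i j).1]; simp [map_sum]

lemma IsRep.conv (hv : IsRep v) (ρ σ : Module.Dual ℂ A) (i j : n) :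
    conv ρ σ (v i j) = ∑ k, ρ (v i k) * σ (v k j) := by
  rw [conv_eq_convRight, hv.convRight]; simp

lemma IsRep.mul_antipode (hv : IsRep v) (i j : n) :
    ∑ k, v i k * HopfAlgebra.antipode ℂ (v k j) = if i = j then 1 else 0 := by
  have h := HopfAlgebra.mul_antipode_lTensor_comul_apply (R := ℂ) (v i j)
  rw [(hv i j).1, (hv i j).2] at h
  simp only [map_sum, LinearMap.lTensor_tmul, LinearMap.mul'_apply] at h
  rw [h]; split_ifs <;> simp

lemma IsRep.antipode_mul (hv : IsRep v) (i j : n) :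
    ∑ k, HopfAlgebra.antipode ℂ (v i k) * v k j = if i = j then 1 else 0 := by
  have h := HopfAlgebra.mul_antipode_rTensor_comul_apply (R := ℂ) (v i j)
  rw [(hv i j).1, (hv i j).2] at h
  simp only [map_sum, LinearMap.rTensor_tmul, LinearMap.mul'_apply] at h
  rw [h]; split_ifs <;> simp

/-- The matrix `Δ(v)` has `Δ(S v)` as a left inverse and the flipped tensor product of antipodes as
a right inverse, so the two agree. -/
lemma IsRep.comul_antipode (hv : IsRep v) (i j : n) :
    Coalgebra.comul (R := ℂ) (HopfAlgebra.antipode ℂ (v i j)) =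
      ∑ k, HopfAlgebra.antipode ℂ (v k j) ⊗ₜ[ℂ] HopfAlgebra.antipode ℂ (v i k) := by
  set S : A →ₗ[ℂ] A := HopfAlgebra.antipode ℂ
  let V : Matrix n n (A ⊗[ℂ] A) := v.map (Bialgebra.comulAlgHom ℂ A)
  let U : Matrix n n (A ⊗[ℂ] A) := (v.map S).map (Bialgebra.comulAlgHom ℂ A)
  let W : Matrix n n (A ⊗[ℂ] A) := Matrix.of fun i j => ∑ k, S (v k j) ⊗ₜ[ℂ] S (v i k)
  have h1 : U * V = 1 := by
    ext i j
    simp only [U, V, Matrix.mul_apply, Matrix.map_apply, ← map_mul, ← map_sum]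
    rw [hv.antipode_mul, Matrix.one_apply]
    split_ifs <;> simp
  have h2 : V * W = 1 := by
    ext i j
    simp only [V, W, Matrix.mul_apply, Matrix.map_apply, Matrix.of_apply,
      Bialgebra.comulAlgHom_apply, (hv _ _).1, Finset.sum_mul, Finset.mul_sum,
      Algebra.TensorProduct.tmul_mul_tmul]
    calc ∑ x, ∑ y, ∑ z, (v i z * S (v y j)) ⊗ₜ[ℂ] (v z x * S (v x y))
        = ∑ y, ∑ z, (v i z * S (v y j)) ⊗ₜ[ℂ] (∑ x, v z x * S (v x y)) := by
          rw [Finset.sum_comm]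
          refine Finset.sum_congr rfl fun y _ => ?_
          rw [Finset.sum_comm]
          simp only [TensorProduct.tmul_sum]
      _ = _ := by
          simp only [S, hv.mul_antipode, TensorProduct.tmul_ite,
            Finset.sum_ite_eq', Finset.mem_univ, if_true, ← TensorProduct.sum_tmul]
          rw [Matrix.one_apply]; split_ifs <;> simp [Algebra.TensorProduct.one_def]
  have h3 : U = W := left_inv_eq_right_inv h1 h2
  have := congrFun (congrFun h3 i) j
  simpa [U, W] using this

end Representations


/-! ### Formal words in the generators and the filtration by degree. -/

section Words

variable {I : Type*} {A : Type*} [Ring A] [Algebra ℂ A] {D : Type*} [Ring D]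

/-- The product of the `q i` along a word. -/
def wordProd (q : I → D) (w : List I) : D := (w.map q).prod

@[simp] lemma wordProd_nil (q : I → D) : wordProd q [] = 1 := rfl

@[simp] lemma wordProd_cons (q : I → D) (i : I) (w : List I) :
    wordProd q (i :: w) = q i * wordProd q w := by simp [wordProd]

variable [Algebra ℂ D]

/-- The span of the elements `j a * q_{i₁} ⋯ q_{iₖ}` with `k < n`. -/
def filt (j : A →ₐ[ℂ] D) (q : I → D) (n : ℕ) : Submodule ℂ D :=
  Submodule.span ℂ {x | ∃ (a : A) (w : List I), w.length < n ∧ x = j a * wordProd q w}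

variable {j : A →ₐ[ℂ] D} {q : I → D}

lemma mul_wordProd_mem_filt (a : A) {w : List I} {n : ℕ} (h : w.length < n) :
    j a * wordProd q w ∈ filt j q n := Submodule.subset_span ⟨a, w, h, rfl⟩

lemma wordProd_mem_filt {w : List I} {n : ℕ} (h : w.length < n) :
    wordProd q w ∈ filt j q n := by
  simpa using mul_wordProd_mem_filt (j := j) (q := q) 1 h

lemma filt_mono {m n : ℕ} (h : m ≤ n) : filt j q m ≤ filt j q n :=
  Submodule.span_mono fun _ ⟨a, w, hw, hx⟩ => ⟨a, w, hw.trans_le h, hx⟩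

/-- The length bound is strict: level `0` is zero, level `1` is `A`, level `2` is `A · span{q_i} +
A`, and degree `n` means level `n + 1`. Inductions on degree can thus start from the zero space. -/
lemma filt_zero : filt j q 0 = ⊥ := by
  simp [filt]

lemma mem_filt_one {x : D} : x ∈ filt j q 1 ↔ ∃ a, x = j a := by
  constructor
  · intro h
    induction h using Submodule.span_induction with
    | mem x hx =>
      obtain ⟨a, w, hw, rfl⟩ := hx
      obtain rfl : w = [] := List.length_eq_zero_iff.1 (by omega)
      exact ⟨a, by simp⟩
    | zero => exact ⟨0, by simp⟩
    | add x y _ _ hx hy =>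
      obtain ⟨a, rfl⟩ := hx
      obtain ⟨b, rfl⟩ := hy
      exact ⟨a + b, by simp⟩
    | smul c x _ hx =>
      obtain ⟨a, rfl⟩ := hx
      exact ⟨c • a, by simp⟩
  · rintro ⟨a, rfl⟩
    simpa using mul_wordProd_mem_filt (j := j) (q := q) a (w := []) (n := 1) (by simp)

lemma apply_mem_filt (a : A) (n : ℕ) : j a ∈ filt j q (n + 1) :=
  filt_mono (by omega) (mem_filt_one.2 ⟨a, rfl⟩)

lemma apply_mul_gen_mem_filt (a : A) (i : I) (n : ℕ) : j a * q i ∈ filt j q (n + 2) := by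
  simpa using mul_wordProd_mem_filt (j := j) (q := q) a (w := [i]) (n := n + 2) (by simp)

lemma apply_mul_mem_filt (a : A) {n : ℕ} {x : D} (hx : x ∈ filt j q n) : j a * x ∈ filt j q n := by
  induction hx using Submodule.span_induction with
  | mem x hx =>
    obtain ⟨b, w, hw, rfl⟩ := hx
    rw [← mul_assoc, ← map_mul]
    exact mul_wordProd_mem_filt _ hw
  | zero => simp
  | add x y _ _ hx hy => rw [mul_add]; exact add_mem hx hy
  | smul c x _ hx => rw [mul_smul_comm]; exact Submodule.smul_mem _ _ hx

/-- The linear map from formal combinations of words to their values. -/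
noncomputable def wordEval (q : I → D) : (List I →₀ ℂ) →ₗ[ℂ] D :=
  Finsupp.linearCombination ℂ (wordProd q)

@[simp] lemma wordEval_single (q : I → D) (w : List I) (c : ℂ) :
    wordEval q (Finsupp.single w c) = c • wordProd q w := by simp [wordEval]

/-- Prefixing a letter. -/
noncomputable def consL (t : I) : (List I →₀ ℂ) →ₗ[ℂ] (List I →₀ ℂ) :=
  Finsupp.lmapDomain ℂ ℂ (List.cons t)

@[simp] lemma consL_single (t : I) (w : List I) (c : ℂ) :
    consL t (Finsupp.single w c) = Finsupp.single (t :: w) c := by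
  simp [consL, Finsupp.mapDomain_single]

@[simp] lemma wordEval_consL (q : I → D) (t : I) (x : List I →₀ ℂ) :
    wordEval q (consL t x) = q t * wordEval q x := by
  induction x using Finsupp.induction_linear with
  | zero => simp
  | add x y hx hy => simp [hx, hy, mul_add]
  | single w c => simp

/-- Formal combinations of words of length less than `n`. -/
noncomputable def wordsLT (I : Type*) (n : ℕ) : Submodule ℂ (List I →₀ ℂ) :=
  Submodule.span ℂ {x | ∃ w : List I, w.length < n ∧ x = Finsupp.single w 1}

lemma single_mem_wordsLT {w : List I} {n : ℕ} (h : w.length < n) :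
    Finsupp.single w 1 ∈ wordsLT I n := Submodule.subset_span ⟨w, h, rfl⟩

lemma wordsLT_mono {m n : ℕ} (h : m ≤ n) : wordsLT I m ≤ wordsLT I n :=
  Submodule.span_mono fun _ ⟨w, hw, hx⟩ => ⟨w, hw.trans_le h, hx⟩

lemma consL_mem_wordsLT (t : I) {n : ℕ} {x : List I →₀ ℂ} (hx : x ∈ wordsLT I n) :
    consL t x ∈ wordsLT I (n + 1) := by
  induction hx using Submodule.span_induction with
  | mem x hx =>
    obtain ⟨w, hw, rfl⟩ := hx
    rw [consL_single]
    exact single_mem_wordsLT (by simpa using hw)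
  | zero => simp
  | add x y _ _ hx hy => rw [map_add]; exact add_mem hx hy
  | smul c x _ hx => rw [map_smul]; exact Submodule.smul_mem _ _ hx

lemma wordEval_mem_filt {n : ℕ} {x : List I →₀ ℂ} (hx : x ∈ wordsLT I n) :
    wordEval q x ∈ filt j q n := by
  induction hx using Submodule.span_induction with
  | mem x hx =>
    obtain ⟨w, hw, rfl⟩ := hx
    simpa using wordProd_mem_filt hw
  | zero => simp
  | add x y _ _ hx hy => rw [map_add]; exact add_mem hx hy
  | smul c x _ hx => rw [map_smul]; exact Submodule.smul_mem _ _ hx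

/-- Evaluation of formal combinations of words with coefficients in `A`. -/
noncomputable def polyEval (j : A →ₐ[ℂ] D) (q : I → D) : A ⊗[ℂ] (List I →₀ ℂ) →ₗ[ℂ] D :=
  LinearMap.mul' ℂ D ∘ₗ TensorProduct.map j.toLinearMap (wordEval q)

@[simp] lemma polyEval_tmul (j : A →ₐ[ℂ] D) (q : I → D) (a : A) (x : List I →₀ ℂ) :
    polyEval j q (a ⊗ₜ x) = j a * wordEval q x := by simp [polyEval]

variable (A I) in
/-- Combinations of words of length less than `n` with coefficients in `A`. -/
noncomputable def polyLT (n : ℕ) : Submodule ℂ (A ⊗[ℂ] (List I →₀ ℂ)) :=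
  Submodule.span ℂ {x | ∃ (a : A) (w : List I), w.length < n ∧ x = a ⊗ₜ Finsupp.single w 1}

lemma tmul_single_mem_polyLT (a : A) {w : List I} {n : ℕ} (h : w.length < n) :
    a ⊗ₜ Finsupp.single w 1 ∈ polyLT I A n := Submodule.subset_span ⟨a, w, h, rfl⟩

lemma polyLT_mono {m n : ℕ} (h : m ≤ n) : polyLT I A m ≤ polyLT I A n :=
  Submodule.span_mono fun _ ⟨a, w, hw, hx⟩ => ⟨a, w, hw.trans_le h, hx⟩

lemma tmul_mem_polyLT (a : A) {n : ℕ} {x : List I →₀ ℂ} (hx : x ∈ wordsLT I n) :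
    a ⊗ₜ x ∈ polyLT I A n := by
  induction hx using Submodule.span_induction with
  | mem x hx =>
    obtain ⟨w, hw, rfl⟩ := hx
    exact tmul_single_mem_polyLT a hw
  | zero => simp
  | add x y _ _ hx hy => rw [TensorProduct.tmul_add]; exact add_mem hx hy
  | smul c x _ hx => rw [TensorProduct.tmul_smul]; exact Submodule.smul_mem _ _ hx

lemma map_polyEval_polyLT (n : ℕ) : (polyLT I A n).map (polyEval j q) = filt j q n := by
  rw [polyLT, Submodule.map_span, filt]
  congr 1
  ext x
  constructor
  · rintro ⟨_, ⟨a, w, hw, rfl⟩, rfl⟩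
    exact ⟨a, w, hw, by simp⟩
  · rintro ⟨a, w, hw, rfl⟩
    exact ⟨_, ⟨a, w, hw, rfl⟩, by simp⟩

lemma exists_mem_polyLT (t : A ⊗[ℂ] (List I →₀ ℂ)) : ∃ n, t ∈ polyLT I A n := by
  have hw : ∀ x : List I →₀ ℂ, ∃ n, x ∈ wordsLT I n := by
    intro x
    induction x using Finsupp.induction_linear with
    | zero => exact ⟨0, zero_mem _⟩
    | add x y hx hy =>
      obtain ⟨m, hm⟩ := hx
      obtain ⟨n, hn⟩ := hy
      exact ⟨max m n, add_mem (wordsLT_mono (le_max_left _ _) hm)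
        (wordsLT_mono (le_max_right _ _) hn)⟩
    | single w c =>
      refine ⟨w.length + 1, ?_⟩
      have := Submodule.smul_mem _ c (single_mem_wordsLT (Nat.lt_succ_self w.length))
      simpa using this
  induction t using TensorProduct.induction_on with
  | zero => exact ⟨0, zero_mem _⟩
  | tmul a x =>
    obtain ⟨n, hn⟩ := hw x
    exact ⟨n, tmul_mem_polyLT a hn⟩
  | add x y hx hy =>
    obtain ⟨m, hm⟩ := hx
    obtain ⟨n, hn⟩ := hy
    exact ⟨max m n, add_mem (polyLT_mono (le_max_left _ _) hm)
      (polyLT_mono (le_max_right _ _) hn)⟩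

/-- Evaluating the same formal combination in a product algebra compares its values in two solutions
of the relations. -/
lemma polyEval_prod {D' : Type*} [Ring D'] [Algebra ℂ D'] (j : A →ₐ[ℂ] D) (q : I → D)
    (j' : A →ₐ[ℂ] D') (q' : I → D') (t : A ⊗[ℂ] (List I →₀ ℂ)) :
    polyEval (j.prod j') (fun i => (q i, q' i)) t = (polyEval j q t, polyEval j' q' t) := by
  have hw : ∀ w : List I, wordProd (fun i => (q i, q' i)) w = (wordProd q w, wordProd q' w) := by
    intro w
    induction w with
    | nil => rfl
    | cons i w ih => simp [ih]
  have hx : ∀ x : List I →₀ ℂ,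
      wordEval (fun i => (q i, q' i)) x = (wordEval q x, wordEval q' x) := by
    intro x
    induction x using Finsupp.induction_linear with
    | zero => simp only [map_zero]; rfl
    | add x y hx hy => simp [hx, hy]
    | single w c => simp [hw]
  induction t using TensorProduct.induction_on with
  | zero => simp only [map_zero]; rfl
  | tmul a x => simp [hx]
  | add x y hx hy => simp [hx, hy]

end Words

/-! ### The quantum symmetrizer. -/

section Symmetrizer

variable {I : Type*} [Fintype I] [DecidableEq I] (R : Matrix (I × I) (I × I) ℂ)

/-- `splitFirst R w m` is the sum over all ways of bringing a letter of the word `w` to the front by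
means of `R`, where the first letter after the move is `m` and has been removed. -/
noncomputable def splitFirst : List I → I → (List I →₀ ℂ)
  | [], _ => 0
  | i :: w, m => (if i = m then Finsupp.single w 1 else 0) +
      ∑ s, ∑ t, R (i, s) (m, t) • consL t (splitFirst w s)

/-- The linear extension of `splitFirst`. -/
noncomputable def splitFirstL (m : I) : (List I →₀ ℂ) →ₗ[ℂ] (List I →₀ ℂ) :=
  Finsupp.linearCombination ℂ fun w => splitFirst R w m

@[simp] lemma splitFirstL_single (m : I) (w : List I) (c : ℂ) :
    splitFirstL R m (Finsupp.single w c) = c • splitFirst R w m := by simp [splitFirstL]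

/-- The quantum symmetrizer in degree `n`. -/
noncomputable def symmetrizer : ℕ → (List I →₀ ℂ) →ₗ[ℂ] (List I →₀ ℂ)
  | 0 => LinearMap.id
  | n + 1 => ∑ m, consL m ∘ₗ symmetrizer n ∘ₗ splitFirstL R m

lemma splitFirst_mem_wordsLT (w : List I) (m : I) : splitFirst R w m ∈ wordsLT I w.length := by
  induction w generalizing m with
  | nil => exact zero_mem _
  | cons i w ih =>
    rw [splitFirst]
    refine add_mem ?_ (sum_mem fun s _ => sum_mem fun t _ => Submodule.smul_mem _ _ ?_)
    · split_ifs
      · exact single_mem_wordsLT (by simp)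
      · exact zero_mem _
    · exact consL_mem_wordsLT t (ih s)

lemma splitFirstL_mem_wordsLT {n : ℕ} {x : List I →₀ ℂ} (hx : x ∈ wordsLT I (n + 1)) (m : I) :
    splitFirstL R m x ∈ wordsLT I n := by
  induction hx using Submodule.span_induction with
  | mem x hx =>
    obtain ⟨w, hw, rfl⟩ := hx
    simpa using wordsLT_mono (Nat.lt_succ_iff.1 hw) (splitFirst_mem_wordsLT R w m)
  | zero => simp
  | add x y _ _ hx hy => rw [map_add]; exact add_mem hx hy
  | smul c x _ hx => rw [map_smul]; exact Submodule.smul_mem _ _ hx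

end Symmetrizer

/-! ### Consequences of the relations in an arbitrary algebra. -/

section Relations

variable {I : Type*} [Fintype I] [DecidableEq I] {A : Type*} [Ring A] [HopfAlgebra ℂ A]
  {D : Type*} [Ring D] [Algebra ℂ D]

/-- The defining relations of an inhomogeneous quantum group, for elements `q i` of an algebra `D`
that `A` is mapped to by `j`. -/
structure SatisfiesRelations (Λ : Matrix I I A) (f : Matrix I I (Module.Dual ℂ A))
    (η : I → Module.Dual ℂ A) (T : I × I → ℂ) (j : A →ₐ[ℂ] D) (q : I → D) : Prop where
  q_mul : ∀ s a, q s * j a = ∑ t, j (convRight a (f s t)) * q t +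
    (j (convRight a (η s)) - ∑ t, j (Λ s t * convLeft (η t) a))
  q_mul_q : ∀ kl : I × I, ∑ ij : I × I, (Rmat Λ f - 1) kl ij •
    (q ij.1 * q ij.2 - ∑ s, η ij.1 (Λ ij.2 s) • q s + algebraMap ℂ D (T ij)
      - ∑ mn : I × I, T mn • j (Λ ij.1 mn.1 * Λ ij.2 mn.2)) = 0

variable {Λ : Matrix I I A} {f : Matrix I I (Module.Dual ℂ A)} {η : I → Module.Dual ℂ A}
  {T : I × I → ℂ} {j : A →ₐ[ℂ] D} {q : I → D}

namespace SatisfiesRelations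

/-- The commutation relation carries `q s` past a coefficient from `A`, leaving at most one extra
letter. -/
lemma gen_mul_mem (h : SatisfiesRelations Λ f η T j q) (s : I) {n : ℕ} {x : D}
    (hx : x ∈ filt j q n) : q s * x ∈ filt j q (n + 1) := by
  induction hx using Submodule.span_induction with
  | mem x hx =>
    obtain ⟨a, w, hw, rfl⟩ := hx
    rw [← mul_assoc, h.q_mul, add_mul, sub_mul, Finset.sum_mul, Finset.sum_mul]
    refine add_mem (sum_mem fun t _ => ?_) (sub_mem ?_ (sum_mem fun t _ => ?_))
    · rw [mul_assoc, ← wordProd_cons]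
      exact mul_wordProd_mem_filt _ (by simpa using hw)
    · exact mul_wordProd_mem_filt _ (by omega)
    · exact mul_wordProd_mem_filt _ (by omega)
  | zero => simp
  | add x y _ _ hx hy => rw [mul_add]; exact add_mem hx hy
  | smul c x _ hx => rw [mul_smul_comm]; exact Submodule.smul_mem _ _ hx

lemma gen_mul_mem_pred (h : SatisfiesRelations Λ f η T j q) (s : I) {n : ℕ} {x : D}
    (hx : x ∈ filt j q (n - 1)) : q s * x ∈ filt j q n := by
  rcases n with _ | n
  · rw [filt_zero, Submodule.mem_bot] at hx
    simp [hx]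
  · exact h.gen_mul_mem s hx

/-- Modulo lower terms, the products of two generators are fixed by `R`. -/
lemma sum_Rmat_mul_mem (h : SatisfiesRelations Λ f η T j q) (i s : I) {n : ℕ} {y : D}
    (hy : y ∈ filt j q n) :
    (∑ m, ∑ t, Rmat Λ f (i, s) (m, t) • (q m * (q t * y))) - q i * (q s * y) ∈
      filt j q (n + 1) := by
  -- The quadratic relation multiplied by `y` trades the difference for terms with at most one
  -- generator in front of `y`.
  have key : (∑ m, ∑ t, Rmat Λ f (i, s) (m, t) • (q m * (q t * y))) - q i * (q s * y) =
      ∑ ij : I × I, (Rmat Λ f - 1) (i, s) ij • ((∑ s, η ij.1 (Λ ij.2 s) • (q s * y))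
        - T ij • y + ∑ mn : I × I, T mn • (j (Λ ij.1 mn.1 * Λ ij.2 mn.2) * y)) := by
    have h0 := congrArg (· * y) (h.q_mul_q (i, s))
    simp only [zero_mul, Finset.sum_mul, smul_mul_assoc] at h0
    rw [← sub_eq_zero]
    rw [← h0, ← Fintype.sum_prod_type' (f := fun m t =>
      Rmat Λ f (i, s) (m, t) • (q m * (q t * y)))]
    have h1 : q i * (q s * y) = ∑ ij : I × I, (1 : Matrix (I × I) (I × I) ℂ) (i, s) ij •
        (q ij.1 * (q ij.2 * y)) := by
      simp [Matrix.one_apply, ite_smul]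
    rw [h1, ← Finset.sum_sub_distrib, ← Finset.sum_sub_distrib]
    refine Finset.sum_congr rfl fun ij _ => ?_
    rw [← sub_smul]
    change (Rmat Λ f - 1) (i, s) ij • (q ij.1 * (q ij.2 * y)) - _ = _
    rw [← smul_sub]
    congr 1
    simp only [sub_mul, add_mul, Finset.sum_mul, smul_mul_assoc, Algebra.algebraMap_eq_smul_one,
      one_mul, mul_assoc]
    abel
  rw [key]
  refine sum_mem fun ij _ => Submodule.smul_mem _ _ (add_mem (sub_mem (sum_mem fun s _ =>
    Submodule.smul_mem _ _ (h.gen_mul_mem s hy)) (Submodule.smul_mem _ _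
      (filt_mono (Nat.le_succ n) hy))) (sum_mem fun mn _ => Submodule.smul_mem _ _
        (filt_mono (Nat.le_succ n) (apply_mul_mem_filt _ hy))))

/-- Bringing any one of the letters to the front by `R` returns the word itself modulo shorter
words, and there are `w.length` letters to choose from. -/
lemma sum_gen_mul_splitFirst (h : SatisfiesRelations Λ f η T j q) (w : List I) :
    (∑ m, q m * wordEval q (splitFirst (Rmat Λ f) w m)) - (w.length : ℂ) • wordProd q w ∈
      filt j q w.length := by
  induction w with
  | nil => simp [splitFirst]
  | cons i w ih =>
    have e1 : ∑ m, q m * wordEval q (splitFirst (Rmat Λ f) (i :: w) m) =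
        q i * wordProd q w + ∑ s, ∑ m, ∑ t, Rmat Λ f (i, s) (m, t) •
          (q m * (q t * wordEval q (splitFirst (Rmat Λ f) w s))) := by
      simp only [splitFirst, map_add, map_sum, map_smul, mul_add, Finset.mul_sum,
        Finset.sum_add_distrib, wordEval_consL, mul_smul_comm]
      congr 1
      · simp [apply_ite (wordEval q)]
      · rw [Finset.sum_comm]
    have e2 : ∀ s, (∑ m, ∑ t, Rmat Λ f (i, s) (m, t) •
        (q m * (q t * wordEval q (splitFirst (Rmat Λ f) w s)))) -
        q i * (q s * wordEval q (splitFirst (Rmat Λ f) w s)) ∈ filt j q (w.length + 1) := fun s =>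
      h.sum_Rmat_mul_mem i s (wordEval_mem_filt (splitFirst_mem_wordsLT _ w s))
    have e3 := add_mem (sum_mem (t := Finset.univ) fun s _ => e2 s) (h.gen_mul_mem i ih)
    rw [e1, List.length_cons]
    convert e3 using 1
    rw [Finset.sum_sub_distrib, mul_sub, Finset.mul_sum, wordProd_cons,
      Nat.cast_succ, add_smul, one_smul, mul_smul_comm]
    abel

/-- The factorial is the product of the numbers of choices made at the successive steps of the
recursion. -/
lemma wordEval_symmetrizer (h : SatisfiesRelations Λ f η T j q) (n : ℕ) {x : List I →₀ ℂ}
    (hx : x ∈ wordsLT I (n + 1)) :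
    wordEval q (symmetrizer (Rmat Λ f) n x) - (n.factorial : ℂ) • wordEval q x ∈ filt j q n := by
  induction n generalizing x with
  | zero => simp [symmetrizer]
  | succ n ih =>
    have e1 : (∑ m, q m * wordEval q (splitFirstL (Rmat Λ f) m x)) -
        ((n + 1 : ℕ) : ℂ) • wordEval q x ∈ filt j q (n + 1) := by
      induction hx using Submodule.span_induction with
      | mem x hx =>
        obtain ⟨w, hw, rfl⟩ := hx
        simp only [splitFirstL_single, one_smul, wordEval_single]
        -- A word that is too short already lies in the target level, so the wrong multiple
        -- `w.length` can be corrected freely.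
        rcases (Nat.lt_succ_iff.1 hw).lt_or_eq with hlt | heq
        · have h1 := filt_mono hlt.le (h.sum_gen_mul_splitFirst w)
          have h2 : wordProd q w ∈ filt j q (n + 1) := wordProd_mem_filt hlt
          have h3 := add_mem h1 (Submodule.smul_mem _ ((w.length : ℂ) - ((n + 1 : ℕ) : ℂ)) h2)
          convert h3 using 1
          rw [sub_smul]; abel
        · rw [← heq]; exact h.sum_gen_mul_splitFirst w
      | zero => simp
      | add x y _ _ hx hy =>
        convert add_mem hx hy using 1
        simp only [map_add, mul_add, smul_add, Finset.sum_add_distrib]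
        abel
      | smul c x _ hx =>
        convert Submodule.smul_mem _ c hx using 1
        simp only [map_smul, mul_smul_comm, smul_sub, Finset.smul_sum]
        rw [smul_comm]
    have e2 := sum_mem (t := Finset.univ) fun m _ =>
      h.gen_mul_mem m (ih (splitFirstL_mem_wordsLT (Rmat Λ f) hx m))
    have e3 := add_mem e2 (Submodule.smul_mem _ (n.factorial : ℂ) e1)
    convert e3 using 1
    simp only [symmetrizer, LinearMap.sum_apply, LinearMap.comp_apply, map_sum, wordEval_consL,
      mul_sub, Finset.sum_sub_distrib, mul_smul_comm, ← Finset.smul_sum, smul_sub]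
    rw [Nat.factorial_succ, smul_smul, Nat.cast_mul, mul_comm ((n + 1 : ℕ) : ℂ)]
    abel

lemma polyEval_symmetrizer (h : SatisfiesRelations Λ f η T j q) (n : ℕ)
    {t : A ⊗[ℂ] (List I →₀ ℂ)} (ht : t ∈ polyLT I A (n + 1)) :
    polyEval j q ((symmetrizer (Rmat Λ f) n).lTensor A t) - (n.factorial : ℂ) • polyEval j q t ∈
      filt j q n := by
  induction ht using Submodule.span_induction with
  | mem x hx =>
    obtain ⟨a, w, hw, rfl⟩ := hx
    have := apply_mul_mem_filt (j := j) a (h.wordEval_symmetrizer n (single_mem_wordsLT hw))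
    simpa [mul_sub] using this
  | zero => simp
  | add x y _ _ hx hy =>
    convert add_mem hx hy using 1
    simp only [map_add, smul_add]
    abel
  | smul c x _ hx =>
    convert Submodule.smul_mem _ c hx using 1
    simp only [map_smul, smul_sub]
    rw [smul_comm]

/-- A combination of words of length at most `n` whose leading part is killed by the symmetrizer
can be reduced to shorter words. -/
lemma polyEval_mem_filt (h : SatisfiesRelations Λ f η T j q) (n : ℕ)
    {t : A ⊗[ℂ] (List I →₀ ℂ)} (ht : t ∈ polyLT I A (n + 1))
    (h0 : (symmetrizer (Rmat Λ f) n).lTensor A t = 0) : polyEval j q t ∈ filt j q n := by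
  have h1 := h.polyEval_symmetrizer n ht
  rw [h0, map_zero, zero_sub, neg_mem_iff] at h1
  -- Characteristic zero enters here: `n!` is invertible.
  exact (Submodule.smul_mem_iff _ (Nat.cast_ne_zero.2 n.factorial_ne_zero)).1 h1

lemma adjoin_mul_mem (h : SatisfiesRelations Λ f η T j q) {x : D}
    (hx : x ∈ Algebra.adjoin ℂ (Set.range j ∪ Set.range q)) :
    ∀ n, ∀ y ∈ filt j q n, ∃ m, x * y ∈ filt j q m := by
  induction hx using Algebra.adjoin_induction with
  | mem x hx =>
    intro n y hy
    rcases hx with ⟨a, rfl⟩ | ⟨i, rfl⟩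
    · exact ⟨n, apply_mul_mem_filt a hy⟩
    · exact ⟨n + 1, h.gen_mul_mem i hy⟩
  | algebraMap r =>
    intro n y hy
    exact ⟨n, by rw [← Algebra.smul_def]; exact Submodule.smul_mem _ _ hy⟩
  | add x x' _ _ hx hx' =>
    intro n y hy
    obtain ⟨m, hm⟩ := hx n y hy
    obtain ⟨m', hm'⟩ := hx' n y hy
    exact ⟨max m m', by
      rw [add_mul]
      exact add_mem (filt_mono (le_max_left _ _) hm) (filt_mono (le_max_right _ _) hm')⟩
  | mul x x' _ _ hx hx' =>
    intro n y hy
    obtain ⟨m, hm⟩ := hx' n y hy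
    obtain ⟨m', hm'⟩ := hx m _ hm
    exact ⟨m', by rwa [mul_assoc]⟩

lemma exists_mem_filt (h : SatisfiesRelations Λ f η T j q) {x : D}
    (hx : x ∈ Algebra.adjoin ℂ (Set.range j ∪ Set.range q)) : ∃ m, x ∈ filt j q m := by
  have := h.adjoin_mul_mem hx 1 1 (mem_filt_one.2 ⟨1, by simp⟩)
  simpa using this

/-- The algebra generated by solutions of the relations is spanned by ordered products. -/
lemma exists_polyEval_eq (h : SatisfiesRelations Λ f η T j q) {x : D}
    (hx : x ∈ Algebra.adjoin ℂ (Set.range j ∪ Set.range q)) : ∃ t, polyEval j q t = x := by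
  obtain ⟨m, hm⟩ := h.exists_mem_filt hx
  rw [← map_polyEval_polyLT] at hm
  obtain ⟨t, _, ht⟩ := hm
  exact ⟨t, ht⟩

/-- Applied to `B` and a second solution `D`, this allows words to be shortened simultaneously in
both. -/
lemma prod {D' : Type*} [Ring D'] [Algebra ℂ D'] {j' : A →ₐ[ℂ] D'} {q' : I → D'}
    (h : SatisfiesRelations Λ f η T j q) (h' : SatisfiesRelations Λ f η T j' q') :
    SatisfiesRelations Λ f η T (j.prod j') fun i => (q i, q' i) where
  q_mul s a := by
    ext
    · simpa [Prod.fst_sum] using h.q_mul s a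
    · simpa [Prod.snd_sum] using h'.q_mul s a
  q_mul_q kl := by
    ext
    · simpa [Prod.fst_sum] using h.q_mul_q kl
    · simpa [Prod.snd_sum] using h'.q_mul_q kl

end SatisfiesRelations

end Relations


/-! ### Functionals on the extension dual to the generators. -/

section Embedding

variable {I : Type*} [Fintype I] [DecidableEq I]
variable {A : Type*} [Ring A] [HopfAlgebra ℂ A] {B : Type*} [Ring B] [HopfAlgebra ℂ B]

lemma comul_apply_hom (ι : A →ₐc[ℂ] B) (a : A) : Coalgebra.comul (R := ℂ) (ι a) =
    TensorProduct.map ι.toAlgHom.toLinearMap ι.toAlgHom.toLinearMap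
      (Coalgebra.comul (R := ℂ) a) :=
  (CoalgHomClass.map_comp_comul_apply ι a).symm

lemma counit_apply_hom (ι : A →ₐc[ℂ] B) (a : A) : Coalgebra.counit (R := ℂ) (ι a) =
    Coalgebra.counit (R := ℂ) a := CoalgHomClass.counit_comp_apply ι a

lemma comul_apply_hom_repr (ι : A →ₐc[ℂ] B) {a : A} {κ : Type*} (r : Coalgebra.Repr ℂ a κ) :
    Coalgebra.comul (R := ℂ) (ι a) = ∑ k ∈ r.index, ι (r.left k) ⊗ₜ[ℂ] ι (r.right k) := by
  rw [comul_apply_hom, ← r.eq, map_sum]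
  rfl

/-- The retraction is merely linear; it extends functionals and the antipode from `A` to `B` without
any compatibility with products or coproducts. -/
lemma exists_retraction {ι : A →ₐc[ℂ] B} (hι : Function.Injective ι) :
    ∃ t : B →ₗ[ℂ] A, ∀ a, t (ι a) = a := by
  obtain ⟨t, ht⟩ := LinearMap.exists_leftInverse_of_injective ι.toAlgHom.toLinearMap
    (LinearMap.ker_eq_bot.2 hι)
  exact ⟨t, fun a => LinearMap.congr_fun ht a⟩

/-- Elements `p i` with `Δ p_i = Λ_ij ⊗ p_j + p_i ⊗ 1`, not all in `A`, where `Λ` is an irreducible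
representation of a Hopf algebra with bijective antipode. -/
structure IsPrimitiveExtension (Λ : Matrix I I A) (ι : A →ₐc[ℂ] B) (p : I → B) : Prop where
  antipode_bijective : Function.Bijective (HopfAlgebra.antipode ℂ : A →ₗ[ℂ] A)
  irrep : IsIrrep Λ
  injective : Function.Injective ι
  comul_p : ∀ i, Coalgebra.comul (R := ℂ) (p i) =
    ∑ j, ι (Λ i j) ⊗ₜ[ℂ] p j + p i ⊗ₜ[ℂ] (1 : B)
  exists_notMem : ∃ i, p i ∉ Set.range ι

/-- `q_i = S(Λ_ij) p_j`. -/
noncomputable def coinvGen (Λ : Matrix I I A) (ι : A →ₐc[ℂ] B) (p : I → B) (i : I) : B :=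
  ∑ j, ι (HopfAlgebra.antipode ℂ (Λ i j)) * p j

namespace IsPrimitiveExtension

variable {Λ : Matrix I I A} {ι : A →ₐc[ℂ] B} {p : I → B}

/-- Multiplying by `S(Λ)` turns the left legs `Λ_ij` of `Δ p_i` into `1` and moves the matrix to the
right leg as `S(Λ)`. -/
lemma comul_coinvGen (h : IsPrimitiveExtension Λ ι p) (i : I) :
    Coalgebra.comul (R := ℂ) (coinvGen Λ ι p i) = (1 : B) ⊗ₜ[ℂ] coinvGen Λ ι p i +
      ∑ k, coinvGen Λ ι p k ⊗ₜ[ℂ] ι (HopfAlgebra.antipode ℂ (Λ i k)) := by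
  set S : A →ₗ[ℂ] A := HopfAlgebra.antipode ℂ
  have h1 : ∀ j, Coalgebra.comul (R := ℂ) (ι (S (Λ i j)) * p j) =
      (∑ k, ∑ l, ι (S (Λ k j) * Λ j l) ⊗ₜ[ℂ] (ι (S (Λ i k)) * p l)) +
      ∑ k, (ι (S (Λ k j)) * p j) ⊗ₜ[ℂ] ι (S (Λ i k)) := by
    intro j
    rw [Bialgebra.comul_mul, comul_apply_hom, h.irrep.1.comul_antipode, h.comul_p]
    simp only [map_sum, TensorProduct.map_tmul, mul_add, Finset.sum_mul, Finset.mul_sum,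
      Algebra.TensorProduct.tmul_mul_tmul, mul_one]
    congr 1
    · rw [Finset.sum_comm]
      simp [S]
  simp only [coinvGen, map_sum]
  rw [Finset.sum_congr rfl fun j _ => h1 j, Finset.sum_add_distrib]
  congr 1
  · calc ∑ j, ∑ k, ∑ l, ι (S (Λ k j) * Λ j l) ⊗ₜ[ℂ] (ι (S (Λ i k)) * p l)
        = ∑ k, ∑ l, ι (∑ j, S (Λ k j) * Λ j l) ⊗ₜ[ℂ] (ι (S (Λ i k)) * p l) := by
          rw [Finset.sum_comm]
          refine Finset.sum_congr rfl fun k _ => ?_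
          rw [Finset.sum_comm]
          simp only [map_sum, TensorProduct.sum_tmul]
      _ = _ := by
          simp only [S, h.irrep.1.antipode_mul, TensorProduct.tmul_sum]
          refine Finset.sum_congr rfl fun k _ => ?_
          rw [Finset.sum_eq_single k]
          · simp
          · intro l _ hl
            simp [hl.symm]
          · simp
  · rw [Finset.sum_comm]
    simp only [TensorProduct.sum_tmul, S]

/-- The coefficient vectors of combinations lying in `A` form a space `V` stable under the
transposes of all `φ(Λ)`, so its annihilator `W` is `Λ`-invariant. If `W = 0`, then every `coinvGen
Λ ι p k`, and with it every `p_i`, would lie in `A`; irreducibility leaves only `W = ⊤`, that is `V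
= 0`. -/
lemma eq_zero_of_sum_coinvGen (h : IsPrimitiveExtension Λ ι p) {x : I → ℂ}
    (hx : ∑ i, x i • coinvGen Λ ι p i ∈ Set.range ι) : x = 0 := by
  obtain ⟨t, ht⟩ := exists_retraction h.injective
  set S : A →ₗ[ℂ] A := HopfAlgebra.antipode ℂ with hS
  let L : (I → ℂ) →ₗ[ℂ] B := Fintype.linearCombination ℂ (coinvGen Λ ι p)
  let V : Submodule ℂ (I → ℂ) := (LinearMap.range ι.toAlgHom.toLinearMap).comap L
  have hV : ∀ x : I → ℂ, x ∈ V ↔ ∃ a, ι a = ∑ i, x i • coinvGen Λ ι p i := by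
    intro x
    simp only [V, Submodule.mem_comap, LinearMap.mem_range, L, Fintype.linearCombination_apply]
    rfl
  have hinv : ∀ (φ : Module.Dual ℂ A), ∀ x ∈ V, (fun k => ∑ i, x i * φ (Λ i k)) ∈ V := by
    intro φ x hx
    obtain ⟨T, hT⟩ : ∃ T : A →ₗ[ℂ] A, ∀ a, T (S a) = a := by
      refine ⟨(LinearEquiv.ofBijective S h.antipode_bijective).symm.toLinearMap, fun a => ?_⟩
      exact (LinearEquiv.ofBijective S h.antipode_bijective).symm_apply_apply a
    obtain ⟨a, ha⟩ := (hV x).1 hx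
    -- The inverse `T` of the antipode is inserted so that contraction with `ψ` evaluates `S(Λ_ik)`
    -- to `φ(Λ_ik)`.
    let ψ : B →ₗ[ℂ] ℂ := φ ∘ₗ T ∘ₗ t
    have h1 := congrArg (convLeft ψ) ha
    have h2 : convLeft ψ (ι a) = ι (convLeft (φ ∘ₗ T) a) := by
      rw [convLeft_repr (Coalgebra.Repr.arbitrary ℂ a), convLeft,
        comul_apply_hom_repr ι (Coalgebra.Repr.arbitrary ℂ a)]
      simp [map_sum, ψ, ht]
    have h3 : ∀ i, convLeft ψ (coinvGen Λ ι p i) = algebraMap ℂ B (ψ (coinvGen Λ ι p i)) +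
        ∑ k, φ (Λ i k) • coinvGen Λ ι p k := by
      intro i
      rw [convLeft, h.comul_coinvGen]
      simp only [map_add, map_sum, LinearMap.lTensor_tmul, TensorProduct.rid_tmul]
      congr 1
      · rw [Algebra.algebraMap_eq_smul_one]
      · simp [ψ, ht, ← hS, hT]
    rw [h2, ← convLeftL_apply ψ, map_sum] at h1
    simp only [map_smul, convLeftL_apply, h3, smul_add, Finset.sum_add_distrib] at h1
    refine (hV _).2 ⟨convLeft (φ ∘ₗ T) a - ∑ i, x i • algebraMap ℂ A (ψ (coinvGen Λ ι p i)), ?_⟩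
    have h4 : ι (∑ i, x i • algebraMap ℂ A (ψ (coinvGen Λ ι p i))) =
        ∑ i, x i • algebraMap ℂ B (ψ (coinvGen Λ ι p i)) := by
      rw [map_sum]
      refine Finset.sum_congr rfl fun i _ => ?_
      rw [map_smul]
      congr 1
      exact ι.toAlgHom.commutes _
    rw [map_sub, h1, h4, add_sub_cancel_left]
    simp only [Finset.smul_sum, Finset.sum_smul, smul_smul]
    exact Finset.sum_comm
  let W : Submodule ℂ (I → ℂ) :=
    { carrier := {y | ∀ x ∈ V, ∑ i, x i * y i = 0}
      zero_mem' := by simp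
      add_mem' := by
        intro y z hy hz x hx
        simp [mul_add, Finset.sum_add_distrib, hy x hx, hz x hx]
      smul_mem' := by
        intro c y hy x hx
        simp only [Pi.smul_apply, smul_eq_mul, mul_left_comm _ c, ← Finset.mul_sum, hy x hx,
          mul_zero] }
  have hW : IsInvariant Λ W := by
    intro φ y hy x hx
    rw [← hy _ (hinv φ x hx)]
    simp only [Matrix.mulVec, dotProduct, Matrix.map_apply, Finset.mul_sum, Finset.sum_mul,
      mul_assoc]
    exact Finset.sum_comm
  have hxV : x ∈ V := (hV x).2 hx
  rcases h.irrep.2.2 W hW with hbot | htop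
  · exfalso
    have hVtop : V = ⊤ := by
      by_contra hne
      -- A functional vanishing on a proper `V` would be a nonzero vector of `W`.
      obtain ⟨φ, hφ, hle⟩ := Submodule.exists_le_ker_of_lt_top V (lt_top_iff_ne_top.2 hne)
      apply hφ
      have hy : (fun i => φ (Pi.single i 1)) ∈ W := by
        intro x hx
        have h1 : φ x = 0 := hle hx
        rw [← h1]
        conv_rhs => rw [← Finset.univ_sum_single x, map_sum]
        refine Finset.sum_congr rfl fun i _ => ?_
        rw [← smul_eq_mul, ← map_smul]
        congr 1
        ext k
        by_cases hk : k = i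
        · subst hk; simp
        · simp [hk]
      rw [hbot, Submodule.mem_bot] at hy
      refine LinearMap.pi_ext' fun i => ?_
      ext
      exact congrFun hy i
    obtain ⟨i, hi⟩ := h.exists_notMem
    have h1 : ∀ k, ∃ a, ι a = coinvGen Λ ι p k := by
      intro k
      obtain ⟨a, ha⟩ := (hV (Pi.single k 1)).1 (hVtop ▸ Submodule.mem_top)
      refine ⟨a, ha.trans ?_⟩
      rw [Finset.sum_eq_single k] <;> simp +contextual
    choose b hb using h1
    apply hi
    refine ⟨∑ k, Λ i k * b k, ?_⟩
    simp only [map_sum, map_mul, hb, coinvGen, Finset.mul_sum, ← mul_assoc]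
    rw [Finset.sum_comm]
    simp only [← Finset.sum_mul, ← map_mul, ← map_sum, h.irrep.1.mul_antipode]
    simp
  · funext i
    have : (Pi.single i 1 : I → ℂ) ∈ W := htop ▸ Submodule.mem_top
    simpa [Pi.single_apply] using this x hxV

/-- Functionals on `B` that vanish on `A` and are dual to the `p i` over `A`. -/
lemma exists_dual (h : IsPrimitiveExtension Λ ι p) : ∃ g : I → Module.Dual ℂ B,
    (∀ k a, g k (ι a) = 0) ∧
    ∀ k i a, g k (ι a * p i) = if i = k then Coalgebra.counit (R := ℂ) a else 0 := by
  obtain ⟨t, ht⟩ := exists_retraction h.injective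
  set S : A →ₗ[ℂ] A := HopfAlgebra.antipode ℂ with hS
  let N : Submodule ℂ B := LinearMap.range ι.toAlgHom.toLinearMap
  have hN : ∀ a, ι a ∈ N := fun a => ⟨a, rfl⟩
  let u : (I → ℂ) →ₗ[ℂ] B ⧸ N := N.mkQ ∘ₗ Fintype.linearCombination ℂ (coinvGen Λ ι p)
  have hu : LinearMap.ker u = ⊥ := by
    rw [LinearMap.ker_eq_bot']
    intro x hx
    simp only [u, LinearMap.comp_apply, Submodule.mkQ_apply, Submodule.Quotient.mk_eq_zero,
      Fintype.linearCombination_apply] at hx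
    obtain ⟨a, ha⟩ := hx
    exact h.eq_zero_of_sum_coinvGen ⟨a, ha⟩
  obtain ⟨v, hv⟩ := LinearMap.exists_leftInverse_of_injective u hu
  let π : B →ₗ[ℂ] (I → ℂ) := v ∘ₗ N.mkQ
  have hπ0 : ∀ a, π (ι a) = 0 := by
    intro a
    simp only [π, LinearMap.comp_apply, Submodule.mkQ_apply]
    rw [(Submodule.Quotient.mk_eq_zero N).2 (hN a), map_zero]
  have hπ1 : ∀ i, π (coinvGen Λ ι p i) = Pi.single i 1 := by
    intro i
    have h1 := LinearMap.congr_fun hv (Pi.single i 1)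
    simp only [LinearMap.comp_apply, u, LinearMap.id_apply, Fintype.linearCombination_apply] at h1
    rw [← h1]
    simp only [π, LinearMap.comp_apply]
    congr 2
    rw [Finset.sum_eq_single i] <;> simp +contextual
  -- `Θ(b) = S(t(b₁)) b₂` strips off the coefficient from `A`: it sends `a` to `ε(a)`, and `a p_i`
  -- to `ε(a) S(Λ_ij) p_j` modulo `A`.
  let Θ : B →ₗ[ℂ] B := LinearMap.mul' ℂ B ∘ₗ
    TensorProduct.map (ι.toAlgHom.toLinearMap ∘ₗ S ∘ₗ t) LinearMap.id ∘ₗ Coalgebra.comul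
  have hS' : ∀ a, ∑ x ∈ (Coalgebra.Repr.arbitrary ℂ a).index,
      S ((Coalgebra.Repr.arbitrary ℂ a).left x) * (Coalgebra.Repr.arbitrary ℂ a).right x =
      algebraMap ℂ A (Coalgebra.counit (R := ℂ) a) := fun a =>
    HopfAlgebra.sum_antipode_mul_eq_algebraMap_counit _
  have hΘ0 : ∀ a, Θ (ι a) = ι (algebraMap ℂ A (Coalgebra.counit (R := ℂ) a)) := by
    intro a
    simp only [Θ, LinearMap.comp_apply]
    rw [comul_apply_hom_repr ι (Coalgebra.Repr.arbitrary ℂ a), ← hS' a]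
    simp [map_sum, ht]
  have hΘ1 : ∀ a i, ∃ c, Θ (ι a * p i) =
      Coalgebra.counit (R := ℂ) a • coinvGen Λ ι p i + ι c := by
    intro a i
    let r := Coalgebra.Repr.arbitrary ℂ a
    refine ⟨∑ x ∈ r.index, S (t (ι (r.left x) * p i)) * r.right x, ?_⟩
    simp only [Θ, LinearMap.comp_apply]
    rw [Bialgebra.comul_mul, comul_apply_hom_repr ι r, h.comul_p]
    simp only [mul_add, Finset.sum_mul, Finset.mul_sum, Algebra.TensorProduct.tmul_mul_tmul,
      mul_one, map_add, map_sum, TensorProduct.map_tmul, LinearMap.mul'_apply,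
      LinearMap.comp_apply, ← map_mul, ht, LinearMap.id_apply]
    congr 1
    · have h1 : Coalgebra.counit (R := ℂ) a • coinvGen Λ ι p i =
          ∑ j, ι (S (Λ i j)) * ι (algebraMap ℂ A (Coalgebra.counit (R := ℂ) a)) * p j := by
        rw [coinvGen, Finset.smul_sum]
        refine Finset.sum_congr rfl fun j _ => ?_
        rw [← map_mul, ← Algebra.commutes, ← Algebra.smul_def, map_smul, smul_mul_assoc]
      rw [h1]
      refine Finset.sum_congr rfl fun j _ => ?_
      rw [← hS' a, map_sum, Finset.mul_sum, Finset.sum_mul]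
      refine Finset.sum_congr rfl fun x _ => ?_
      change ι (S (r.left x * Λ i j)) * _ = _
      rw [hS, HopfAlgebra.antipode_mul_antidistrib, map_mul, map_mul]
      simp only [mul_assoc]
      rfl
    · simp only [map_mul]
      rfl
  refine ⟨fun k => LinearMap.proj k ∘ₗ π ∘ₗ Θ, fun k a => ?_, fun k i a => ?_⟩
  · simp [hΘ0, hπ0]
  · obtain ⟨c, hc⟩ := hΘ1 a i
    simp only [LinearMap.comp_apply, hc, map_add, hπ0, map_smul, hπ1]
    simp [Pi.single_apply, eq_comm]

end IsPrimitiveExtension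

end Embedding


/-! ### Derivatives of words, the symmetrizer criterion and the presentation of `B`. -/

section OrderedProducts

variable {I : Type*} [Fintype I] [DecidableEq I]
variable {A : Type*} [Ring A] [HopfAlgebra ℂ A] {B : Type*} [Ring B] [HopfAlgebra ℂ B]
variable {Λ : Matrix I I A} {ι : A →ₐc[ℂ] B} {p : I → B}
variable {f : Matrix I I (Module.Dual ℂ A)} {η : I → Module.Dual ℂ A} {T : I × I → ℂ}

/-- Tensors whose left leg is a combination of ordered products of length less than `n`. -/
noncomputable def filtLeft (ι : A →ₐc[ℂ] B) (p : I → B) (n : ℕ) : Submodule ℂ (B ⊗[ℂ] B) :=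
  Submodule.map₂ (TensorProduct.mk ℂ B B) (filt ι.toAlgHom p n) ⊤

lemma tmul_mem_filtLeft {n : ℕ} {x : B} (hx : x ∈ filt ι.toAlgHom p n) (y : B) :
    x ⊗ₜ y ∈ filtLeft ι p n := Submodule.apply_mem_map₂ _ hx Submodule.mem_top

lemma tmul_mul_mem_filtLeft {m n : ℕ} {x y : B}
    (hx : ∀ b ∈ filt ι.toAlgHom p m, x * b ∈ filt ι.toAlgHom p n) {z : B ⊗[ℂ] B}
    (hz : z ∈ filtLeft ι p m) : (x ⊗ₜ y) * z ∈ filtLeft ι p n := by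
  rw [filtLeft, Submodule.map₂_eq_span_image2] at hz
  induction hz using Submodule.span_induction with
  | mem z hz =>
    obtain ⟨b, hb, c, -, rfl⟩ := hz
    simp only [TensorProduct.mk_apply, Algebra.TensorProduct.tmul_mul_tmul]
    exact tmul_mem_filtLeft (hx b hb) _
  | zero => simp
  | add u v _ _ hu hv => rw [mul_add]; exact add_mem hu hv
  | smul c u _ hu => rw [mul_smul_comm]; exact Submodule.smul_mem _ _ hu

/-- The coefficient of `p_k` in the right leg of the coproduct of an ordered product of the `p i`,
up to lower terms. -/
noncomputable def wordDeriv (Λ : Matrix I I A) (ι : A →ₐc[ℂ] B) (p : I → B) : List I → I → B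
  | [], _ => 0
  | i :: w, k => ι (Λ i k) * wordProd p w + p i * wordDeriv Λ ι p w k

namespace SatisfiesRelations

lemma wordDeriv_mem_filt (hr : SatisfiesRelations Λ f η T ι.toAlgHom p) (w : List I) (k : I) :
    wordDeriv Λ ι p w k ∈ filt ι.toAlgHom p w.length := by
  induction w with
  | nil => exact zero_mem _
  | cons i w ih =>
    exact add_mem (mul_wordProd_mem_filt (j := ι.toAlgHom) _ (by simp)) (hr.gen_mul_mem i ih)

/-- In the remaining terms at least two generators have gone to the right leg, so the left leg has
degree at most `w.length - 2`, which is level `w.length - 1`. For words of length at most one the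
remainder vanishes, matching level `0`. -/
lemma comul_wordProd (hr : SatisfiesRelations Λ f η T ι.toAlgHom p)
    (hp : IsPrimitiveExtension Λ ι p) (w : List I) :
    Coalgebra.comul (R := ℂ) (wordProd p w) - wordProd p w ⊗ₜ 1 -
      ∑ k, wordDeriv Λ ι p w k ⊗ₜ p k ∈ filtLeft ι p (w.length - 1) := by
  induction w with
  | nil => simp [wordDeriv, Algebra.TensorProduct.one_def]
  | cons i w ih =>
    set r := Coalgebra.comul (R := ℂ) (wordProd p w) - wordProd p w ⊗ₜ[ℂ] (1 : B) -
      ∑ k, wordDeriv Λ ι p w k ⊗ₜ p k with hr'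
    have e : Coalgebra.comul (R := ℂ) (wordProd p w) = r + wordProd p w ⊗ₜ[ℂ] (1 : B) +
      ∑ k, wordDeriv Λ ι p w k ⊗ₜ p k := by rw [hr']; abel
    have h1 : ∀ l, (ι (Λ i l) ⊗ₜ[ℂ] p l) * r ∈ filtLeft ι p w.length := fun l =>
      tmul_mul_mem_filtLeft (fun b hb => apply_mul_mem_filt (j := ι.toAlgHom) _
        (filt_mono (Nat.sub_le _ _) hb)) ih
    have h2 : (p i ⊗ₜ[ℂ] (1 : B)) * r ∈ filtLeft ι p w.length :=
      tmul_mul_mem_filtLeft (fun b hb => hr.gen_mul_mem_pred i hb) ih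
    have h3 : ∀ l k, (ι (Λ i l) * wordDeriv Λ ι p w k) ⊗ₜ[ℂ] (p l * p k) ∈
        filtLeft ι p w.length := fun l k => tmul_mem_filtLeft
      (apply_mul_mem_filt (j := ι.toAlgHom) _ (hr.wordDeriv_mem_filt w k)) _
    have h4 := add_mem (add_mem (sum_mem (t := Finset.univ) fun l _ => h1 l) h2)
      (sum_mem (t := Finset.univ) fun l _ => sum_mem (t := Finset.univ) fun k _ => h3 l k)
    simp only [List.length_cons, Nat.add_sub_cancel]
    convert h4 using 1
    rw [wordProd_cons, Bialgebra.comul_mul, hp.comul_p, e]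
    simp only [wordDeriv, add_mul, mul_add, Finset.sum_mul, Finset.mul_sum,
      Algebra.TensorProduct.tmul_mul_tmul, mul_one, one_mul, TensorProduct.add_tmul,
      Finset.sum_add_distrib]
    rw [Finset.sum_comm]
    abel

/-- The derivative of a word in terms of the ways of bringing a letter to the front. -/
lemma wordDeriv_sub_mem (hr : SatisfiesRelations Λ f η T ι.toAlgHom p) (hΛ : IsRep Λ)
    (w : List I) (k : I) :
    wordDeriv Λ ι p w k - ∑ m, ι (Λ m k) * wordEval p (splitFirst (Rmat Λ f) w m) ∈
      filt ι.toAlgHom p (w.length - 1) := by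
  induction w with
  | nil => simp [wordDeriv, splitFirst]
  | cons i w ih =>
    simp only [List.length_cons, Nat.add_sub_cancel]
    set y : I → B := fun s => wordEval p (splitFirst (Rmat Λ f) w s) with hy
    have h1 := hr.gen_mul_mem_pred i ih
    have hy' : ∀ s, y s ∈ filt ι.toAlgHom p w.length := fun s =>
      wordEval_mem_filt (splitFirst_mem_wordsLT _ w s)
    -- Moving `p_i` past `Λ_sk` produces `f_it(Λ_sm) Λ_mk p_t`, and `f_it(Λ_sm)` is the entry
    -- `R_{is,mt}`.
    have h2 : ∀ s, p i * (ι (Λ s k) * y s) - ∑ m, ∑ t, Rmat Λ f (i, s) (m, t) •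
        (ι (Λ m k) * (p t * y s)) ∈ filt ι.toAlgHom p w.length := by
      intro s
      have e : p i * (ι (Λ s k) * y s) - ∑ m, ∑ t, Rmat Λ f (i, s) (m, t) •
          (ι (Λ m k) * (p t * y s)) =
          ι.toAlgHom (convRight (Λ s k) (η i)) * y s -
            ∑ t, ι.toAlgHom (Λ i t * convLeft (η t) (Λ s k)) * y s := by
        rw [← mul_assoc]
        have := hr.q_mul i (Λ s k)
        change p i * ι (Λ s k) = _ at this
        rw [this, add_mul, sub_mul, Finset.sum_mul, Finset.sum_mul, add_comm, add_sub_assoc,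
          add_eq_left, sub_eq_zero, Finset.sum_comm]
        refine Finset.sum_congr rfl fun t _ => ?_
        rw [hΛ.convRight, map_sum, Finset.sum_mul, Finset.sum_mul]
        refine Finset.sum_congr rfl fun m _ => ?_
        rw [map_smul, smul_mul_assoc, smul_mul_assoc, mul_assoc]
        rfl
      rw [e]
      exact sub_mem (apply_mul_mem_filt _ (hy' s))
        (sum_mem fun t _ => apply_mul_mem_filt _ (hy' s))
    have h3 := add_mem h1 (sum_mem (t := Finset.univ) fun s _ => h2 s)
    convert h3 using 1
    have h4 : ∑ m, ι (Λ m k) * wordEval p (splitFirst (Rmat Λ f) (i :: w) m) =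
        ι (Λ i k) * wordProd p w + ∑ s, ∑ m, ∑ t, Rmat Λ f (i, s) (m, t) •
          (ι (Λ m k) * (p t * y s)) := by
      simp only [splitFirst, map_add, map_sum, map_smul, mul_add, Finset.mul_sum,
        Finset.sum_add_distrib, wordEval_consL, mul_smul_comm]
      congr 1
      · simp [apply_ite (wordEval p)]
      · rw [Finset.sum_comm]
    rw [h4, wordDeriv, mul_sub, Finset.mul_sum, Finset.sum_sub_distrib]
    abel

end SatisfiesRelations

/-- Contraction of the right leg with a functional. -/
noncomputable def contractRight (g : Module.Dual ℂ B) : B ⊗[ℂ] B →ₗ[ℂ] B :=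
  (TensorProduct.rid ℂ B).toLinearMap ∘ₗ g.lTensor B

@[simp] lemma contractRight_tmul (g : Module.Dual ℂ B) (x y : B) :
    contractRight g (x ⊗ₜ y) = g y • x := by simp [contractRight]

lemma contractRight_comul (g : Module.Dual ℂ B) (b : B) :
    contractRight g (Coalgebra.comul (R := ℂ) b) = convLeft g b := rfl

/-- Functionals on `B` that vanish on `A` and are dual to the `p i` over `A`. -/
structure IsDualFamily (ι : A →ₐc[ℂ] B) (p : I → B) (g : I → Module.Dual ℂ B) : Prop where
  apply_hom : ∀ k a, g k (ι a) = 0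
  apply_mul_gen : ∀ k i a,
    g k (ι a * p i) = if i = k then Coalgebra.counit (R := ℂ) a else 0

namespace IsDualFamily

variable {g : I → Module.Dual ℂ B}

lemma contract_one (hg : IsDualFamily ι p g) (k : I) (a : A) (y : B) :
    contractRight (g k) (Coalgebra.comul (R := ℂ) (ι a) * y ⊗ₜ 1) = 0 := by
  rw [comul_apply_hom_repr ι (Coalgebra.Repr.arbitrary ℂ a), Finset.sum_mul, map_sum]
  simp [hg.apply_hom]

lemma contract_gen (hg : IsDualFamily ι p g) (k i : I) (a : A) (y : B) :
    contractRight (g k) (Coalgebra.comul (R := ℂ) (ι a) * y ⊗ₜ p i) =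
      if i = k then ι a * y else 0 := by
  rw [comul_apply_hom_repr ι (Coalgebra.Repr.arbitrary ℂ a), Finset.sum_mul, map_sum]
  simp only [Algebra.TensorProduct.tmul_mul_tmul, contractRight_tmul, hg.apply_mul_gen]
  split_ifs
  · have := convLeft_repr (Coalgebra.Repr.arbitrary ℂ a) (Coalgebra.counit : A →ₗ[ℂ] ℂ)
    rw [convLeft_counit] at this
    conv_rhs => rw [this, map_sum, Finset.sum_mul]
    simp
  · simp

lemma contract_mem_filt (g : Module.Dual ℂ B) (a : A) {n : ℕ} {z : B ⊗[ℂ] B}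
    (hz : z ∈ filtLeft ι p n) :
    contractRight g (Coalgebra.comul (R := ℂ) (ι a) * z) ∈ filt ι.toAlgHom p n := by
  rw [filtLeft, Submodule.map₂_eq_span_image2] at hz
  induction hz using Submodule.span_induction with
  | mem z hz =>
    obtain ⟨b, hb, c, -, rfl⟩ := hz
    rw [comul_apply_hom_repr ι (Coalgebra.Repr.arbitrary ℂ a), Finset.sum_mul, map_sum]
    refine sum_mem fun x _ => ?_
    simp only [TensorProduct.mk_apply, Algebra.TensorProduct.tmul_mul_tmul, contractRight_tmul]
    exact Submodule.smul_mem _ _ (apply_mul_mem_filt (j := ι.toAlgHom) _ hb)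
  | zero => simp
  | add u v _ _ hu hv => rw [mul_add, map_add]; exact add_mem hu hv
  | smul c u _ hu => rw [mul_smul_comm, map_smul]; exact Submodule.smul_mem _ _ hu

/-- Of the three kinds of terms in `Δ(a w)`, contraction with `g k` kills those with right leg in
`A`, picks the coefficient of `p k`, and keeps the others in the lower level. -/
lemma convLeft_mul_wordProd_sub_mem (hg : IsDualFamily ι p g)
    (hr : SatisfiesRelations Λ f η T ι.toAlgHom p) (hp : IsPrimitiveExtension Λ ι p)
    (k : I) (a : A) (w : List I) :
    convLeft (g k) (ι a * wordProd p w) - ι a * wordDeriv Λ ι p w k ∈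
      filt ι.toAlgHom p (w.length - 1) := by
  have h1 := contract_mem_filt (g k) a (hr.comul_wordProd hp w)
  convert h1 using 1
  rw [← contractRight_comul, Bialgebra.comul_mul, mul_sub, mul_sub, map_sub, map_sub,
    hg.contract_one, sub_zero, Finset.mul_sum, map_sum]
  simp [hg.contract_gen]

lemma convLeft_gen (hg : IsDualFamily ι p g) (hp : IsPrimitiveExtension Λ ι p)
    (k i : I) (a : A) : convLeft (g k) (ι a * p i) = ι (a * Λ i k) := by
  rw [← contractRight_comul, Bialgebra.comul_mul, hp.comul_p, mul_add, map_add,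
    hg.contract_one, add_zero, Finset.mul_sum, map_sum]
  simp [hg.contract_gen]

lemma convLeft_hom (hg : IsDualFamily ι p g) (k : I) (a : A) : convLeft (g k) (ι a) = 0 := by
  have := hg.contract_one k a 1
  rwa [← Algebra.TensorProduct.one_def, mul_one, contractRight_comul] at this

end IsDualFamily

lemma IsPrimitiveExtension.exists_isDualFamily (h : IsPrimitiveExtension Λ ι p) :
    ∃ g, IsDualFamily ι p g := by
  obtain ⟨g, h1, h2⟩ := h.exists_dual
  exact ⟨g, h1, h2⟩

/-- The `p i` are linearly independent over `A` modulo `A`. -/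
lemma IsPrimitiveExtension.linearIndependent (h : IsPrimitiveExtension Λ ι p) {a : I → A} {c : A}
    (h0 : ∑ i, ι (a i) * p i + ι c = 0) : (∀ i, a i = 0) ∧ c = 0 := by
  obtain ⟨g, hg⟩ := h.exists_isDualFamily
  have h1 : ∀ k, ∑ i, a i * Λ i k = 0 := by
    intro k
    apply h.injective
    have := congrArg (convLeftL (g k)) h0
    rw [map_add, map_sum, map_zero] at this
    simpa [hg.convLeft_gen h, hg.convLeft_hom] using this
  have h2 : ∀ i, a i = 0 := by
    intro i
    -- The contractions give `a Λ = 0`, and the antipode inverts `Λ`.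
    have h3 : ∑ k, (∑ l, a l * Λ l k) * HopfAlgebra.antipode ℂ (Λ k i) = a i := by
      simp only [Finset.sum_mul, mul_assoc]
      rw [Finset.sum_comm]
      simp [← Finset.mul_sum, h.irrep.1.mul_antipode]
    rw [← h3]
    simp [h1]
  refine ⟨h2, h.injective ?_⟩
  simpa [h2] using h0

/-- The operation on formal combinations of words corresponding to the contraction of the coproduct
with a functional dual to the `p i`. -/
noncomputable def polyDeriv (Λ : Matrix I I A) (R : Matrix (I × I) (I × I) ℂ) (k : I) :
    A ⊗[ℂ] (List I →₀ ℂ) →ₗ[ℂ] A ⊗[ℂ] (List I →₀ ℂ) :=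
  ∑ m, TensorProduct.map (LinearMap.mulRight ℂ (Λ m k)) (splitFirstL R m)

lemma polyDeriv_mem_polyLT (R : Matrix (I × I) (I × I) ℂ) (k : I) {n : ℕ}
    {t : A ⊗[ℂ] (List I →₀ ℂ)} (ht : t ∈ polyLT I A (n + 1)) :
    polyDeriv Λ R k t ∈ polyLT I A n := by
  induction ht using Submodule.span_induction with
  | mem x hx =>
    obtain ⟨a, w, hw, rfl⟩ := hx
    simp only [polyDeriv, LinearMap.sum_apply, TensorProduct.map_tmul]
    exact sum_mem fun m _ => tmul_mem_polyLT _ (splitFirstL_mem_wordsLT R (single_mem_wordsLT hw) m)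
  | zero => simp
  | add x y _ _ hx hy => rw [map_add]; exact add_mem hx hy
  | smul c x _ hx => rw [map_smul]; exact Submodule.smul_mem _ _ hx

namespace IsDualFamily

variable {g : I → Module.Dual ℂ B}

/-- This links the contraction in `B`, which is well defined on values, with `polyDeriv`, which is
defined on formal combinations. -/
lemma convLeft_polyEval_sub_mem (hg : IsDualFamily ι p g)
    (hr : SatisfiesRelations Λ f η T ι.toAlgHom p) (hp : IsPrimitiveExtension Λ ι p)
    (k : I) {n : ℕ} {t : A ⊗[ℂ] (List I →₀ ℂ)} (ht : t ∈ polyLT I A (n + 2)) :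
    convLeft (g k) (polyEval ι.toAlgHom p t) -
      polyEval ι.toAlgHom p (polyDeriv Λ (Rmat Λ f) k t) ∈ filt ι.toAlgHom p n := by
  induction ht using Submodule.span_induction with
  | mem x hx =>
    obtain ⟨a, w, hw, rfl⟩ := hx
    have h1 := hg.convLeft_mul_wordProd_sub_mem hr hp k a w
    have h2 := apply_mul_mem_filt (j := ι.toAlgHom) a (hr.wordDeriv_sub_mem hp.irrep.1 w k)
    have h3 := filt_mono (n := n) (by omega) (add_mem h1 h2)
    convert h3 using 1
    simp only [polyDeriv, LinearMap.sum_apply, TensorProduct.map_tmul, map_sum, polyEval_tmul,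
      splitFirstL_single, one_smul, wordEval_single, LinearMap.mulRight_apply, map_mul, mul_sub,
      Finset.mul_sum, mul_assoc]
    change convLeft (g k) (ι a * wordProd p w) - ∑ m, ι a * (ι (Λ m k) * _) =
      _ + (ι a * _ - ∑ m, ι a * _)
    abel
  | zero =>
    rw [← convLeftL_apply, map_zero, map_zero, map_zero, map_zero, sub_zero]
    exact zero_mem _
  | add x y _ _ hx hy =>
    convert add_mem hx hy using 1
    simp only [map_add, convLeft_add]
    abel
  | smul c x _ hx =>
    convert Submodule.smul_mem _ c hx using 1
    simp only [← convLeftL_apply, map_smul, smul_sub]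

lemma convLeft_mem_filt (hg : IsDualFamily ι p g)
    (hr : SatisfiesRelations Λ f η T ι.toAlgHom p) (hp : IsPrimitiveExtension Λ ι p)
    (k : I) {n : ℕ} {b : B} (hb : b ∈ filt ι.toAlgHom p (n + 1)) :
    convLeft (g k) b ∈ filt ι.toAlgHom p n := by
  rcases n with _ | n
  · obtain ⟨a, rfl⟩ := mem_filt_one.1 hb
    change convLeft (g k) (ι a) ∈ _
    rw [hg.convLeft_hom]
    exact zero_mem _
  -- In higher degree the contraction differs from the value of `polyDeriv` by lower terms, and
  -- `polyDeriv` removes one letter.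
  · rw [← map_polyEval_polyLT] at hb
    obtain ⟨t, ht, rfl⟩ := hb
    have h1 := filt_mono (Nat.le_succ n) (hg.convLeft_polyEval_sub_mem hr hp k ht)
    have h2 : polyEval ι.toAlgHom p (polyDeriv Λ (Rmat Λ f) k t) ∈ filt ι.toAlgHom p (n + 1) := by
      rw [← map_polyEval_polyLT]
      exact ⟨_, polyDeriv_mem_polyLT _ k ht, rfl⟩
    have := add_mem h1 h2
    rwa [sub_add_cancel] at this

end IsDualFamily

lemma exists_of_mem_polyLT_one {t : A ⊗[ℂ] (List I →₀ ℂ)} (ht : t ∈ polyLT I A 1) :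
    ∃ a : A, t = a ⊗ₜ Finsupp.single [] 1 := by
  induction ht using Submodule.span_induction with
  | mem x hx =>
    obtain ⟨a, w, hw, rfl⟩ := hx
    obtain rfl : w = [] := List.length_eq_zero_iff.1 (by omega)
    exact ⟨a, rfl⟩
  | zero => exact ⟨0, by simp⟩
  | add x y _ _ hx hy =>
    obtain ⟨a, rfl⟩ := hx
    obtain ⟨b, rfl⟩ := hy
    exact ⟨a + b, by rw [TensorProduct.add_tmul]⟩
  | smul c x _ hx =>
    obtain ⟨a, rfl⟩ := hx
    exact ⟨c • a, by rw [TensorProduct.smul_tmul']⟩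

/-- Multiplying the `A`-leg of the `k`-th derivative by `S(Λ_kl)` and summing over `k` cancels the
factor `Λ_mk` and isolates `splitFirst` at the letter `l`; the recursion then assembles the
symmetrizer from these pieces. -/
lemma symmetrizer_eq_zero_of_polyDeriv (hΛ : IsRep Λ) (R : Matrix (I × I) (I × I) ℂ) (n : ℕ)
    {t : A ⊗[ℂ] (List I →₀ ℂ)}
    (ht : ∀ k, (symmetrizer R n).lTensor A (polyDeriv Λ R k t) = 0) :
    (symmetrizer R (n + 1)).lTensor A t = 0 := by
  have h1 : ∀ (l) (t : A ⊗[ℂ] (List I →₀ ℂ)), ∑ k, TensorProduct.map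
      (LinearMap.mulRight ℂ (HopfAlgebra.antipode ℂ (Λ k l) : A)) LinearMap.id
        ((symmetrizer R n).lTensor A (polyDeriv Λ R k t)) =
      (symmetrizer R n ∘ₗ splitFirstL R l).lTensor A t := by
    intro l t
    induction t using TensorProduct.induction_on with
    | zero => simp
    | tmul a x =>
      simp only [polyDeriv, LinearMap.sum_apply, TensorProduct.map_tmul, map_sum,
        LinearMap.lTensor_tmul, LinearMap.mulRight_apply, LinearMap.id_apply, mul_assoc,
        LinearMap.comp_apply]
      rw [Finset.sum_comm]
      simp only [← TensorProduct.sum_tmul, ← Finset.mul_sum, hΛ.mul_antipode]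
      rw [Finset.sum_eq_single l] <;> simp +contextual
    | add x y hx hy => simp only [map_add, Finset.sum_add_distrib, hx, hy]
  have h2 : (symmetrizer R (n + 1)).lTensor A t =
      ∑ l, (consL l).lTensor A ((symmetrizer R n ∘ₗ splitFirstL R l).lTensor A t) := by
    simp only [symmetrizer]
    rw [← LinearMap.coe_lTensorHom, map_sum, LinearMap.sum_apply]
    simp only [LinearMap.coe_lTensorHom, LinearMap.lTensor_comp, LinearMap.comp_apply]
  rw [h2]
  refine Finset.sum_eq_zero fun l _ => ?_
  rw [← h1]
  simp [ht]

/-- Ordered products satisfy no relations except those forced by the symmetrizer. -/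
lemma SatisfiesRelations.symmetrizer_eq_zero
    (hr : SatisfiesRelations Λ f η T ι.toAlgHom p) (hp : IsPrimitiveExtension Λ ι p)
    (n : ℕ) {t : A ⊗[ℂ] (List I →₀ ℂ)} (ht : t ∈ polyLT I A (n + 1))
    (h0 : polyEval ι.toAlgHom p t ∈ filt ι.toAlgHom p n) :
    (symmetrizer (Rmat Λ f) n).lTensor A t = 0 := by
  obtain ⟨g, hg⟩ := hp.exists_isDualFamily
  induction n generalizing t with
  | zero =>
    obtain ⟨a, rfl⟩ := exists_of_mem_polyLT_one ht
    rw [filt_zero, Submodule.mem_bot] at h0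
    have : ι a = 0 := by simpa using h0
    rw [(map_eq_zero_iff ι hp.injective).1 this]
    simp
  | succ n ih =>
    refine symmetrizer_eq_zero_of_polyDeriv hp.irrep.1 _ n fun k => ?_
    -- Contraction lowers the level of the reduced value too, so each derivative again evaluates to
    -- something of lower degree than its words suggest.
    refine ih (polyDeriv_mem_polyLT _ k ht) ?_
    have h1 := hg.convLeft_polyEval_sub_mem hr hp k ht
    have h2 := hg.convLeft_mem_filt hr hp k h0
    have := sub_mem h2 h1
    rwa [sub_sub_cancel] at this

/-- An element all of whose contractions lie in `A` is of degree at most one. -/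
lemma SatisfiesRelations.mem_filt_two (hr : SatisfiesRelations Λ f η T ι.toAlgHom p)
    (hp : IsPrimitiveExtension Λ ι p) {g : I → Module.Dual ℂ B} (hg : IsDualFamily ι p g) {b : B}
    (hb : b ∈ Algebra.adjoin ℂ (Set.range ι ∪ Set.range p))
    (h1 : ∀ k, convLeft (g k) b ∈ Set.range ι) : b ∈ filt ι.toAlgHom p 2 := by
  obtain ⟨m, hm⟩ := hr.exists_mem_filt hb
  have hm' : b ∈ filt ι.toAlgHom p (m + 2) := filt_mono (by omega) hm
  clear hm
  induction m with
  | zero => exact hm'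
  | succ m ih =>
    refine ih ?_
    rw [← map_polyEval_polyLT] at hm'
    obtain ⟨t, ht, rfl⟩ := hm'
    refine hr.polyEval_mem_filt (m + 2) ht (symmetrizer_eq_zero_of_polyDeriv hp.irrep.1 _ _
      fun k => hr.symmetrizer_eq_zero hp _ (polyDeriv_mem_polyLT _ k ht) ?_)
    have h2 := hg.convLeft_polyEval_sub_mem hr hp k (n := m + 1) ht
    obtain ⟨a, ha⟩ := h1 k
    have h3 : convLeft (g k) (polyEval ι.toAlgHom p t) ∈ filt ι.toAlgHom p (m + 1) := by
      rw [← ha]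
      exact apply_mem_filt (j := ι.toAlgHom) a m
    -- The contraction lies in `A`, hence below the nominal degree of the derivative. This fails to
    -- be an improvement only at level `2`, where the descent stops.
    have := sub_mem h3 h2
    rwa [sub_sub_cancel] at this

/-- The universal property: the algebra `B` is presented by the relations. -/
theorem SatisfiesRelations.exists_lift (hr : SatisfiesRelations Λ f η T ι.toAlgHom p)
    (hp : IsPrimitiveExtension Λ ι p) (hgen : Algebra.adjoin ℂ (Set.range ι ∪ Set.range p) = ⊤)
    {D : Type*} [Ring D] [Algebra ℂ D] {j : A →ₐ[ℂ] D} {q : I → D}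
    (hq : SatisfiesRelations Λ f η T j q) :
    ∃ ψ : B →ₐ[ℂ] D, (∀ a, ψ (ι a) = j a) ∧ ∀ i, ψ (p i) = q i := by
  have hprod := hr.prod hq
  set J := ι.toAlgHom.prod j
  set P : I → B × D := fun i => (p i, q i)
  -- If `t` vanishes in `B`, the symmetrizer kills its leading part, so in `B × D` it has the same
  -- value as some shorter `t'`. The first component shows that `t'` still vanishes in `B`, and
  -- induction applies.
  have hker : ∀ n, ∀ t ∈ polyLT I A n, polyEval ι.toAlgHom p t = 0 → polyEval j q t = 0 := by
    intro n
    induction n with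
    | zero =>
      intro t ht _
      have : t = 0 := by simpa [polyLT] using ht
      simp [this]
    | succ n ih =>
      intro t ht h0
      have h1 := hr.symmetrizer_eq_zero hp n ht (h0 ▸ zero_mem _)
      have h2 := hprod.polyEval_mem_filt n ht h1
      rw [← map_polyEval_polyLT] at h2
      obtain ⟨t', ht', he⟩ := h2
      rw [polyEval_prod, polyEval_prod, Prod.mk.injEq] at he
      rw [← he.2]
      exact ih t' ht' (he.1.trans h0)
  -- `Γ` is the graph of the homomorphism sought: its first projection is onto because `B` is
  -- generated, and injective by `hker`.
  let Γ : Subalgebra ℂ (B × D) := Algebra.adjoin ℂ (Set.range J ∪ Set.range P)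
  have hinj : ∀ x ∈ Γ, x.1 = 0 → x.2 = 0 := by
    intro x hx h0
    obtain ⟨t, rfl⟩ := hprod.exists_polyEval_eq hx
    obtain ⟨n, hn⟩ := exists_mem_polyLT t
    rw [polyEval_prod] at h0 ⊢
    exact hker n t hn h0
  have hJ : ∀ a, (ι a, j a) ∈ Γ := fun a => Algebra.subset_adjoin (Or.inl ⟨a, rfl⟩)
  have hP : ∀ i, (p i, q i) ∈ Γ := fun i => Algebra.subset_adjoin (Or.inr ⟨i, rfl⟩)
  let F : Γ →ₐ[ℂ] B := (AlgHom.fst ℂ B D).comp Γ.val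
  have hF : Function.Bijective F := by
    constructor
    · rw [injective_iff_map_eq_zero]
      rintro ⟨x, hx⟩ h0
      exact Subtype.ext (Prod.ext h0 (hinj x hx h0))
    · rw [← AlgHom.range_eq_top, eq_top_iff, ← hgen]
      refine Algebra.adjoin_le ?_
      rintro _ (⟨a, rfl⟩ | ⟨i, rfl⟩)
      · exact ⟨⟨_, hJ a⟩, rfl⟩
      · exact ⟨⟨_, hP i⟩, rfl⟩
  let e := AlgEquiv.ofBijective F hF
  have he : ∀ x y, (h : (x, y) ∈ Γ) → e.symm x = ⟨(x, y), h⟩ := by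
    intro x y h
    rw [AlgEquiv.symm_apply_eq]
    rfl
  refine ⟨((AlgHom.snd ℂ B D).comp Γ.val).comp e.symm.toAlgHom, fun a => ?_, fun i => ?_⟩
  · change (e.symm (ι a)).1.2 = j a
    rw [he _ _ (hJ a)]
  · change (e.symm (p i)).1.2 = q i
    rw [he _ _ (hP i)]

lemma symmetrizer_one_single_singleton (R : Matrix (I × I) (I × I) ℂ) (i : I) :
    symmetrizer R 1 (Finsupp.single [i] 1) = Finsupp.single [i] 1 := by
  simp [symmetrizer, splitFirst, apply_ite (consL _)]

/-- In degree two the symmetrizer is `R + 1`, which is how the maximality condition on quadratic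
relations appears. -/
lemma symmetrizer_two_single_pair (R : Matrix (I × I) (I × I) ℂ) (i k : I) :
    symmetrizer R 2 (Finsupp.single [i, k] 1) =
      ∑ mt : I × I, (R + 1) (i, k) mt • Finsupp.single [mt.1, mt.2] 1 := by
  have h1 : ∀ m, splitFirst R [i, k] m = (if i = m then Finsupp.single [k] 1 else 0) +
      ∑ t, R (i, k) (m, t) • Finsupp.single [t] 1 := by
    intro m
    rw [splitFirst, Finset.sum_eq_single k]
    · simp [splitFirst]
    · intro s _ hs
      simp [splitFirst, hs.symm]
    · simp
  rw [symmetrizer]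
  simp only [LinearMap.sum_apply, LinearMap.comp_apply, splitFirstL_single, one_smul, h1, map_add,
    map_sum, map_smul, symmetrizer_one_single_singleton, apply_ite (symmetrizer R 1), map_zero,
    apply_ite (consL _), consL_single, Finset.sum_add_distrib, Finset.sum_ite_eq, Finset.mem_univ,
    if_true, Matrix.add_apply, add_smul]
  rw [add_comm, Fintype.sum_prod_type]
  congr 1
  rw [Finset.sum_eq_single (i, k)]
  · simp
  · intro b _ hb
    simp [hb.symm]
  · simp

lemma symmetrizer_two_single_singleton (R : Matrix (I × I) (I × I) ℂ) (i : I) :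
    symmetrizer R 2 (Finsupp.single [i] 1) = 0 := by
  simp [symmetrizer, apply_ite (splitFirstL R _), splitFirst]

lemma symmetrizer_succ_single_nil (R : Matrix (I × I) (I × I) ℂ) (n : ℕ) :
    symmetrizer R (n + 1) (Finsupp.single [] 1) = 0 := by
  simp [symmetrizer, splitFirst]

/-- The leading coefficients of the quadratic relations. -/
lemma SatisfiesRelations.quadratic_iff (hr : SatisfiesRelations Λ f η T ι.toAlgHom p)
    (hp : IsPrimitiveExtension Λ ι p) (x : I × I → ℂ) :
    Matrix.vecMul x (Rmat Λ f + 1) = 0 ↔ ∃ (b : I → A) (c : A),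
      ∑ ij : I × I, x ij • (p ij.1 * p ij.2) + ∑ i, ι (b i) * p i + ι c = 0 := by
  constructor
  · intro hx
    -- On the left kernel of `R + 1` the matrix `R - 1` is the invertible scalar `-2`, so the given
    -- relations combine to one with leading coefficients `x`.
    have h1 : Matrix.vecMul x (Rmat Λ f - 1) = (-2 : ℂ) • x := by
      have : Rmat Λ f - 1 = (Rmat Λ f + 1) - (2 : ℂ) • (1 : Matrix (I × I) (I × I) ℂ) := by
        rw [two_smul]; abel
      rw [this, Matrix.vecMul_sub, hx, Matrix.vecMul_smul, Matrix.vecMul_one]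
      simp
    have h2 : ∑ ij : I × I, x ij • (p ij.1 * p ij.2 - ∑ s, η ij.1 (Λ ij.2 s) • p s +
        algebraMap ℂ B (T ij) - ∑ mn : I × I, T mn • ι (Λ ij.1 mn.1 * Λ ij.2 mn.2)) = 0 := by
      have h3 : ∑ kl, x kl • ∑ ij : I × I, (Rmat Λ f - 1) kl ij •
          (p ij.1 * p ij.2 - ∑ s, η ij.1 (Λ ij.2 s) • p s + algebraMap ℂ B (T ij)
            - ∑ mn : I × I, T mn • ι (Λ ij.1 mn.1 * Λ ij.2 mn.2)) = 0 :=
        Finset.sum_eq_zero fun kl _ => by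
          have := hr.q_mul_q kl
          exact (congrArg (x kl • ·) this).trans (smul_zero _)
      simp only [Finset.smul_sum (N := B) (r := x _), smul_smul] at h3
      rw [Finset.sum_comm] at h3
      simp only [← Finset.sum_smul] at h3
      have h4 : ∀ ij, ∑ kl, x kl * (Rmat Λ f - 1) kl ij = -2 * x ij := fun ij =>
        congrFun h1 ij
      simp only [h4, mul_smul, ← Finset.smul_sum (N := B) (r := (-2 : ℂ))] at h3
      exact (smul_eq_zero.1 h3).resolve_left (by norm_num)
    refine ⟨fun s => -∑ ij : I × I, (x ij * η ij.1 (Λ ij.2 s)) • (1 : A),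
      ∑ ij : I × I, x ij • (algebraMap ℂ A (T ij) -
        ∑ mn : I × I, T mn • (Λ ij.1 mn.1 * Λ ij.2 mn.2)), ?_⟩
    have hc : ∀ z : ℂ, ι (algebraMap ℂ A z) = algebraMap ℂ B z := fun z => ι.toAlgHom.commutes z
    rw [← h2]
    simp only [map_neg, map_sum, map_smul, map_one, neg_mul, Finset.sum_mul, smul_mul_assoc,
      one_mul, map_sub, hc, smul_sub, smul_add, Finset.sum_add_distrib, Finset.sum_sub_distrib,
      Finset.sum_neg_distrib, Finset.smul_sum, smul_smul]
    rw [Finset.sum_comm (s := (Finset.univ : Finset I))]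
    abel
  · rintro ⟨b, c, h0⟩
    let t : A ⊗[ℂ] (List I →₀ ℂ) :=
      ∑ ij : I × I, x ij • ((1 : A) ⊗ₜ[ℂ] Finsupp.single [ij.1, ij.2] (1 : ℂ)) +
        ∑ i, b i ⊗ₜ[ℂ] Finsupp.single [i] (1 : ℂ) + c ⊗ₜ[ℂ] Finsupp.single [] (1 : ℂ)
    have ht : t ∈ polyLT I A 3 :=
      add_mem (add_mem (sum_mem fun ij _ => Submodule.smul_mem _ _
        (tmul_single_mem_polyLT _ (by simp))) (sum_mem fun i _ =>
          tmul_single_mem_polyLT _ (by simp))) (tmul_single_mem_polyLT _ (by simp))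
    have ht0 : polyEval ι.toAlgHom p t = 0 := by
      rw [← h0]
      simp [t]
    have h1 := hr.symmetrizer_eq_zero hp 2 ht (ht0 ▸ zero_mem _)
    simp only [t, map_add, map_sum, map_smul, LinearMap.lTensor_tmul, symmetrizer_two_single_pair,
      symmetrizer_two_single_singleton, symmetrizer_succ_single_nil, TensorProduct.tmul_zero,
      Finset.sum_const_zero, add_zero] at h1
    -- The leading coefficients are scalars, so the counit on the `A`-leg loses nothing.
    have h2 := congrArg (TensorProduct.lid ℂ (List I →₀ ℂ) ∘
      (Coalgebra.counit : A →ₗ[ℂ] ℂ).rTensor (List I →₀ ℂ)) h1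
    simp only [Function.comp_apply, map_sum, map_smul, LinearMap.rTensor_tmul,
      TensorProduct.lid_tmul, Bialgebra.counit_one, one_smul, map_zero] at h2
    funext mt
    have h3 := DFunLike.congr_fun h2 [mt.1, mt.2]
    simp only [Finsupp.coe_finsetSum, Finset.sum_apply, Finsupp.coe_smul, Pi.smul_apply,
      Finsupp.coe_zero, Pi.zero_apply, smul_eq_mul] at h3
    rw [Pi.zero_apply, ← h3]
    simp only [Matrix.vecMul, dotProduct]
    refine Finset.sum_congr rfl fun ij _ => ?_
    congr 1
    rw [Finset.sum_eq_single mt]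
    · simp
    · intro l _ hl
      have : ¬ (l.1 = mt.1 ∧ l.2 = mt.2) := fun h => hl (Prod.ext h.1 h.2)
      simp [this]
    · simp

end OrderedProducts


/-! ### Complete reducibility, Schur's lemma and matrix elements. -/

section RepresentationTheory

variable {I : Type*} [Fintype I] [DecidableEq I] {A : Type*} [Ring A] [HopfAlgebra ℂ A]

lemma IsRep.reindex {n m : Type*} [Fintype n] [DecidableEq n] [Fintype m] [DecidableEq m]
    {v : Matrix n n A} (hv : IsRep v) (e : m ≃ n) : IsRep (v.submatrix e e) := by
  intro i j
  refine ⟨?_, ?_⟩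
  · simp only [Matrix.submatrix_apply, (hv _ _).1]
    exact (Equiv.sum_comp e fun k => v (e i) k ⊗ₜ[ℂ] v k (e j)).symm
  · simp [(hv _ _).2]

lemma isInvariant_reindex_iff {n m : Type*} [Fintype n] [Fintype m]
    (v : Matrix n n A) (e : m ≃ n) (W : Submodule ℂ (n → ℂ)) :
    IsInvariant (v.submatrix e e) (W.map (LinearEquiv.funCongrLeft ℂ ℂ e).toLinearMap) ↔
      IsInvariant v W := by
  have key : ∀ (φ : Module.Dual ℂ A) (x : n → ℂ), ((v.submatrix e e).map φ).mulVec (x ∘ e) =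
      ((v.map φ).mulVec x) ∘ e := by
    intro φ x
    rw [← Matrix.submatrix_map, Matrix.submatrix_mulVec_equiv]
    simp [Function.comp_assoc]
  constructor
  · intro h φ x hx
    obtain ⟨y, hy, hxy⟩ := h φ (x ∘ e) ⟨x, hx, rfl⟩
    rw [key] at hxy
    have : y = (v.map φ).mulVec x := by
      funext i
      simpa using congrFun hxy (e.symm i)
    rwa [← this]
  · rintro h φ _ ⟨x, hx, rfl⟩
    exact ⟨_, h φ x hx, (key φ x).symm⟩

/-- Passing from `Fin n` to arbitrary finite index types is needed for the representation on `I ⊕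
Unit` that carries a cocycle. -/
lemma IsHomogeneousPart.isCompletelyReducible {Λ : Matrix I I A} (hA : IsHomogeneousPart Λ)
    {n : Type*} [Fintype n] [DecidableEq n] {v : Matrix n n A} (hv : IsRep v) :
    IsCompletelyReducible v := by
  intro W hW
  let e : Fin (Fintype.card n) ≃ n := (Fintype.equivFin n).symm
  let E := LinearEquiv.funCongrLeft ℂ ℂ e
  obtain ⟨W', hW', hc⟩ := hA.completelyReducible _ _ (hv.reindex e) (W.map E.toLinearMap)
    ((isInvariant_reindex_iff v e W).2 hW)
  refine ⟨W'.map E.symm.toLinearMap, ?_, ?_⟩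
  · rw [← isInvariant_reindex_iff v e]
    change IsInvariant _ ((W'.map E.symm.toLinearMap).map E.toLinearMap)
    convert hW'
    rw [← Submodule.map_comp]
    simp
  · have := hc.map (Submodule.orderIsoMapComap E.symm)
    have h1 : W = (W.map E.toLinearMap).map E.symm.toLinearMap := by
      rw [← Submodule.map_comp]
      simp
    rw [h1]
    exact this

/-- Schur's lemma. -/
lemma IsIrrep.exists_eq_smul_one {v : Matrix I I A} (hv : IsIrrep v) {X : Matrix I I ℂ}
    (hX : X.map (algebraMap ℂ A) * v = v * X.map (algebraMap ℂ A)) :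
    ∃ m : ℂ, X = m • (1 : Matrix I I ℂ) := by
  have := hv.2.1
  obtain ⟨m, hm⟩ := Module.End.exists_eigenvalue (Matrix.toLin' X)
  let W : Submodule ℂ (I → ℂ) := Module.End.eigenspace (Matrix.toLin' X) m
  have hφ : ∀ φ : Module.Dual ℂ A, X * v.map φ = v.map φ * X := by
    intro φ
    ext i j
    have := congrArg φ (congrFun (congrFun hX i) j)
    simp only [Matrix.mul_apply, map_sum, Matrix.map_apply, ← Algebra.commutes,
      ← Algebra.smul_def, map_smul, smul_eq_mul] at this ⊢
    rw [this]
    exact Finset.sum_congr rfl fun k _ => mul_comm _ _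
  have hW : IsInvariant v W := by
    intro φ x hx
    simp only [W, Module.End.mem_eigenspace_iff, Matrix.toLin'_apply] at hx ⊢
    rw [Matrix.mulVec_mulVec, hφ, ← Matrix.mulVec_mulVec, hx, Matrix.mulVec_smul]
  rcases hv.2.2 W hW with h | h
  · exact absurd h hm
  · refine ⟨m, ?_⟩
    apply Matrix.toLin'.injective
    refine LinearMap.ext fun x => ?_
    have hx : x ∈ W := h ▸ Submodule.mem_top
    rw [Module.End.mem_eigenspace_iff] at hx
    rw [hx]
    simp

/-- Extensions of the trivial representation by a completely reducible one split. -/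
lemma IsHomogeneousPart.exists_of_comul {Λ : Matrix I I A} (hA : IsHomogeneousPart Λ) {c : I → A}
    (hc : ∀ i, Coalgebra.comul (R := ℂ) (c i) = ∑ j, Λ i j ⊗ₜ[ℂ] c j + c i ⊗ₜ[ℂ] (1 : A)) :
    ∃ n : I → ℂ, ∀ i, c i = algebraMap ℂ A (n i) - ∑ j, n j • Λ i j := by
  have hΛ := hA.irrep.1
  let v : Matrix (I ⊕ Unit) (I ⊕ Unit) A :=
    Matrix.fromBlocks Λ (Matrix.of fun i _ => c i) 0 1
  have hε : ∀ i, Coalgebra.counit (R := ℂ) (c i) = 0 := by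
    intro i
    have h1 := congrArg (TensorProduct.lid ℂ A) (Coalgebra.rTensor_counit_comul (R := ℂ) (c i))
    rw [hc] at h1
    simp only [map_add, map_sum, LinearMap.rTensor_tmul, TensorProduct.lid_tmul, (hΛ _ _).2,
      ite_smul, one_smul, zero_smul, Finset.sum_ite_eq, Finset.mem_univ, if_true] at h1
    rw [add_eq_left] at h1
    have h2 := congrArg (Coalgebra.counit (R := ℂ)) h1
    simpa using h2
  have hv : IsRep v := by
    rintro (i | i) (j | j)
    · simpa [v, (hΛ i j).1] using (hΛ i j).2
    · simpa [v, hc] using hε i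
    · simp [v]
    · simp [v, Algebra.TensorProduct.one_def]
  -- A complement of this invariant hyperplane contains a vector with last coordinate `1`. It is
  -- fixed by `v`, and its other coordinates are the required `n`.
  let W : Submodule ℂ (I ⊕ Unit → ℂ) :=
    LinearMap.ker (LinearMap.proj (Sum.inr ()) : (I ⊕ Unit → ℂ) →ₗ[ℂ] ℂ)
  have hW : IsInvariant v W := by
    intro φ x hx
    simp only [W, LinearMap.mem_ker, LinearMap.proj_apply] at hx ⊢
    simp [Matrix.mulVec, dotProduct, v, hx]
  obtain ⟨W', hW', hcompl⟩ := hA.isCompletelyReducible hv W hW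
  obtain ⟨w, w', hw, hw', hsum⟩ := Submodule.mem_sup.1
    (hcompl.sup_eq_top ▸ Submodule.mem_top : (Pi.single (Sum.inr ()) 1 : I ⊕ Unit → ℂ) ∈ W ⊔ W')
    |> fun ⟨w, hw, w', hw', h⟩ => (⟨w, w', hw, hw', h⟩ : ∃ w w', w ∈ W ∧ w' ∈ W' ∧ w + w' = _)
  have hw1 : w' (Sum.inr ()) = 1 := by
    have := congrFun hsum (Sum.inr ())
    simp only [W, LinearMap.mem_ker, LinearMap.proj_apply] at hw
    simpa [hw] using this
  refine ⟨fun i => w' (Sum.inl i), fun i => ?_⟩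
  apply eq_of_forall_dual
  intro φ
  have h1 : (v.map φ).mulVec w' - φ 1 • w' ∈ W ⊓ W' := by
    refine ⟨?_, sub_mem (hW' φ w' hw') (Submodule.smul_mem _ _ hw')⟩
    simp [W, Matrix.mulVec, dotProduct, v, hw1]
  rw [hcompl.inf_eq_bot, Submodule.mem_bot] at h1
  have h2 := congrFun h1 (Sum.inl i)
  simp only [Pi.sub_apply, Matrix.mulVec, dotProduct, Matrix.map_apply, Fintype.sum_sum_type,
    Finset.univ_unique, PUnit.default_eq_unit, Finset.sum_singleton, hw1, mul_one, Pi.smul_apply,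
    smul_eq_mul, Pi.zero_apply, v, Matrix.fromBlocks_apply₁₁, Matrix.fromBlocks_apply₁₂,
    Matrix.of_apply] at h2
  rw [map_sub, map_sum, Algebra.algebraMap_eq_smul_one, map_smul]
  simp only [map_smul, smul_eq_mul]
  have h3 : ∑ x, φ (Λ i x) * w' (Sum.inl x) = ∑ x, w' (Sum.inl x) * φ (Λ i x) :=
    Finset.sum_congr rfl fun _ _ => mul_comm _ _
  rw [h3] at h2
  linear_combination h2

/-- The contractions with the coordinate functionals of a basis of the right factor are the
coordinates of the tensor. -/
lemma tensor_ext_right {V U : Type*} [AddCommGroup V] [Module ℂ V] [AddCommGroup U] [Module ℂ U]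
    {x y : V ⊗[ℂ] U} (h : ∀ ψ : Module.Dual ℂ U, TensorProduct.rid ℂ V (ψ.lTensor V x) =
      TensorProduct.rid ℂ V (ψ.lTensor V y)) : x = y := by
  classical
  let b := Module.Basis.ofVectorSpace ℂ U
  apply (TensorProduct.equivFinsuppOfBasisRight (M := V) b).injective
  ext i
  have key : ∀ z : V ⊗[ℂ] U, TensorProduct.equivFinsuppOfBasisRight (M := V) b z i =
      TensorProduct.rid ℂ V ((b.coord i).lTensor V z) := by
    intro z
    induction z using TensorProduct.induction_on with
    | zero => simp
    | tmul v u => simp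
    | add z z' hz hz' => simp [hz, hz']
  rw [key, key, h]

/-- Every element of a Hopf algebra is a combination of matrix elements of a representation. -/
lemma exists_isRep_mem_span (a : A) : ∃ (n : ℕ) (v : Matrix (Fin n) (Fin n) A), IsRep v ∧
    a ∈ Submodule.span ℂ (Set.range fun ij : Fin n × Fin n => v ij.1 ij.2) := by
  -- `W` is the subcomodule generated by `a`. It is finite-dimensional because `Δ a` is a finite
  -- sum, and `v` below is the matrix of its coaction in a basis.
  let W : Submodule ℂ A := Submodule.span ℂ (Set.range fun ψ : Module.Dual ℂ A => convLeft ψ a)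
  have hWc : ∀ b ∈ W, ∀ ψ, convLeft ψ b ∈ W := by
    intro b hb ψ
    induction hb using Submodule.span_induction with
    | mem x hx =>
      obtain ⟨χ, rfl⟩ := hx
      dsimp only
      rw [convLeft_convLeft]
      exact Submodule.subset_span ⟨_, rfl⟩
    | zero => rw [← convLeftL_apply, map_zero]; exact zero_mem _
    | add x y _ _ hx hy => rw [convLeft_add]; exact add_mem hx hy
    | smul c x _ hx => rw [← convLeftL_apply, map_smul]; exact Submodule.smul_mem _ _ hx
  have haW : a ∈ W := Submodule.subset_span ⟨Coalgebra.counit, by simp⟩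
  have hfin : FiniteDimensional ℂ W := by
    let r := Coalgebra.Repr.arbitrary ℂ a
    have hle : W ≤ Submodule.span ℂ (r.left '' r.index) := by
      refine Submodule.span_le.2 ?_
      rintro _ ⟨ψ, rfl⟩
      dsimp only
      rw [convLeft_repr r]
      exact sum_mem fun i hi => Submodule.smul_mem _ _ (Submodule.subset_span ⟨i, hi, rfl⟩)
    have : FiniteDimensional ℂ (Submodule.span ℂ (r.left '' r.index)) :=
      FiniteDimensional.span_of_finite ℂ (Set.Finite.image _ (Finset.finite_toSet _))
    exact Submodule.finiteDimensional_of_le hle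
  let e := Module.finBasis ℂ W
  obtain ⟨P, hP⟩ := W.subtype.exists_leftInverse_of_injective W.ker_subtype
  have hP' : ∀ b : A, b ∈ W → ((P b : W) : A) = b := by
    intro b hb
    have := LinearMap.congr_fun hP ⟨b, hb⟩
    exact congrArg Subtype.val this
  let c : Fin (Module.finrank ℂ W) → Module.Dual ℂ A := fun i => e.coord i ∘ₗ P
  have hexp : ∀ b ∈ W, b = ∑ i, c i b • (e i : A) := by
    intro b hb
    have := congrArg W.subtype (e.sum_repr (P b))
    rw [map_sum] at this
    simp only [map_smul, Submodule.subtype_apply, hP' b hb] at this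
    rw [← this]
    refine Finset.sum_congr rfl fun i _ => ?_
    congr 1
    simp [c, this]
  let v : Matrix (Fin (Module.finrank ℂ W)) (Fin (Module.finrank ℂ W)) A :=
    Matrix.of fun i j => convRight (e j : A) (c i)
  have hcoact : ∀ b ∈ W, Coalgebra.comul (R := ℂ) b = ∑ i, (e i : A) ⊗ₜ[ℂ] convRight b (c i) := by
    intro b hb
    refine tensor_ext_right fun ψ => ?_
    have h1 := hexp _ (hWc b hb ψ)
    rw [map_sum, map_sum]
    change convLeft ψ b = _
    rw [h1]
    refine Finset.sum_congr rfl fun i _ => ?_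
    rw [LinearMap.lTensor_tmul, TensorProduct.rid_tmul, ← conv_eq_convLeft, conv_eq_convRight]
  have hce : ∀ i j, c i (e j : A) = if i = j then 1 else 0 := by
    intro i j
    have h1 : P (e j : A) = e j := Subtype.ext (hP' _ (e j).2)
    simp [c, h1, Finsupp.single_apply, eq_comm]
  refine ⟨_, v, fun i j => ⟨?_, ?_⟩, ?_⟩
  · refine tensor_ext_right fun ψ => ?_
    change convLeft ψ (convRight (e j : A) (c i)) = _
    have h1 : convLeft ψ (e j : A) = ∑ k, ψ (v k j) • (e k : A) := by
      rw [convLeft, hcoact _ (e j).2]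
      simp [v]
    rw [← convRight_convLeft, h1, ← convRightL_apply]
    simp [v]
  · simp [v, hce]
  -- The counit on the left leg of the coaction recovers `a` as a combination of entries of `v`.
  · have h1 : a = convRight a (Coalgebra.counit : A →ₗ[ℂ] ℂ) := (convRight_counit a).symm
    rw [h1, convRight, hcoact a haW, map_sum, map_sum]
    refine sum_mem fun i _ => ?_
    simp only [LinearMap.rTensor_tmul, TensorProduct.lid_tmul]
    refine Submodule.smul_mem _ _ ?_
    have h2 : convRight a (c i) = ∑ j, c j a • convRight (e j : A) (c i) := by
      conv_lhs => rw [hexp a haW]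
      rw [← convRightL_apply, map_sum]
      simp
    rw [h2]
    refine sum_mem fun j _ => ?_
    exact Submodule.smul_mem _ _ (Submodule.subset_span ⟨(i, j), rfl⟩)

end RepresentationTheory


/-! ### Reduction to irreducible representations and the vanishing of morphisms. -/

section Irreducible

variable {I : Type*} [Fintype I] [DecidableEq I] {A : Type*} [Ring A] [HopfAlgebra ℂ A]

/-- In a basis of `U` the restriction of `v` is a representation `v'` of smaller or equal size, and
`ρ(v)` acts on `U` through `ρ(v')`. -/
lemma matrix_map_mulVec_eq_zero_of_subrep {n : ℕ} {v : Matrix (Fin n) (Fin n) A} (hv : IsRep v)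
    {U : Submodule ℂ (Fin n → ℂ)} (hU : IsInvariant v U) (ρ : Module.Dual ℂ A)
    (hρ : ∀ v' : Matrix (Fin (Module.finrank ℂ U)) (Fin (Module.finrank ℂ U)) A, IsRep v' →
      v'.map ρ = 0) {x : Fin n → ℂ} (hx : x ∈ U) : (v.map ρ).mulVec x = 0 := by
  let e := Module.finBasis ℂ U
  obtain ⟨P, hP⟩ := U.subtype.exists_leftInverse_of_injective U.ker_subtype
  have hP' : ∀ (y) (hy : y ∈ U), P y = ⟨y, hy⟩ := fun y hy => LinearMap.congr_fun hP ⟨y, hy⟩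
  let c : Fin (Module.finrank ℂ U) → Module.Dual ℂ (Fin n → ℂ) := fun a => e.coord a ∘ₗ P
  have hexp : ∀ y ∈ U, y = ∑ a, c a y • (e a : Fin n → ℂ) := by
    intro y hy
    have h1 := congrArg U.subtype (e.sum_repr (P y))
    rw [map_sum, hP' y hy] at h1
    simp only [map_smul, Submodule.subtype_apply] at h1
    conv_lhs => rw [← h1]
    refine Finset.sum_congr rfl fun a _ => ?_
    simp [c, hP' y hy]
  have hcsum : ∀ a (y : Fin n → ℂ), c a y = ∑ i, c a (Pi.single i 1) * y i := by
    intro a y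
    conv_lhs => rw [← Finset.univ_sum_single y, map_sum]
    refine Finset.sum_congr rfl fun i _ => ?_
    have : (Pi.single i (y i) : Fin n → ℂ) = y i • Pi.single i 1 := by
      ext k
      by_cases hk : k = i
      · subst hk; simp
      · simp [hk]
    rw [this, map_smul, smul_eq_mul, mul_comm]
  let v' : Matrix (Fin (Module.finrank ℂ U)) (Fin (Module.finrank ℂ U)) A :=
    Matrix.of fun a b => ∑ i, c a (Pi.single i 1) • ∑ j, (e b : Fin n → ℂ) j • v i j
  have hφ : ∀ (φ : Module.Dual ℂ A) a b,
      φ (v' a b) = c a ((v.map φ).mulVec (e b : Fin n → ℂ)) := by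
    intro φ a b
    rw [hcsum]
    simp only [v', Matrix.of_apply, map_sum, map_smul, smul_eq_mul, Matrix.mulVec, dotProduct,
      Matrix.map_apply]
    refine Finset.sum_congr rfl fun i _ => ?_
    congr 1
    exact Finset.sum_congr rfl fun j _ => mul_comm _ _
  have hφ' : ∀ (φ : Module.Dual ℂ A) b, (v.map φ).mulVec (e b : Fin n → ℂ) =
      ∑ a, φ (v' a b) • (e a : Fin n → ℂ) := by
    intro φ b
    rw [hexp _ (hU φ _ (e b).2)]
    simp only [hφ]
  have hv'e : ∀ i b, ∑ j, (e b : Fin n → ℂ) j • v i j = ∑ a, (e a : Fin n → ℂ) i • v' a b := by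
    intro i b
    apply eq_of_forall_dual
    intro φ
    have h1 := congrFun (hφ' φ b) i
    simp only [Matrix.mulVec, dotProduct, Matrix.map_apply, Finset.sum_apply, Pi.smul_apply,
      smul_eq_mul] at h1
    simp only [map_sum, map_smul, smul_eq_mul]
    rw [Finset.sum_congr rfl fun j _ => mul_comm _ _, h1]
    exact Finset.sum_congr rfl fun j _ => mul_comm _ _
  have hrep : IsRep v' := by
    intro a b
    constructor
    · have h1 : Coalgebra.comul (R := ℂ) (v' a b) = ∑ i, c a (Pi.single i 1) •
          ∑ k, v i k ⊗ₜ[ℂ] (∑ j, (e b : Fin n → ℂ) j • v k j) := by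
        simp only [v', Matrix.of_apply, map_sum, map_smul, (hv _ _).1, Finset.smul_sum,
          TensorProduct.tmul_sum, TensorProduct.tmul_smul]
        refine Finset.sum_congr rfl fun i _ => ?_
        rw [Finset.sum_comm]
      rw [h1]
      simp only [hv'e]
      have h2 : ∀ d, v' a d = ∑ i, c a (Pi.single i 1) • ∑ j, (e d : Fin n → ℂ) j • v i j :=
        fun d => rfl
      simp only [h2, TensorProduct.sum_tmul, TensorProduct.tmul_sum,
        Finset.smul_sum, ← TensorProduct.smul_tmul', TensorProduct.tmul_smul]
      rw [Finset.sum_congr rfl fun i _ => Finset.sum_comm]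
      rw [Finset.sum_comm]
    · have h1 : c a (e b : Fin n → ℂ) = if a = b then 1 else 0 := by
        simp [c, hP' _ (e b).2, Finsupp.single_apply, eq_comm]
      rw [← h1, hcsum]
      simp [v', (hv _ _).2]
  rw [hexp x hx, Matrix.mulVec_sum]
  refine Finset.sum_eq_zero fun b _ => ?_
  rw [Matrix.mulVec_smul, hφ']
  have h0 : ∀ a, ρ (v' a b) = 0 := fun a => congrFun (congrFun (hρ v' hrep) a) b
  simp [h0]

/-- A functional that vanishes on the matrix elements of all irreducible representations is zero,
provided all representations are completely reducible. -/
lemma IsHomogeneousPart.eq_zero_of_irrep {Λ : Matrix I I A} (hA : IsHomogeneousPart Λ)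
    {ρ : Module.Dual ℂ A}
    (hρ : ∀ (n : ℕ) (v : Matrix (Fin n) (Fin n) A), IsIrrep v → v.map ρ = 0) : ρ = 0 := by
  -- Strong induction on the dimension: a reducible representation is the direct sum of two proper
  -- invariant subspaces.
  have key : ∀ (n : ℕ) (v : Matrix (Fin n) (Fin n) A), IsRep v → v.map ρ = 0 := by
    intro n
    induction n using Nat.strong_induction_on with
    | _ n ih =>
      intro v hv
      by_cases hirr : IsIrrep v
      · exact hρ n v hirr
      rcases Nat.eq_zero_or_pos n with rfl | hn
      · ext i
        exact i.elim0
      obtain ⟨W, hW, hbot, htop⟩ : ∃ W : Submodule ℂ (Fin n → ℂ), IsInvariant v W ∧ W ≠ ⊥ ∧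
          W ≠ ⊤ := by
        by_contra hcon
        push Not at hcon
        exact hirr ⟨hv, ⟨⟨0, hn⟩⟩, fun W hW => or_iff_not_imp_left.2 (hcon W hW)⟩
      obtain ⟨W', hW', hc⟩ := hA.completelyReducible n v hv W hW
      have htop' : W' ≠ ⊤ := fun h => hbot (by simpa [h] using hc.inf_eq_bot)
      have hlt : ∀ U : Submodule ℂ (Fin n → ℂ), U ≠ ⊤ → Module.finrank ℂ U < n := by
        intro U hU
        simpa using Submodule.finrank_lt hU
      have hzero : ∀ U : Submodule ℂ (Fin n → ℂ), U ≠ ⊤ → IsInvariant v U → ∀ x ∈ U,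
          (v.map ρ).mulVec x = 0 := fun U hU hinv x hx =>
        matrix_map_mulVec_eq_zero_of_subrep hv hinv ρ (ih _ (hlt U hU)) hx
      apply Matrix.toLin'.injective
      refine LinearMap.ext fun x => ?_
      obtain ⟨y, hy, z, hz, rfl⟩ := Submodule.mem_sup.1
        (hc.sup_eq_top ▸ Submodule.mem_top : x ∈ W ⊔ W')
      rw [Matrix.toLin'_apply, Matrix.mulVec_add, hzero W htop hW y hy, hzero W' htop' hW' z hz]
      simp
  ext a
  obtain ⟨n, v, hv, ha⟩ := exists_isRep_mem_span a
  induction ha using Submodule.span_induction with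
  | mem x hx =>
    obtain ⟨ij, rfl⟩ := hx
    exact congrFun (congrFun (key n v hv) ij.1) ij.2
  | zero => simp
  | add x y _ _ hx hy => simp [hx, hy]
  | smul c x _ hx => simp [hx]

/-- The trivial representation serves as `w` in `Mor(v ⊗ w, Λ ⊗ v ⊗ w) = 0`. -/
lemma isIrrep_one : IsIrrep (1 : Matrix (Fin 1) (Fin 1) A) := by
  refine ⟨fun i j => ?_, ⟨0⟩, fun W _ => ?_⟩
  · obtain rfl : i = 0 := Subsingleton.elim _ _
    obtain rfl : j = 0 := Subsingleton.elim _ _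
    simp [Algebra.TensorProduct.one_def]
  · have h : Module.finrank ℂ W ≤ 1 := by simpa using W.finrank_le
    rcases Nat.le_one_iff_eq_zero_or_eq_one.1 h with h | h
    · exact Or.inl (Submodule.finrank_eq_zero.1 h)
    · exact Or.inr (Submodule.eq_top_of_finrank_eq (by simpa using h))

/-- The vanishing of `Mor(v ⊗ w, Λ ⊗ v ⊗ w)` in terms of functionals on `A`. -/
lemma IsHomogeneousPart.eq_zero_of_convRight {Λ : Matrix I I A} (hA : IsHomogeneousPart Λ)
    {σ : I → Module.Dual ℂ A}
    (hσ : ∀ s b, convRight b (σ s) = ∑ t, Λ s t * convLeft (σ t) b) (s : I) : σ s = 0 := by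
  refine hA.eq_zero_of_irrep fun n v hv => ?_
  -- The hypothesis on `σ`, evaluated on the entries of `v`, says that the numbers `σ_t(v_ml)` form
  -- a morphism from `v` to `Λ ⊗ v`.
  let Y : Matrix (I × (Fin n × Fin 1)) (Fin n × Fin 1) ℂ :=
    Matrix.of fun tm l => σ tm.1 (v tm.2.1 l.1)
  have hY : Y = 0 := by
    refine hA.mor_eq_zero n 1 v 1 hv isIrrep_one Y ?_
    ext ⟨s, k, i⟩ ⟨l, j⟩
    have h1 := hσ s (v k l)
    rw [hv.1.convRight] at h1
    simp only [hv.1.convLeft] at h1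
    obtain rfl := Subsingleton.elim i 0
    obtain rfl := Subsingleton.elim j 0
    simp only [Matrix.mul_apply, Fintype.sum_prod_type, Y, Matrix.map_apply, Matrix.of_apply,
      Matrix.kroneckerMap_apply, Finset.univ_unique, Fin.default_eq_zero, Finset.sum_singleton,
      Matrix.one_apply_eq, mul_one, ← Algebra.smul_def]
    rw [h1]
    refine Finset.sum_congr rfl fun t _ => ?_
    rw [Finset.mul_sum]
    refine Finset.sum_congr rfl fun m _ => ?_
    rw [← Algebra.commutes, ← Algebra.smul_def, mul_smul_comm]
  ext k l
  exact congrFun (congrFun hY (s, (k, 0))) (l, 0)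

end Irreducible

/-! ### Solutions of the coproduct equation and embedded Hopf algebras. -/

section Classification

variable {I : Type*} [Fintype I] [DecidableEq I]
variable {A : Type*} [Ring A] [HopfAlgebra ℂ A] {B : Type*} [Ring B] [HopfAlgebra ℂ B]
variable {Λ : Matrix I I A} {ι : A →ₐc[ℂ] B} {p : I → B}
variable {f : Matrix I I (Module.Dual ℂ A)} {η : I → Module.Dual ℂ A} {T : I × I → ℂ}

lemma exists_of_mem_filt_two {b : B} (hb : b ∈ filt ι.toAlgHom p 2) :
    ∃ (a : I → A) (c : A), b = ∑ i, ι (a i) * p i + ι c := by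
  induction hb using Submodule.span_induction with
  | mem x hx =>
    obtain ⟨a, w, hw, rfl⟩ := hx
    match w, hw with
    | [], _ => exact ⟨0, a, by simp⟩
    | [i], _ =>
      refine ⟨Pi.single i a, 0, ?_⟩
      rw [Finset.sum_eq_single i]
      · simp
      · intro k _ hk
        simp [hk]
      · simp
  | zero => exact ⟨0, 0, by simp⟩
  | add x y _ _ hx hy =>
    obtain ⟨a, c, rfl⟩ := hx
    obtain ⟨a', c', rfl⟩ := hy
    refine ⟨a + a', c + c', ?_⟩
    simp only [Pi.add_apply, map_add, add_mul, Finset.sum_add_distrib]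
    abel
  | smul z x _ hx =>
    obtain ⟨a, c, rfl⟩ := hx
    refine ⟨z • a, z • c, ?_⟩
    simp [Finset.smul_sum]

lemma filt_two_eq_firstFiltration : filt ι.toAlgHom p 2 = firstFiltration ι p := by
  apply le_antisymm
  · intro b hb
    obtain ⟨a, c, rfl⟩ := exists_of_mem_filt_two hb
    exact add_mem (sum_mem fun i _ => Submodule.subset_span (Or.inr ⟨(a i, i), rfl⟩))
      (Submodule.subset_span (Or.inl ⟨c, rfl⟩))
  · refine Submodule.span_le.2 ?_
    rintro _ (⟨c, rfl⟩ | ⟨⟨a, i⟩, rfl⟩)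
    · exact apply_mem_filt (j := ι.toAlgHom) c 1
    · exact apply_mul_gen_mem_filt (j := ι.toAlgHom) a i 0

lemma map_hom_injective (hι : Function.Injective ι) : Function.Injective
    (TensorProduct.map ι.toAlgHom.toLinearMap ι.toAlgHom.toLinearMap) := by
  obtain ⟨t, ht⟩ := exists_retraction hι
  have h : TensorProduct.map t t ∘ₗ
      TensorProduct.map ι.toAlgHom.toLinearMap ι.toAlgHom.toLinearMap = LinearMap.id := by
    ext x y
    simp [ht]
  exact Function.LeftInverse.injective (g := TensorProduct.map t t) fun x => LinearMap.congr_fun h x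

/-- Contraction of the left leg returns the bare coefficient `a`, whereas `convLeft_gen` returns `a
Λ_ik`. Comparing the two sides pins down coefficients. -/
lemma IsDualFamily.convRight_gen {g : I → Module.Dual ℂ B} (hg : IsDualFamily ι p g)
    (hp : IsPrimitiveExtension Λ ι p) (k i : I) (a : A) :
    convRight (ι a * p i) (g k) = if i = k then ι a else 0 := by
  let r := Coalgebra.Repr.arbitrary ℂ a
  rw [convRight, Bialgebra.comul_mul, comul_apply_hom_repr ι r, hp.comul_p]
  simp only [mul_add, Finset.sum_mul, Finset.mul_sum, Algebra.TensorProduct.tmul_mul_tmul, mul_one,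
    map_add, map_sum, LinearMap.rTensor_tmul, TensorProduct.lid_tmul, ← map_mul ι, hg.apply_hom,
    hg.apply_mul_gen, zero_smul, Finset.sum_const_zero, zero_add]
  split_ifs
  · have h1 := convRight_repr r (Coalgebra.counit : A →ₗ[ℂ] ℂ)
    rw [convRight_counit] at h1
    conv_rhs => rw [h1]
    simp
  · simp

lemma IsDualFamily.convRight_hom {g : I → Module.Dual ℂ B} (hg : IsDualFamily ι p g)
    (k : I) (a : A) : convRight (ι a) (g k) = 0 := by
  rw [convRight, comul_apply_hom_repr ι (Coalgebra.Repr.arbitrary ℂ a)]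
  simp [map_sum, hg.apply_hom]

/-- Solutions of `Δ x_i = Λ_ij ⊗ x_j + x_i ⊗ 1`. -/
lemma SatisfiesRelations.exists_eq_shiftedGenerator
    (hr : SatisfiesRelations Λ f η T ι.toAlgHom p)
    (hp : IsPrimitiveExtension Λ ι p) (hA : IsHomogeneousPart Λ)
    (hgen : Algebra.adjoin ℂ (Set.range ι ∪ Set.range p) = ⊤) {x : I → B}
    (hx : ∀ i, Coalgebra.comul (R := ℂ) (x i) =
      ∑ j, ι (Λ i j) ⊗ₜ[ℂ] x j + x i ⊗ₜ[ℂ] (1 : B)) :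
    ∃ (m : ℂ) (n : I → ℂ), ∀ i, x i = shiftedGenerator Λ ι p m n i := by
  obtain ⟨g, hg⟩ := hp.exists_isDualFamily
  have hg1 : ∀ k, g k 1 = 0 := fun k => by simpa using hg.apply_hom k 1
  have hL : ∀ k i, convLeft (g k) (x i) = ι (∑ j, g k (x j) • Λ i j) := by
    intro k i
    rw [convLeft, hx]
    simp [map_sum, hg1]
  -- Only the term `x_i ⊗ 1` survives this contraction, which forces the coefficients of the `p_k`
  -- in `x_i` to be scalars.
  have hR : ∀ k i, convRight (x i) (g k) = algebraMap ℂ B (g k (x i)) := by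
    intro k i
    rw [convRight, hx]
    simp [map_sum, hg.apply_hom, Algebra.algebraMap_eq_smul_one]
  have hx2 : ∀ i, x i ∈ filt ι.toAlgHom p 2 := fun i =>
    hr.mem_filt_two hp hg (hgen ▸ Algebra.mem_top) fun k => ⟨_, (hL k i).symm⟩
  choose a c hac using fun i => exists_of_mem_filt_two (hx2 i)
  have hgx : ∀ k i, g k (x i) = Coalgebra.counit (R := ℂ) (a i k) := by
    intro k i
    rw [hac i, map_add, map_sum, hg.apply_hom, add_zero]
    simp [hg.apply_mul_gen]
  have hscal : ∀ i k, a i k = algebraMap ℂ A (g k (x i)) := by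
    intro i k
    apply hp.injective
    have h1 := hR k i
    have h2 : ι (algebraMap ℂ A (g k (x i))) = algebraMap ℂ B (g k (x i)) :=
      ι.toAlgHom.commutes _
    rw [h2, ← h1]
    conv_rhs => rw [hac i, ← convRightL_apply, map_add, map_sum]
    simp [hg.convRight_gen hp, hg.convRight_hom]
  let X : Matrix I I ℂ := Matrix.of fun i k => g k (x i)
  -- The right-leg contraction, computed from the expansion of `x_i` and from its coproduct, makes
  -- `X` an intertwiner of `Λ`, so Schur's lemma applies.
  have hX : X.map (algebraMap ℂ A) * Λ = Λ * X.map (algebraMap ℂ A) := by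
    ext i k
    apply hp.injective
    have h1 := hL k i
    rw [hac i, ← convLeftL_apply, map_add, map_sum] at h1
    simp only [convLeftL_apply, hg.convLeft_gen hp, hg.convLeft_hom, add_zero, ← map_sum] at h1
    simp only [Matrix.mul_apply, Matrix.map_apply, X, Matrix.of_apply, ← hscal]
    rw [h1]
    congr 1
    refine Finset.sum_congr rfl fun j _ => ?_
    rw [hscal, ← Algebra.commutes, ← Algebra.smul_def]
  obtain ⟨m, hm⟩ := hA.irrep.exists_eq_smul_one hX
  have hxm : ∀ i, x i = m • p i + ι (c i) := by
    intro i
    rw [hac i]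
    congr 1
    have h1 : ∀ k, g k (x i) = m * (1 : Matrix I I ℂ) i k := fun k =>
      congrFun (congrFun hm i) k
    simp only [hscal, h1]
    rw [Finset.sum_eq_single i]
    · simp [Algebra.algebraMap_eq_smul_one]
    · intro k _ hk
      simp [hk.symm]
    · simp
  -- With `m p_i` removed, the part in `A` satisfies the same coproduct equation and is therefore a
  -- coboundary.
  have hc : ∀ i, Coalgebra.comul (R := ℂ) (c i) = ∑ j, Λ i j ⊗ₜ[ℂ] c j + c i ⊗ₜ[ℂ] (1 : A) := by
    intro i
    apply map_hom_injective hp.injective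
    rw [← comul_apply_hom]
    have h1 := hx i
    simp only [hxm, map_add, map_smul, hp.comul_p, TensorProduct.tmul_add, TensorProduct.add_tmul,
      TensorProduct.tmul_smul, TensorProduct.smul_tmul', Finset.sum_add_distrib, smul_add,
      Finset.smul_sum] at h1
    simp only [map_add, map_sum, TensorProduct.map_tmul]
    have h2 : Coalgebra.comul (R := ℂ) (ι (c i)) =
        ∑ j, ι (Λ i j) ⊗ₜ[ℂ] ι (c j) + ι (c i) ⊗ₜ[ℂ] (1 : B) := by
      rw [← sub_eq_zero] at h1 ⊢
      rw [← h1]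
      abel
    rw [h2]
    congr 2
    exact (map_one ι).symm
  obtain ⟨n, hn⟩ := hA.exists_of_comul hc
  refine ⟨m, n, fun i => ?_⟩
  rw [hxm, hn, shiftedGenerator, add_sub_assoc]
  congr 1
  rw [map_sub, map_sum]
  congr 1
  · exact ι.toAlgHom.commutes _
  · simp

/-- A functional vanishing on `A` lowers the degree. -/
lemma SatisfiesRelations.convLeft_mem_filt (hr : SatisfiesRelations Λ f η T ι.toAlgHom p)
    (hp : IsPrimitiveExtension Λ ι p) {g : Module.Dual ℂ B} (hg : ∀ a, g (ι a) = 0)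
    {n : ℕ} {b : B} (hb : b ∈ filt ι.toAlgHom p (n + 1)) :
    convLeft g b ∈ filt ι.toAlgHom p n := by
  induction hb using Submodule.span_induction with
  | mem x hx =>
    obtain ⟨a, w, hw, rfl⟩ := hx
    have h1 : Coalgebra.comul (R := ℂ) (wordProd p w) - wordProd p w ⊗ₜ 1 ∈
        filtLeft ι p w.length := by
      have h2 : filtLeft ι p (w.length - 1) ≤ filtLeft ι p w.length :=
        Submodule.map₂_le_map₂_left (filt_mono (Nat.sub_le _ _))
      have h3 := add_mem (h2 (hr.comul_wordProd hp w)) (sum_mem (t := Finset.univ) fun k _ =>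
        tmul_mem_filtLeft (hr.wordDeriv_mem_filt w k) (p k))
      rwa [sub_add_cancel] at h3
    have h2 := IsDualFamily.contract_mem_filt g a h1
    have h3 : contractRight g (Coalgebra.comul (R := ℂ) (ι a) * wordProd p w ⊗ₜ 1) = 0 := by
      rw [comul_apply_hom_repr ι (Coalgebra.Repr.arbitrary ℂ a), Finset.sum_mul, map_sum]
      simp [hg]
    rw [mul_sub, map_sub, h3, sub_zero, ← Bialgebra.comul_mul, contractRight_comul] at h2
    exact filt_mono (Nat.lt_succ_iff.1 hw) h2
  | zero => rw [← convLeftL_apply, map_zero]; exact zero_mem _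
  | add x y _ _ hx hy => rw [convLeft_add]; exact add_mem hx hy
  | smul c x _ hx => rw [← convLeftL_apply, map_smul]; exact Submodule.smul_mem _ _ hx

/-- The image of a cosemisimple Hopf algebra in `B` lies in `A`. -/
lemma SatisfiesRelations.apply_mem_range (hr : SatisfiesRelations Λ f η T ι.toAlgHom p)
    (hp : IsPrimitiveExtension Λ ι p)
    (hgen : Algebra.adjoin ℂ (Set.range ι ∪ Set.range p) = ⊤)
    {C : Type*} [Ring C] [HopfAlgebra ℂ C]
    (hC : ∀ (n : ℕ) (v : Matrix (Fin n) (Fin n) C), IsRep v → IsCompletelyReducible v)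
    {φ : C →ₐc[ℂ] B} (hφ : Function.Injective φ) (x : C) : φ x ∈ Set.range ι := by
  obtain ⟨n, v, hv, hx⟩ := exists_isRep_mem_span x
  obtain ⟨s, hs⟩ := exists_retraction hφ
  have hcomp : ∀ (g : Module.Dual ℂ B), (v.map (g ∘ₗ φ.toAlgHom.toLinearMap)) =
      (v.map φ).map g := fun g => rfl
  have hext : ∀ ψ : Module.Dual ℂ C, v.map ψ = (v.map φ).map (ψ ∘ₗ s) := by
    intro ψ
    ext i j
    simp [hs]
  have hu : IsRep (v.map φ) := by
    intro i j
    refine ⟨?_, ?_⟩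
    · rw [Matrix.map_apply, comul_apply_hom, (hv i j).1, map_sum]
      rfl
    · rw [Matrix.map_apply, counit_apply_hom, (hv i j).2]
  -- `U` measures the failure of the entries of `φ(v)` to lie in `A`; the aim is `U = 0`.
  let U : Submodule ℂ (Fin n → ℂ) := Submodule.span ℂ {y | ∃ (g : Module.Dual ℂ B)
    (z : Fin n → ℂ), (∀ a, g (ι a) = 0) ∧ y = ((v.map φ).map g).mulVec z}
  have hconv : ∀ g g' : Module.Dual ℂ B, (v.map φ).map (conv g g') =
      (v.map φ).map g * (v.map φ).map g' := by
    intro g g'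
    ext i j
    rw [Matrix.map_apply, hu.conv]
    rfl
  have hU : IsInvariant v U := by
    intro ψ y hy
    rw [hext]
    induction hy using Submodule.span_induction with
    | mem y hy =>
      obtain ⟨g, z, hg, rfl⟩ := hy
      rw [Matrix.mulVec_mulVec, ← hconv]
      refine Submodule.subset_span ⟨_, z, fun a => ?_, rfl⟩
      rw [conv, LinearMap.comp_apply, LinearMap.comp_apply,
        comul_apply_hom_repr ι (Coalgebra.Repr.arbitrary ℂ a)]
      simp [map_sum, hg]
    | zero => simp
    | add y z _ _ hy hz => rw [Matrix.mulVec_add]; exact add_mem hy hz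
    | smul c y _ hy => rw [Matrix.mulVec_smul]; exact Submodule.smul_mem _ _ hy
  obtain ⟨W, hW, hc⟩ := hC n v hv U hU
  -- Functionals vanishing on `A` map an invariant complement of `U` into `U ⊓ W = 0`, so `U` is
  -- already generated by their action on `U` itself.
  have hUU : U ≤ Submodule.span ℂ {y | ∃ (g : Module.Dual ℂ B)
      (z : Fin n → ℂ), (∀ a, g (ι a) = 0) ∧ z ∈ U ∧ y = ((v.map φ).map g).mulVec z} := by
    refine Submodule.span_le.2 ?_
    rintro _ ⟨g, z, hg, rfl⟩
    obtain ⟨z0, hz0, w, hw, rfl⟩ := Submodule.mem_sup.1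
      (hc.sup_eq_top ▸ Submodule.mem_top : z ∈ U ⊔ W)
    refine Submodule.subset_span ⟨g, z0, hg, hz0, ?_⟩
    have h1 : ((v.map φ).map g).mulVec w ∈ U ⊓ W :=
      ⟨Submodule.subset_span ⟨g, w, hg, rfl⟩, by rw [← hcomp]; exact hW _ w hw⟩
    rw [hc.inf_eq_bot, Submodule.mem_bot] at h1
    rw [Matrix.mulVec_add, h1, add_zero]
  -- Each such functional lowers the degree, and `hUU` allows this to be repeated until the level is
  -- `0`.
  have hdown : ∀ m, (∀ y ∈ U, ∀ i, ∑ k, y k • (v.map φ) i k ∈ filt ι.toAlgHom p (m + 1)) →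
      ∀ y ∈ U, ∀ i, ∑ k, y k • (v.map φ) i k ∈ filt ι.toAlgHom p m := by
    intro m hm y hy i
    have hy' := hUU hy
    clear hy
    induction hy' using Submodule.span_induction with
    | mem y hy =>
      obtain ⟨g, z, hg, hz, rfl⟩ := hy
      have h1 := hr.convLeft_mem_filt hp hg (hm z hz i)
      convert h1 using 1
      rw [← convLeftL_apply, map_sum]
      simp only [map_smul, convLeftL_apply, hu.convLeft, Matrix.mulVec, dotProduct,
        Finset.sum_smul, Finset.smul_sum, smul_smul]
      rw [Finset.sum_comm]
      refine Finset.sum_congr rfl fun k _ => Finset.sum_congr rfl fun l _ => ?_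
      rw [mul_comm]
      rfl
    | zero => simp
    | add y z _ _ hy hz =>
      convert add_mem hy hz using 1
      simp [add_smul, Finset.sum_add_distrib]
    | smul c y _ hy =>
      convert Submodule.smul_mem _ c hy using 1
      simp [Finset.smul_sum, smul_smul]
  obtain ⟨N, hN⟩ : ∃ N, ∀ i k, (v.map φ) i k ∈ filt ι.toAlgHom p N := by
    choose m hm using fun ik : Fin n × Fin n =>
      hr.exists_mem_filt (x := (v.map φ) ik.1 ik.2) (hgen ▸ Algebra.mem_top)
    exact ⟨Finset.univ.sup m, fun i k =>
      filt_mono (Finset.le_sup (f := m) (Finset.mem_univ (i, k))) (hm (i, k))⟩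
  have hzero : ∀ m, (∀ y ∈ U, ∀ i, ∑ k, y k • (v.map φ) i k ∈ filt ι.toAlgHom p m) →
      ∀ y ∈ U, ∀ i, ∑ k, y k • (v.map φ) i k = 0 := by
    intro m
    induction m with
    | zero =>
      intro h y hy i
      simpa [filt_zero] using h y hy i
    | succ m ih => exact fun h => ih (hdown m h)
  -- The counit turns `φ(v) y = 0` into `y = 0`.
  have hU0 : ∀ y ∈ U, y = 0 := by
    intro y hy
    funext i
    have h1 := congrArg (Coalgebra.counit (R := ℂ)) (hzero N (fun y _ i => sum_mem fun k _ =>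
      Submodule.smul_mem _ _ (hN i k)) y hy i)
    simpa [map_sum, (hv _ _).2] using h1
  have hentry : ∀ i k, φ (v i k) ∈ LinearMap.range ι.toAlgHom.toLinearMap := by
    intro i k
    by_contra hnot
    obtain ⟨g, hg1, hg2⟩ := Submodule.exists_le_ker_of_notMem hnot
    apply hg1
    have h1 := hU0 (((v.map φ).map g).mulVec (Pi.single k 1)) (Submodule.subset_span
      ⟨g, _, fun a => hg2 ⟨a, rfl⟩, rfl⟩)
    have h2 := congrFun h1 i
    simpa using h2
  change φ x ∈ LinearMap.range ι.toAlgHom.toLinearMap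
  induction hx using Submodule.span_induction with
  | mem x hx =>
    obtain ⟨ij, rfl⟩ := hx
    exact hentry _ _
  | zero => simp
  | add x y _ _ hx hy => rw [map_add]; exact add_mem hx hy
  | smul c x _ hx => rw [map_smul]; exact Submodule.smul_mem _ _ hx

end Classification


/-! ### Elementary properties of Hopf involutions. -/

section HopfStarLemmas

variable {A : Type*} [Ring A] [HopfAlgebra ℂ A]

namespace HopfStar

variable (s : HopfStar A)

lemma ext_star {s s' : HopfStar A} (h : ∀ a, s.star a = s'.star a) : s = s' := by
  have h' : s.star = s'.star := LinearMap.ext h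
  cases s
  cases s'
  congr

@[simp] lemma star_one : s.star 1 = 1 := by
  have h : ∀ y, y * s.star 1 = y := by
    intro y
    have := s.star_mul 1 (s.star y)
    rw [one_mul, s.star_star] at this
    exact this.symm
  simpa using h 1

lemma star_smul (z : ℂ) (a : A) : s.star (z • a) = conj z • s.star a := s.star.map_smulₛₗ z a

@[simp] lemma star_algebraMap (z : ℂ) :
    s.star (algebraMap ℂ A z) = algebraMap ℂ A (conj z) := by
  rw [Algebra.algebraMap_eq_smul_one, star_smul, star_one, Algebra.algebraMap_eq_smul_one]

/-- The functional `a ↦ conj (ρ (a^*))`. -/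
noncomputable def dualStar (ρ : Module.Dual ℂ A) : Module.Dual ℂ A where
  toFun a := conj (ρ (s.star a))
  map_add' a b := by simp
  map_smul' z a := by simp

@[simp] lemma dualStar_apply (ρ : Module.Dual ℂ A) (a : A) :
    s.dualStar ρ a = conj (ρ (s.star a)) := rfl

lemma comul_star_repr {a : A} {κ : Type*} (r : Coalgebra.Repr ℂ a κ) :
    Coalgebra.comul (R := ℂ) (s.star a) =
      ∑ k ∈ r.index, s.star (r.left k) ⊗ₜ[ℂ] s.star (r.right k) := by
  rw [s.comul_star, ← r.eq, map_sum]
  rfl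

lemma star_convRight (a : A) (ρ : Module.Dual ℂ A) :
    s.star (convRight a ρ) = convRight (s.star a) (s.dualStar ρ) := by
  rw [convRight_repr (Coalgebra.Repr.arbitrary ℂ a), convRight,
    s.comul_star_repr (Coalgebra.Repr.arbitrary ℂ a)]
  simp [map_sum, s.star_star]

lemma star_convLeft (a : A) (ρ : Module.Dual ℂ A) :
    s.star (convLeft ρ a) = convLeft (s.dualStar ρ) (s.star a) := by
  rw [convLeft_repr (Coalgebra.Repr.arbitrary ℂ a), convLeft,
    s.comul_star_repr (Coalgebra.Repr.arbitrary ℂ a)]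
  simp [map_sum, s.star_star]

end HopfStar

end HopfStarLemmas

/-! ### Generators and relations as checkable data, and identities for `R` and `Z`. -/

section Data

variable {I : Type*} [Fintype I] [DecidableEq I]
variable {A : Type*} [Ring A] [HopfAlgebra ℂ A] {B : Type*} [Ring B] [HopfAlgebra ℂ B]

/-- The part of the definition of an inhomogeneous quantum group which concerns the generators and
their relations. -/
structure InhomogeneousData (Λ : Matrix I I A) (ι : A →ₐc[ℂ] B) (p : I → B)
    (f : Matrix I I (Module.Dual ℂ A)) (η : I → Module.Dual ℂ A) (T : I × I → ℂ) : Prop where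
  generated : Algebra.adjoin ℂ (Set.range ι ∪ Set.range p) = ⊤
  injective : Function.Injective ι
  comul_p : ∀ i, Coalgebra.comul (R := ℂ) (p i) =
    ∑ j, ι (Λ i j) ⊗ₜ[ℂ] p j + p i ⊗ₜ[ℂ] (1 : B)
  counit_p : ∀ i, Coalgebra.counit (R := ℂ) (p i) = 0
  exists_notMem : ∃ i, p i ∉ Set.range ι
  f_one : ∀ s t, f s t 1 = if s = t then 1 else 0
  f_mul : ∀ s t a b, f s t (a * b) = ∑ m, f s m a * f m t b
  η_one : ∀ s, η s 1 = 0
  η_mul : ∀ s a b, η s (a * b) = η s a * Coalgebra.counit (R := ℂ) b + ∑ t, f s t a * η t b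
  Λ_f : ∀ s r a, ∑ t, Λ s t * convLeft (f t r) a = ∑ t, convRight a (f s t) * Λ t r
  relations : SatisfiesRelations Λ f η T ι.toAlgHom p
  R_sq : Rmat Λ f * Rmat Λ f = 1
  R_T : Matrix.mulVec (Rmat Λ f) T = -T

variable {Λ : Matrix I I A} {ι : A →ₐc[ℂ] B} {p : I → B}
variable {f : Matrix I I (Module.Dual ℂ A)} {η : I → Module.Dual ℂ A} {T : I × I → ℂ}

lemma IsInhomogeneousQG.data (h : IsInhomogeneousQG Λ ι p f η T) :
    InhomogeneousData Λ ι p f η T where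
  generated := h.generated
  injective := h.injective
  comul_p := h.comul_p
  counit_p := h.counit_p
  exists_notMem := h.exists_notMem
  f_one := h.f_one
  f_mul := h.f_mul
  η_one := h.η_one
  η_mul := h.η_mul
  Λ_f := h.Λ_f
  relations := ⟨h.p_mul, h.p_mul_p⟩
  R_sq := h.R_sq
  R_T := h.R_T

lemma InhomogeneousData.isPrimitiveExtension (h : InhomogeneousData Λ ι p f η T)
    (hA : IsHomogeneousPart Λ) : IsPrimitiveExtension Λ ι p where
  antipode_bijective := hA.antipode_bijective
  irrep := hA.irrep
  injective := h.injective
  comul_p := h.comul_p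
  exists_notMem := h.exists_notMem

lemma InhomogeneousData.p_mul (h : InhomogeneousData Λ ι p f η T) (s : I) (a : A) :
    p s * ι a = ∑ t, ι (convRight a (f s t)) * p t +
      (ι (convRight a (η s)) - ∑ t, ι (Λ s t * convLeft (η t) a)) := h.relations.q_mul s a

/-- The maximality of the set of quadratic relations is automatic. -/
lemma InhomogeneousData.isInhomogeneousQG (h : InhomogeneousData Λ ι p f η T)
    (hA : IsHomogeneousPart Λ) : IsInhomogeneousQG Λ ι p f η T where
  toIsHomogeneousPart := hA
  generated := h.generated
  injective := h.injective
  comul_p := h.comul_p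
  counit_p := h.counit_p
  exists_notMem := h.exists_notMem
  bimodule := by
    intro x hx a
    rw [← filt_two_eq_firstFiltration] at hx ⊢
    obtain ⟨b, c, rfl⟩ := exists_of_mem_filt_two hx
    rw [add_mul, Finset.sum_mul, ← map_mul]
    refine add_mem (sum_mem fun i _ => ?_) (apply_mem_filt (j := ι.toAlgHom) _ 1)
    rw [mul_assoc, h.p_mul]
    refine apply_mul_mem_filt (j := ι.toAlgHom) _ (add_mem (sum_mem fun t _ =>
      apply_mul_gen_mem_filt (j := ι.toAlgHom) _ _ 0) (sub_mem
        (apply_mem_filt (j := ι.toAlgHom) _ 1) (sum_mem fun t _ =>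
          apply_mem_filt (j := ι.toAlgHom) _ 1)))
  f_one := h.f_one
  f_mul := h.f_mul
  η_one := h.η_one
  η_mul := h.η_mul
  Λ_f := h.Λ_f
  p_mul := h.p_mul
  R_sq := h.R_sq
  quadratic := h.relations.quadratic_iff (h.isPrimitiveExtension hA)
  R_T := h.R_T
  p_mul_p := h.relations.q_mul_q

/-- A scalar matrix acting on a vector with entries in an algebra. -/
def smulVec {κ lam D : Type*} [Fintype lam] [AddCommGroup D] [Module ℂ D]
    (X : Matrix κ lam ℂ) (w : lam → D) : κ → D := fun k => ∑ l, X k l • w l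

section smulVec

variable {κ lam mu D : Type*} [Fintype lam] [Fintype mu] [AddCommGroup D] [Module ℂ D]

lemma smulVec_smulVec (X : Matrix κ lam ℂ) (Y : Matrix lam mu ℂ) (w : mu → D) :
    smulVec X (smulVec Y w) = smulVec (X * Y) w := by
  funext k
  simp only [smulVec, Finset.smul_sum, smul_smul, Matrix.mul_apply, Finset.sum_smul]
  exact Finset.sum_comm

lemma smulVec_add (X : Matrix κ lam ℂ) (w w' : lam → D) :
    smulVec X (w + w') = smulVec X w + smulVec X w' := by
  funext k
  simp [smulVec, Finset.sum_add_distrib]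

lemma smulVec_sub (X : Matrix κ lam ℂ) (w w' : lam → D) :
    smulVec X (w - w') = smulVec X w - smulVec X w' := by
  funext k
  simp [smulVec, smul_sub, Finset.sum_sub_distrib]

lemma sub_smulVec (X Y : Matrix κ lam ℂ) (w : lam → D) :
    smulVec (X - Y) w = smulVec X w - smulVec Y w := by
  funext k
  simp [smulVec, sub_smul, Finset.sum_sub_distrib]

lemma add_smulVec (X Y : Matrix κ lam ℂ) (w : lam → D) :
    smulVec (X + Y) w = smulVec X w + smulVec Y w := by
  funext k
  simp [smulVec, add_smul, Finset.sum_add_distrib]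

lemma smulVec_smul (z : ℂ) (X : Matrix κ lam ℂ) (w : lam → D) :
    smulVec X (z • w) = z • smulVec X w := by
  funext k
  simp only [smulVec, Pi.smul_apply, Finset.smul_sum]
  exact Finset.sum_congr rfl fun l _ => smul_comm _ _ _

@[simp] lemma smulVec_zero (X : Matrix κ lam ℂ) : smulVec X (0 : lam → D) = 0 := by
  funext k
  simp [smulVec]

@[simp] lemma one_smulVec [DecidableEq lam] (w : lam → D) :
    smulVec (1 : Matrix lam lam ℂ) w = w := by
  funext k
  simp [smulVec, Matrix.one_apply, ite_smul]

end smulVec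

/-- The vector with entries
`q_i q_j - Z_ij,s q_s + T_ij - Λ_im Λ_jn T_mn`. -/
noncomputable def quadVec {D : Type*} [Ring D] [Algebra ℂ D] (Λ : Matrix I I A)
    (Z : Matrix (I × I) I ℂ) (T : I × I → ℂ) (j : A →ₐ[ℂ] D) (q : I → D) : I × I → D :=
  fun ij => q ij.1 * q ij.2 - ∑ s, Z ij s • q s + algebraMap ℂ D (T ij)
      - ∑ mn : I × I, T mn • j (Λ ij.1 mn.1 * Λ ij.2 mn.2)

lemma SatisfiesRelations.smulVec_quadVec {D : Type*} [Ring D] [Algebra ℂ D] {j : A →ₐ[ℂ] D}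
    {q : I → D} (h : SatisfiesRelations Λ f η T j q) :
    smulVec (Rmat Λ f - 1) (quadVec Λ (Zmat Λ η) T j q) = 0 := by
  funext kl
  exact h.q_mul_q kl

namespace InhomogeneousData

/-- Since `f` is multiplicative, evaluating it on `S(a₁) a₂ = ε(a)` exhibits `f ∘ S` as a
convolution inverse of `f`. -/
lemma isRep_f_conv_antipode (h : InhomogeneousData Λ ι p f η T) (s r : I) :
    ∑ t, conv (f s t ∘ₗ HopfAlgebra.antipode ℂ) (f t r) =
      if s = r then (Coalgebra.counit : A →ₗ[ℂ] ℂ) else 0 := by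
  ext a
  let e := Coalgebra.Repr.arbitrary ℂ a
  have h1 : f s r (∑ i ∈ e.index, HopfAlgebra.antipode ℂ (e.left i) * e.right i) =
      f s r (algebraMap ℂ A (Coalgebra.counit (R := ℂ) a)) := by
    rw [HopfAlgebra.sum_antipode_mul_eq_algebraMap_counit]
  rw [map_sum, Algebra.algebraMap_eq_smul_one, map_smul, h.f_one] at h1
  simp only [h.f_mul] at h1
  rw [LinearMap.sum_apply, Finset.sum_congr rfl fun t _ => conv_repr e _ _, Finset.sum_comm]
  simp only [LinearMap.comp_apply]
  rw [h1]
  split_ifs <;> simp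

lemma f_conv_f_antipode (h : InhomogeneousData Λ ι p f η T) (s r : I) :
    ∑ t, conv (f s t) (f t r ∘ₗ HopfAlgebra.antipode ℂ) =
      if s = r then (Coalgebra.counit : A →ₗ[ℂ] ℂ) else 0 := by
  ext a
  let e := Coalgebra.Repr.arbitrary ℂ a
  have h1 : f s r (∑ i ∈ e.index, e.left i * HopfAlgebra.antipode ℂ (e.right i)) =
      f s r (algebraMap ℂ A (Coalgebra.counit (R := ℂ) a)) := by
    rw [HopfAlgebra.sum_mul_antipode_eq_algebraMap_counit]
  rw [map_sum, Algebra.algebraMap_eq_smul_one, map_smul, h.f_one] at h1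
  simp only [h.f_mul] at h1
  rw [LinearMap.sum_apply, Finset.sum_congr rfl fun t _ => conv_repr e _ _, Finset.sum_comm]
  simp only [LinearMap.comp_apply]
  rw [h1]
  split_ifs <;> simp

/-- The twisted derivation rule for `η` is evaluated on `S(a₁) a₂ = ε(a)`, where `η` vanishes. -/
lemma f_antipode_conv_η (h : InhomogeneousData Λ ι p f η T) (s : I) :
    ∑ t, conv (f s t ∘ₗ HopfAlgebra.antipode ℂ) (η t) = -(η s ∘ₗ HopfAlgebra.antipode ℂ) := by
  ext a
  let e := Coalgebra.Repr.arbitrary ℂ a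
  have h1 : η s (∑ i ∈ e.index, HopfAlgebra.antipode ℂ (e.left i) * e.right i) =
      η s (algebraMap ℂ A (Coalgebra.counit (R := ℂ) a)) := by
    rw [HopfAlgebra.sum_antipode_mul_eq_algebraMap_counit]
  rw [map_sum, Algebra.algebraMap_eq_smul_one, map_smul, h.η_one, smul_zero] at h1
  simp only [h.η_mul, Finset.sum_add_distrib] at h1
  have h2 : ∑ i ∈ e.index, η s (HopfAlgebra.antipode ℂ (e.left i)) *
      Coalgebra.counit (R := ℂ) (e.right i) = η s (HopfAlgebra.antipode ℂ a) := by
    have h3 := congrArg (η s ∘ₗ HopfAlgebra.antipode ℂ) (convLeft_counit a)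
    rw [convLeft_repr e, map_sum] at h3
    rw [← LinearMap.comp_apply, ← h3]
    refine Finset.sum_congr rfl fun i _ => ?_
    rw [map_smul, smul_eq_mul, mul_comm]
    rfl
  rw [h2, Finset.sum_comm] at h1
  rw [LinearMap.sum_apply, Finset.sum_congr rfl fun t _ => conv_repr e _ _]
  exact eq_neg_of_add_eq_zero_right h1

/-- The exchange relation `Λ_f` on the entries of `Λ`; it expresses that `R` is an endomorphism of
`Λ ⊗ Λ`. -/
lemma Rmat_mul_commutes (h : InhomogeneousData Λ ι p f η T) (hΛ : IsRep Λ) (s j b r : I) :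
    ∑ kt : I × I, Rmat Λ f (s, j) kt • (Λ kt.1 b * Λ kt.2 r) =
      ∑ tk : I × I, Rmat Λ f tk (b, r) • (Λ s tk.1 * Λ j tk.2) := by
  have h1 := h.Λ_f s r (Λ j b)
  simp only [hΛ.convLeft, hΛ.convRight, Finset.mul_sum, Finset.sum_mul, mul_smul_comm,
    smul_mul_assoc] at h1
  rw [Fintype.sum_prod_type_right, Fintype.sum_prod_type]
  exact h1.symm

/-- `R` intertwines `Λ ⊗ Λ` with itself: action on coefficient vectors. -/
lemma smulVec_sum_mul (h : InhomogeneousData Λ ι p f η T) (hΛ : IsRep Λ) {D : Type*} [Ring D]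
    [Algebra ℂ D] (j : A →ₐ[ℂ] D) (V : I × I → ℂ) :
    smulVec (Rmat Λ f) (fun ij => ∑ mn : I × I, V mn • j (Λ ij.1 mn.1 * Λ ij.2 mn.2)) =
      fun ij => ∑ mn : I × I, (Rmat Λ f).mulVec V mn • j (Λ ij.1 mn.1 * Λ ij.2 mn.2) := by
  funext kl
  have h1 : ∀ mn : I × I, ∑ ij : I × I, Rmat Λ f kl ij • j (Λ ij.1 mn.1 * Λ ij.2 mn.2) =
      ∑ ij : I × I, Rmat Λ f ij mn • j (Λ kl.1 ij.1 * Λ kl.2 ij.2) := by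
    intro mn
    have := congrArg j (h.Rmat_mul_commutes hΛ kl.1 kl.2 mn.1 mn.2)
    simpa only [map_sum, map_smul] using this
  simp only [smulVec, Finset.smul_sum]
  rw [Finset.sum_comm]
  simp only [smul_comm (Rmat Λ f kl _), ← Finset.smul_sum, h1]
  simp only [Finset.smul_sum, Matrix.mulVec, dotProduct, Finset.sum_smul, smul_smul]
  rw [Finset.sum_comm]
  refine Finset.sum_congr rfl fun ij _ => Finset.sum_congr rfl fun mn _ => ?_
  rw [mul_comm]

/-- The values of `f` on `S(Λ)` form the inverse of `R`, and `R² = 1` makes this inverse `R` itself.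
-/
lemma Rmat_swap (h : InhomogeneousData Λ ι p f η T) (hΛ : IsRep Λ) (s m n k : I) :
    Rmat Λ f (s, m) (n, k) = f m n (HopfAlgebra.antipode ℂ (Λ s k)) := by
  let R' : Matrix (I × I) (I × I) ℂ :=
    Matrix.of fun sm nk => f sm.2 nk.1 (HopfAlgebra.antipode ℂ (Λ sm.1 nk.2))
  have h1 : Rmat Λ f * R' = 1 := by
    ext ⟨i, j⟩ ⟨n, k⟩
    have h2 := congrArg (f i n) (hΛ.mul_antipode j k)
    rw [map_sum] at h2
    simp only [h.f_mul] at h2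
    rw [Matrix.mul_apply, Fintype.sum_prod_type]
    refine h2.trans ?_
    rw [apply_ite (f i n), h.f_one, map_zero, Matrix.one_apply]
    simp only [Prod.mk.injEq]
    split_ifs <;> simp_all
  have h2 : R' = Rmat Λ f := by
    rw [← one_mul R', ← h.R_sq, mul_assoc, h1, mul_one]
  rw [← h2]
  rfl

/-- Apply `η` to `Λ S(Λ) = 1`. In the notation below it says `Z = -R Z*`, with `Z*` the matrix
`Zstar`. -/
lemma Zmat_add (h : InhomogeneousData Λ ι p f η T) (hΛ : IsRep Λ) (ij : I × I) (l : I) :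
    Zmat Λ η ij l + ∑ km : I × I, Rmat Λ f ij km * η km.2 (HopfAlgebra.antipode ℂ (Λ km.1 l)) =
      0 := by
  have h1 := congrArg (η ij.1) (hΛ.mul_antipode ij.2 l)
  rw [map_sum, apply_ite (η ij.1), h.η_one, map_zero, ite_self] at h1
  simp only [h.η_mul, Finset.sum_add_distrib, HopfAlgebra.counit_antipode, (hΛ _ _).2] at h1
  rw [Fintype.sum_prod_type]
  simpa [Zmat, Rmat] using h1

/-- Moving `A` to the right of the generators. -/
lemma sum_p_mul_antipode (h : InhomogeneousData Λ ι p f η T)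
    (hM : ∀ s r x, ∑ t, Λ t r * convRight x (f s t ∘ₗ HopfAlgebra.antipode ℂ) =
      ∑ t, convLeft (f t r ∘ₗ HopfAlgebra.antipode ℂ) x * Λ s t) (s : I) (b : A) :
    ∑ t, p t * ι (convRight b (f s t ∘ₗ HopfAlgebra.antipode ℂ)) =
      ι b * p s - ι (convRight b (η s ∘ₗ HopfAlgebra.antipode ℂ)) +
        ∑ t, ι (convLeft (η t ∘ₗ HopfAlgebra.antipode ℂ) b * Λ s t) := by
  -- After commuting each `p t` to the right, the convolution of `f ∘ S` with `f` collapses to the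
  -- counit.
  have e1 : ∑ t, ∑ r, ι (convRight (convRight b (f s t ∘ₗ HopfAlgebra.antipode ℂ)) (f t r)) * p r =
      ι b * p s := by
    rw [Finset.sum_comm]
    simp only [convRight_convRight, ← Finset.sum_mul, ← map_sum, ← convRight_sum_right,
      h.isRep_f_conv_antipode]
    rw [Finset.sum_eq_single s]
    · simp
    · intro r _ hr
      simp [hr.symm, convRight]
    · simp
  have e2 : ∑ t, ι (convRight (convRight b (f s t ∘ₗ HopfAlgebra.antipode ℂ)) (η t)) =
      - ι (convRight b (η s ∘ₗ HopfAlgebra.antipode ℂ)) := by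
    simp only [convRight_convRight, ← map_sum, ← convRight_sum_right, h.f_antipode_conv_η]
    rw [← neg_one_smul ℂ, convRight_smul_right, neg_one_smul, map_neg]
  have e3 : ∑ t, ∑ r, ι (Λ t r * convLeft (η r) (convRight b (f s t ∘ₗ HopfAlgebra.antipode ℂ))) =
      - ∑ t, ι (convLeft (η t ∘ₗ HopfAlgebra.antipode ℂ) b * Λ s t) := by
    rw [Finset.sum_comm]
    -- The exchange relation for `f ∘ S` changes convolution from one side into convolution from the
    -- other, where it meets `η`.
    simp only [← convRight_convLeft, ← map_sum, hM, convLeft_convLeft]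
    rw [Finset.sum_comm]
    simp only [← Finset.sum_mul, ← convLeft_sum_left, h.f_antipode_conv_η]
    rw [← map_neg, ← Finset.sum_neg_distrib]
    congr 1
    refine Finset.sum_congr rfl fun t _ => ?_
    rw [← neg_one_smul ℂ (η t ∘ₗ HopfAlgebra.antipode ℂ), convLeft_smul_left, neg_one_smul,
      neg_mul]
  simp only [h.p_mul, Finset.sum_add_distrib, Finset.sum_sub_distrib, e1, e2, e3]
  abel

end InhomogeneousData

end Data


/-! ### The conjugate opposite algebra: involutions as algebra homomorphisms. -/

/-- The opposite algebra of `B` with the complex conjugate scalar multiplication. -/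
def ConjOp (B : Type*) := Bᵐᵒᵖ

namespace ConjOp

variable {B : Type*} [Ring B]

instance : Ring (ConjOp B) := inferInstanceAs (Ring Bᵐᵒᵖ)

/-- The identity map to the conjugate opposite algebra. -/
def mk : B ≃+ ConjOp B := MulOpposite.opAddEquiv

lemma mk_mul (x y : B) : mk (x * y) = mk y * mk x := rfl

variable [Algebra ℂ B]

noncomputable instance : Algebra ℂ (ConjOp B) :=
  RingHom.toAlgebra' (R := ℂ) (S := ConjOp B) ((algebraMap ℂ Bᵐᵒᵖ).comp (starRingEnd ℂ))
    fun z x => Algebra.commutes (R := ℂ) (A := Bᵐᵒᵖ) (conj z) x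

lemma algebraMap_eq (z : ℂ) : algebraMap ℂ (ConjOp B) z = mk (algebraMap ℂ B (conj z)) := rfl

lemma smul_mk (z : ℂ) (x : B) : z • mk x = mk (conj z • x) := by
  rw [Algebra.smul_def, algebraMap_eq, ← mk_mul, ← Algebra.commutes, ← Algebra.smul_def]

lemma mk_symm_smul (z : ℂ) (x : ConjOp B) : mk.symm (z • x) = conj z • mk.symm x := by
  obtain ⟨y, rfl⟩ := mk.surjective x
  rw [smul_mk, AddEquiv.symm_apply_apply, AddEquiv.symm_apply_apply]

end ConjOp

/-! ### Existence, necessity and uniqueness for the involution on `B`. -/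

section StarStructure

variable {I : Type*} [Fintype I] [DecidableEq I]
variable {A : Type*} [Ring A] [HopfAlgebra ℂ A] {B : Type*} [Ring B] [HopfAlgebra ℂ B]
variable {Λ : Matrix I I A} {ι : A →ₐc[ℂ] B} {p : I → B}
variable {f : Matrix I I (Module.Dual ℂ A)} {η : I → Module.Dual ℂ A} {T : I × I → ℂ}

lemma SatisfiesRelations.map {D D' : Type*} [Ring D] [Algebra ℂ D] [Ring D'] [Algebra ℂ D']
    {j : A →ₐ[ℂ] D} {q : I → D} (h : SatisfiesRelations Λ f η T j q) (ψ : D →ₐ[ℂ] D') :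
    SatisfiesRelations Λ f η T (ψ.comp j) (fun i => ψ (q i)) where
  q_mul s a := by simpa using congrArg ψ (h.q_mul s a)
  q_mul_q kl := by simpa using congrArg ψ (h.q_mul_q kl)

/-- The composition of the involution of `A` with its embedding in `B`, as a homomorphism to the
conjugate opposite algebra. -/
noncomputable def conjEmbedding (ι : A →ₐc[ℂ] B) (sA : HopfStar A) : A →ₐ[ℂ] ConjOp B where
  toFun a := ConjOp.mk (ι (sA.star a))
  map_one' := by rw [sA.star_one, map_one]; rfl
  map_mul' a b := by rw [sA.star_mul, map_mul, ConjOp.mk_mul]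
  map_zero' := by simp
  map_add' a b := by simp
  commutes' z := by
    rw [sA.star_algebraMap, ConjOp.algebraMap_eq]
    exact congrArg ConjOp.mk (ι.toAlgHom.commutes (conj z))

lemma conjEmbedding_apply (sA : HopfStar A) (a : A) :
    conjEmbedding ι sA a = ConjOp.mk (ι (sA.star a)) := rfl

variable {sA : HopfStar A}

/-- Read back in `B`, the relation in the conjugate opposite algebra has its products reversed and
`f`, `η` replaced by their conjugates `dualStar`, so it moves `p s` leftwards past `A`. -/
lemma conj_q_mul_iff (hΛ : ∀ i j, sA.star (Λ i j) = Λ i j) (s : I) (a : A) :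
    (ConjOp.mk (p s) * conjEmbedding ι sA a =
      ∑ t, conjEmbedding ι sA (convRight a (f s t)) * ConjOp.mk (p t) +
      (conjEmbedding ι sA (convRight a (η s)) -
        ∑ t, conjEmbedding ι sA (Λ s t * convLeft (η t) a))) ↔
    ι (sA.star a) * p s = ∑ t, p t * ι (convRight (sA.star a) (sA.dualStar (f s t))) +
      (ι (convRight (sA.star a) (sA.dualStar (η s))) -
        ∑ t, ι (convLeft (sA.dualStar (η t)) (sA.star a) * Λ s t)) := by
  simp only [conjEmbedding_apply, ← ConjOp.mk_mul, ← map_sum, ← map_sub, ← map_add,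
    sA.star_convRight, sA.star_convLeft, sA.star_mul, hΛ]
  exact ConjOp.mk.injective.eq_iff

/-- The analogue of the matrix `Z` for the involution. -/
noncomputable def Zstar (Λ : Matrix I I A) (η : I → Module.Dual ℂ A) : Matrix (I × I) I ℂ :=
  Matrix.of fun km l => η km.2 (HopfAlgebra.antipode ℂ (Λ km.1 l))

/-- `T̃_ij = conj T_ji`. -/
noncomputable def Tstar (T : I × I → ℂ) : I × I → ℂ := fun ij => conj (T (ij.2, ij.1))

namespace InhomogeneousData

variable (h : InhomogeneousData Λ ι p f η T) (hΛr : IsRep Λ)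
  (hΛ : ∀ i j, sA.star (Λ i j) = Λ i j)

include h hΛr hΛ in
lemma conj_Rmat (hf : ∀ i j a, f i j (HopfAlgebra.antipode ℂ (sA.star a)) = conj (f i j a))
    (kl ij : I × I) : conj (Rmat Λ f kl ij) = Rmat Λ f kl.swap ij.swap := by
  obtain ⟨k, l⟩ := kl
  obtain ⟨i, j⟩ := ij
  change conj (f k j (Λ l i)) = Rmat Λ f (l, k) (j, i)
  rw [h.Rmat_swap hΛr, ← hf, hΛ]

-- Reversing products swaps the two indices of each pair, and under reality of `f` conjugation of
-- `R` performs the same swap; hence the relations keep their shape, with `Z` and `T` replaced by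
-- `Zstar` and `Tstar`.
include h hΛr hΛ in
lemma conj_quad_iff
    (hf : ∀ i j a, f i j (HopfAlgebra.antipode ℂ (sA.star a)) = conj (f i j a))
    (hη : ∀ i a, η i (HopfAlgebra.antipode ℂ (sA.star a)) = conj (η i a)) :
    smulVec (Rmat Λ f - 1)
      (quadVec Λ (Zmat Λ η) T (conjEmbedding ι sA) fun i => ConjOp.mk (p i)) = 0 ↔
    smulVec (Rmat Λ f - 1) (quadVec Λ (Zstar Λ η) (Tstar T) ι.toAlgHom p) = 0 := by
  have hR : ∀ kl ij : I × I,
      conj ((Rmat Λ f - 1) kl ij) = (Rmat Λ f - 1) kl.swap ij.swap := by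
    intro kl ij
    rw [Matrix.sub_apply, Matrix.sub_apply, map_sub, h.conj_Rmat hΛr hΛ hf, Matrix.one_apply,
      Matrix.one_apply, apply_ite conj, map_one, map_zero]
    simp only [Prod.swap_inj]
  have hZ : ∀ (ij : I × I) s, conj (Zmat Λ η ij s) = Zstar Λ η ij.swap s := by
    intro ij s
    change conj (η ij.1 (Λ ij.2 s)) = η ij.1 (HopfAlgebra.antipode ℂ (Λ ij.2 s))
    rw [← hη, hΛ]
  have hW : ∀ ij : I × I,
      quadVec Λ (Zmat Λ η) T (conjEmbedding ι sA) (fun i => ConjOp.mk (p i)) ij =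
      ConjOp.mk (quadVec Λ (Zstar Λ η) (Tstar T) ι.toAlgHom p ij.swap) := by
    intro ij
    simp only [quadVec, conjEmbedding_apply, ← ConjOp.mk_mul, ConjOp.smul_mk,
      ConjOp.algebraMap_eq, ← map_sum, ← map_sub, ← map_add, sA.star_mul, hΛ, hZ]
    congr 2
    exact Fintype.sum_equiv (Equiv.prodComm I I) _ _ fun mn => rfl
  have key : ∀ kl, smulVec (Rmat Λ f - 1)
      (quadVec Λ (Zmat Λ η) T (conjEmbedding ι sA) fun i => ConjOp.mk (p i)) kl =
      ConjOp.mk (smulVec (Rmat Λ f - 1)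
        (quadVec Λ (Zstar Λ η) (Tstar T) ι.toAlgHom p) kl.swap) := by
    intro kl
    simp only [smulVec, hW, ConjOp.smul_mk, hR, ← map_sum]
    congr 1
    exact Fintype.sum_equiv (Equiv.prodComm I I) _ _ fun mn => rfl
  constructor
  · intro h0
    funext kl
    have := key kl.swap
    rw [h0, Prod.swap_swap] at this
    exact ConjOp.mk.injective (this.symm.trans (map_zero _).symm)
  · intro h0
    funext kl
    rw [key, h0]
    exact map_zero _

-- From `Z = -R Z*` and `R² = 1`, with `Z*` standing for `Zstar`, also `R Z = -Z*`, so the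
-- difference `Z - Z*` is fixed by `R`.
include h hΛr in
lemma smulVec_Z_sub :
    smulVec (Rmat Λ f - 1) (smulVec (Zmat Λ η - Zstar Λ η) p) = 0 := by
  have h1 : Zmat Λ η = -(Rmat Λ f * Zstar Λ η) := by
    ext ij l
    rw [Matrix.neg_apply, Matrix.mul_apply]
    exact eq_neg_of_add_eq_zero_left (h.Zmat_add hΛr ij l)
  have h2 : Rmat Λ f * Zmat Λ η = - Zstar Λ η := by
    rw [h1, Matrix.mul_neg, ← Matrix.mul_assoc, h.R_sq, Matrix.one_mul]
  have h3 : (Rmat Λ f - 1) * (Zmat Λ η - Zstar Λ η) = 0 := by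
    rw [Matrix.sub_mul, Matrix.mul_sub, h2, Matrix.one_mul]
    rw [h1]
    abel
  rw [smulVec_smulVec, h3]
  funext k
  simp [smulVec]

include h hΛr hΛ in
lemma Rmat_mulVec_Tstar
    (hf : ∀ i j a, f i j (HopfAlgebra.antipode ℂ (sA.star a)) = conj (f i j a)) :
    (Rmat Λ f).mulVec (Tstar T) = -Tstar T := by
  funext kl
  have h1 := congrArg conj (congrFun h.R_T kl.swap)
  simp only [Matrix.mulVec, dotProduct, map_sum, map_mul, h.conj_Rmat hΛr hΛ hf, Prod.swap_swap,
    Pi.neg_apply, map_neg] at h1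
  simp only [Matrix.mulVec, dotProduct, Pi.neg_apply]
  refine Eq.trans ?_ h1
  exact Fintype.sum_equiv (Equiv.prodComm I I) _ _ fun mn => rfl

lemma isMor_one_iff (D : I × I → ℂ) :
    IsMor (1 : Matrix Unit Unit A) (Λ ⊗ₖ Λ) (Matrix.of fun ij _ => D ij) ↔
      ∀ ij : I × I, algebraMap ℂ A (D ij) =
        ∑ mn : I × I, D mn • (Λ ij.1 mn.1 * Λ ij.2 mn.2) := by
  rw [IsMor, Matrix.mul_one, ← Matrix.ext_iff]
  have hcomm : ∀ (x : A) (z : ℂ), x * algebraMap ℂ A z = z • x := fun x z => by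
    rw [← Algebra.commutes, Algebra.smul_def]
  simp only [Matrix.map_apply, Matrix.of_apply, Matrix.mul_apply, Matrix.kroneckerMap_apply,
    hcomm, forall_const]

-- Compared with the known relation, the new one differs by a term in `Z - Zstar`, which `R - 1`
-- kills, and by a term in `Tstar T - T`, on which `R - 1` is multiplication by `-2`. Hence the
-- relation holds exactly when the latter term vanishes.
include h hΛr hΛ in
lemma quad_star_iff
    (hf : ∀ i j a, f i j (HopfAlgebra.antipode ℂ (sA.star a)) = conj (f i j a)) :
    smulVec (Rmat Λ f - 1) (quadVec Λ (Zstar Λ η) (Tstar T) ι.toAlgHom p) = 0 ↔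
    IsMor (1 : Matrix Unit Unit A) (Λ ⊗ₖ Λ)
        (Matrix.of fun ij _ => conj (T (ij.2, ij.1)) - T ij) := by
  let D : I × I → ℂ := Tstar T - T
  change _ ↔ IsMor _ _ (Matrix.of fun ij _ => D ij)
  rw [isMor_one_iff]
  let w : I × I → B := fun ij => ∑ mn : I × I, D mn • ι.toAlgHom (Λ ij.1 mn.1 * Λ ij.2 mn.2)
  let d : I × I → B := fun ij => algebraMap ℂ B (D ij)
  have hsplit : quadVec Λ (Zstar Λ η) (Tstar T) ι.toAlgHom p =
      quadVec Λ (Zmat Λ η) T ι.toAlgHom p + smulVec (Zmat Λ η - Zstar Λ η) p + (d - w) := by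
    funext ij
    simp only [quadVec, Pi.add_apply, Pi.sub_apply, smulVec, d, w, D, Matrix.sub_apply, sub_smul,
      Finset.sum_sub_distrib, map_sub]
    abel
  have hRD : (Rmat Λ f).mulVec D = -D := by
    simp only [D]
    rw [Matrix.mulVec_sub, h.Rmat_mulVec_Tstar hΛr hΛ hf, h.R_T]
    abel
  have hRd : smulVec (Rmat Λ f) d = -d := by
    funext kl
    have := congrArg (algebraMap ℂ B) (congrFun hRD kl)
    simpa [Matrix.mulVec, dotProduct, map_sum, smulVec, d, Algebra.smul_def] using this
  have hRw : smulVec (Rmat Λ f) w = -w := by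
    rw [h.smulVec_sum_mul hΛr, hRD]
    funext ij
    simp [w]
  have hkey : smulVec (Rmat Λ f - 1) (quadVec Λ (Zstar Λ η) (Tstar T) ι.toAlgHom p) =
      (-2 : ℂ) • (d - w) := by
    rw [hsplit, smulVec_add, smulVec_add, h.relations.smulVec_quadVec, h.smulVec_Z_sub hΛr,
      sub_smulVec, one_smulVec, smulVec_sub, hRd, hRw, neg_smul, two_smul]
    abel
  rw [hkey, smul_eq_zero, or_iff_right (by norm_num), sub_eq_zero, funext_iff]
  refine forall_congr' fun ij => ?_
  rw [← h.injective.eq_iff, map_sum]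
  simp only [map_smul]
  have : ι (algebraMap ℂ A (D ij)) = algebraMap ℂ B (D ij) := ι.toAlgHom.commutes _
  rw [this]
  rfl

-- The involution applied to the exchange relation `Λ_f`, with `f` replaced by `f ∘ S` by its
-- reality condition.
include h hΛ in
lemma antipode_exchange
    (hf : ∀ i j a, f i j (HopfAlgebra.antipode ℂ (sA.star a)) = conj (f i j a)) (s r : I) (x : A) :
    ∑ t, Λ t r * convRight x (f s t ∘ₗ HopfAlgebra.antipode ℂ) =
      ∑ t, convLeft (f t r ∘ₗ HopfAlgebra.antipode ℂ) x * Λ s t := by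
  have hd : ∀ i j, sA.dualStar (f i j) = f i j ∘ₗ HopfAlgebra.antipode ℂ := by
    intro i j
    ext b
    rw [sA.dualStar_apply, ← hf, sA.star_star]
    rfl
  have h1 := congrArg sA.star (h.Λ_f s r (sA.star x))
  simp only [map_sum, sA.star_mul, hΛ, sA.star_convLeft, sA.star_convRight, sA.star_star, hd] at h1
  exact h1.symm

include h hΛr hΛ in
/-- Under the reality conditions, the adjoint generators satisfy the defining relations. -/
lemma conj_satisfiesRelations
    (hf : ∀ i j a, f i j (HopfAlgebra.antipode ℂ (sA.star a)) = conj (f i j a))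
    (hη : ∀ i a, η i (HopfAlgebra.antipode ℂ (sA.star a)) = conj (η i a))
    (hT : IsMor (1 : Matrix Unit Unit A) (Λ ⊗ₖ Λ)
        (Matrix.of fun ij _ => conj (T (ij.2, ij.1)) - T ij)) :
    SatisfiesRelations Λ f η T (conjEmbedding ι sA) (fun i => ConjOp.mk (p i)) where
  q_mul s a := by
    have hd : ∀ i j, sA.dualStar (f i j) = f i j ∘ₗ HopfAlgebra.antipode ℂ := by
      intro i j
      ext b
      rw [sA.dualStar_apply, ← hf, sA.star_star]
      rfl
    have hd' : ∀ i, sA.dualStar (η i) = η i ∘ₗ HopfAlgebra.antipode ℂ := by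
      intro i
      ext b
      rw [sA.dualStar_apply, ← hη, sA.star_star]
      rfl
    rw [conj_q_mul_iff hΛ]
    simp only [hd, hd']
    rw [h.sum_p_mul_antipode (h.antipode_exchange hΛ hf)]
    abel
  q_mul_q kl := by
    have h1 := (h.quad_star_iff hΛr hΛ hf).2 hT
    exact congrFun ((h.conj_quad_iff hΛr hΛ hf hη).2 h1) kl

end InhomogeneousData

lemma map_star_mul (s : B →ₛₗ[starRingEnd ℂ] B) (hs : ∀ a b, s (a * b) = s b * s a)
    (x y : B ⊗[ℂ] B) : TensorProduct.map s s (x * y) =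
      TensorProduct.map s s y * TensorProduct.map s s x := by
  induction x using TensorProduct.induction_on with
  | zero => simp
  | add x x' hx hx' => simp [add_mul, mul_add, hx, hx']
  | tmul a b =>
    induction y using TensorProduct.induction_on with
    | zero => simp
    | add y y' hy hy' => simp [add_mul, mul_add, hy, hy']
    | tmul c d => simp [hs]

/-- Involutions with self-adjoint `p i` that extend the involution of `A`. -/
lemma InhomogeneousData.exists_star (h : InhomogeneousData Λ ι p f η T)
    (hA : IsHomogeneousPart Λ)
    (hΛ : ∀ i j, sA.star (Λ i j) = Λ i j)
    (hf : ∀ i j a, f i j (HopfAlgebra.antipode ℂ (sA.star a)) = conj (f i j a))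
    (hη : ∀ i a, η i (HopfAlgebra.antipode ℂ (sA.star a)) = conj (η i a))
    (hT : IsMor (1 : Matrix Unit Unit A) (Λ ⊗ₖ Λ)
        (Matrix.of fun ij _ => conj (T (ij.2, ij.1)) - T ij)) :
    ∃ sB : HopfStar B, ExtendsStar ι sA sB ∧ ∀ i, sB.star (p i) = p i := by
  obtain ⟨ψ, hψA, hψp⟩ := h.relations.exists_lift (h.isPrimitiveExtension hA) h.generated
    (h.conj_satisfiesRelations hA.irrep.1 hΛ hf hη hT)
  let s : B →ₛₗ[starRingEnd ℂ] B :=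
    { toFun := fun b => ConjOp.mk.symm (ψ b)
      map_add' := fun a b => by simp
      map_smul' := fun z a => by rw [map_smul, ConjOp.mk_symm_smul] }
  have hsA : ∀ a, s (ι a) = ι (sA.star a) := by
    intro a
    change ConjOp.mk.symm (ψ (ι a)) = _
    rw [hψA, conjEmbedding_apply, AddEquiv.symm_apply_apply]
  have hsp : ∀ i, s (p i) = p i := by
    intro i
    change ConjOp.mk.symm (ψ (p i)) = _
    rw [hψp, AddEquiv.symm_apply_apply]
  have hmul : ∀ a b, s (a * b) = s b * s a := by
    intro a b
    change ConjOp.mk.symm (ψ (a * b)) = _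
    apply ConjOp.mk.injective
    rw [AddEquiv.apply_symm_apply, map_mul, ConjOp.mk_mul]
    change _ = ConjOp.mk (ConjOp.mk.symm (ψ a)) * ConjOp.mk (ConjOp.mk.symm (ψ b))
    simp
  have hone : s 1 = 1 := by
    have := hsA 1
    rw [map_one ι, sA.star_one, map_one ι] at this
    exact this
  have halg : ∀ z : ℂ, s (algebraMap ℂ B z) = algebraMap ℂ B (conj z) := by
    intro z
    rw [Algebra.algebraMap_eq_smul_one, s.map_smulₛₗ, hone, Algebra.algebraMap_eq_smul_one]
  -- Involutivity and compatibility with `Δ` need checking only on generators.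
  have htop : ∀ b : B, b ∈ Algebra.adjoin ℂ (Set.range ι ∪ Set.range p) := fun b =>
    h.generated ▸ Algebra.mem_top
  refine ⟨⟨s, hmul, fun b => ?_, fun b => ?_⟩, hsA, hsp⟩
  · have hb := htop b
    induction hb using Algebra.adjoin_induction with
    | mem x hx =>
      rcases hx with ⟨a, rfl⟩ | ⟨i, rfl⟩
      · rw [hsA, hsA, sA.star_star]
      · rw [hsp, hsp]
    | algebraMap r => rw [halg, halg, Complex.conj_conj]
    | add x y _ _ hx hy => rw [map_add, map_add, hx, hy]
    | mul x y _ _ hx hy => rw [hmul, hmul, hx, hy]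
  · have hb := htop b
    induction hb using Algebra.adjoin_induction with
    | mem x hx =>
      rcases hx with ⟨a, rfl⟩ | ⟨i, rfl⟩
      · let r := Coalgebra.Repr.arbitrary ℂ a
        rw [hsA, comul_apply_hom, sA.comul_star_repr r, comul_apply_hom_repr ι r, map_sum, map_sum]
        refine Finset.sum_congr rfl fun k _ => ?_
        rw [TensorProduct.map_tmul, TensorProduct.map_tmul, hsA, hsA]
        rfl
      · rw [hsp, h.comul_p]
        simp [map_sum, hsA, hsp, hone, hΛ]
    | algebraMap r => rw [halg]; simp [halg, hone]
    | add x y _ _ hx hy => rw [map_add, map_add, map_add, map_add, hx, hy]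
    | mul x y _ _ hx hy =>
      rw [hmul, Bialgebra.comul_mul, Bialgebra.comul_mul, hx, hy, map_star_mul s hmul]

/-- The reality conditions are necessary. -/
lemma InhomogeneousData.star_conditions (h : InhomogeneousData Λ ι p f η T)
    (hA : IsHomogeneousPart Λ) (hΛ : ∀ i j, sA.star (Λ i j) = Λ i j)
    {sB : HopfStar B} (hext : ExtendsStar ι sA sB) (hp : ∀ i, sB.star (p i) = p i) :
    (∀ i j a, f i j (HopfAlgebra.antipode ℂ (sA.star a)) = conj (f i j a)) ∧
      (∀ i a, η i (HopfAlgebra.antipode ℂ (sA.star a)) = conj (η i a)) ∧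
      IsMor (1 : Matrix Unit Unit A) (Λ ⊗ₖ Λ)
        (Matrix.of fun ij _ => conj (T (ij.2, ij.1)) - T ij) := by
  have hP := h.isPrimitiveExtension hA
  let ψ : B →ₐ[ℂ] ConjOp B :=
    { toFun := fun b => ConjOp.mk (sB.star b)
      map_one' := by rw [sB.star_one]; rfl
      map_mul' := fun a b => by rw [sB.star_mul, ConjOp.mk_mul]
      map_zero' := by simp
      map_add' := fun a b => by simp
      commutes' := fun z => by rw [sB.star_algebraMap]; rfl }
  -- The given involution is a homomorphism to the conjugate opposite algebra, so the relations
  -- persist there with unchanged coefficients.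
  have hrel := h.relations.map ψ
  have hj : ψ.comp ι.toAlgHom = conjEmbedding ι sA := by
    ext a
    change ConjOp.mk (sB.star (ι a)) = ConjOp.mk (ι (sA.star a))
    rw [hext]
  have hq : (fun i => ψ (p i)) = fun i => ConjOp.mk (p i) := by
    funext i
    change ConjOp.mk (sB.star (p i)) = _
    rw [hp]
  rw [hj, hq] at hrel
  have hK : ∀ s b, ι b * p s = ∑ t, p t * ι (convRight b (sA.dualStar (f s t))) +
      (ι (convRight b (sA.dualStar (η s))) -
        ∑ t, ι (convLeft (sA.dualStar (η t)) b * Λ s t)) := by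
    intro s b
    have := (conj_q_mul_iff hΛ s (sA.star b)).1 (hrel.q_mul s (sA.star b))
    rwa [sA.star_star] at this
  -- Moving `A` past `p` by `hK` and back by `p_mul` must be the identity; independence of the `p_r`
  -- over `A` isolates the coefficient, and the counit turns it into an identity of functionals.
  have hinv : ∀ s r, ∑ t, conv (sA.dualStar (f s t)) (f t r) =
      if s = r then (Coalgebra.counit : A →ₗ[ℂ] ℂ) else 0 := by
    intro s r
    ext b
    have h1 := hK s b
    simp only [h.p_mul, Finset.sum_add_distrib] at h1
    rw [Finset.sum_comm] at h1
    simp only [← Finset.sum_mul, ← map_sum ι, convRight_convRight, ← convRight_sum_right] at h1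
    have h2 : ∑ r, ι (convRight b (∑ t, conv (sA.dualStar (f s t)) (f t r)) -
        (if s = r then b else 0)) * p r + ι (convRight b (sA.dualStar (η s)) -
        ∑ t, convLeft (sA.dualStar (η t)) b * Λ s t +
        (∑ t, (convRight b (conv (sA.dualStar (f s t)) (η t)) -
          ∑ r, Λ t r * convLeft (η r) (convRight b (sA.dualStar (f s t)))))) = 0 := by
      simp only [map_sub, map_add, sub_mul, Finset.sum_sub_distrib]
      have h3 : ∑ r, ι (if s = r then b else 0) * p r = ι b * p s := by
        rw [Finset.sum_eq_single s]
        · simp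
        · intro r _ hr
          simp [hr.symm]
        · simp
      rw [h3, h1]
      simp only [map_sum, Finset.sum_sub_distrib]
      abel
    have h4 := congrArg (Coalgebra.counit (R := ℂ)) ((hP.linearIndependent h2).1 r)
    rw [map_sub, counit_convRight, map_zero, sub_eq_zero] at h4
    rw [h4]
    split_ifs <;> simp
  -- Both are convolution inverses of `f`, one on the left and one on the right.
  have hd : ∀ s u, sA.dualStar (f s u) = f s u ∘ₗ HopfAlgebra.antipode ℂ := by
    intro s u
    have h1 : ∑ r, conv (∑ t, conv (sA.dualStar (f s t)) (f t r))
        (f r u ∘ₗ HopfAlgebra.antipode ℂ) = f s u ∘ₗ HopfAlgebra.antipode ℂ := by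
      simp only [hinv]
      rw [Finset.sum_eq_single s]
      · simp
      · intro r _ hr
        ext a
        simp [hr.symm, conv]
      · simp
    rw [← h1]
    simp only [conv_sum_left, conv_assoc]
    rw [Finset.sum_comm]
    simp only [← conv_sum_right, h.f_conv_f_antipode]
    rw [Finset.sum_eq_single u]
    · simp
    · intro r _ hr
      ext a
      simp [hr, conv]
    · simp
  have hf : ∀ i j a, f i j (HopfAlgebra.antipode ℂ (sA.star a)) = conj (f i j a) := by
    intro i j a
    have := LinearMap.congr_fun (hd i j) (sA.star a)
    rw [sA.dualStar_apply, sA.star_star] at this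
    exact this.symm
  -- `ρ` is the defect of reality of `η`.
  let ρ : I → Module.Dual ℂ A := fun s =>
    sA.dualStar (η s) - η s ∘ₗ HopfAlgebra.antipode ℂ
  have hρ : ∀ s b, convRight b (ρ s) = ∑ t, convLeft (ρ t) b * Λ s t := by
    intro s b
    apply h.injective
    have h1 := hK s b
    simp only [hd] at h1
    rw [h.sum_p_mul_antipode (h.antipode_exchange hΛ hf)] at h1
    simp only [ρ, convRight_sub_right, convLeft_sub_left, sub_mul, Finset.sum_sub_distrib, map_sub,
      map_sum]
    rw [← sub_eq_zero] at h1 ⊢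
    rw [← neg_eq_zero, ← h1]
    abel
  -- In the identity for `ρ` the matrix `Λ` stands on the wrong side. Convolution with `f` moves it
  -- across by the exchange relation, and the vanishing of morphisms then applies; `f ∘ S` undoes
  -- the convolution afterwards.
  let σ : I → Module.Dual ℂ A := fun s => ∑ t, conv (f s t) (ρ t)
  have hσ : ∀ s, σ s = 0 := by
    refine hA.eq_zero_of_convRight fun s b => ?_
    simp only [σ, convRight_sum_right, convLeft_sum_left, Finset.mul_sum]
    simp only [← convRight_convRight, ← convLeft_convLeft, hρ]
    rw [Finset.sum_comm]
    conv_rhs => rw [Finset.sum_comm]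
    refine Finset.sum_congr rfl fun r _ => ?_
    rw [h.Λ_f]
    simp only [convRight_convLeft]
  have hρ0 : ∀ u, ρ u = 0 := by
    intro u
    have h1 : ∑ s, conv (f u s ∘ₗ HopfAlgebra.antipode ℂ) (σ s) = ρ u := by
      simp only [σ, conv_sum_right, ← conv_assoc]
      rw [Finset.sum_comm]
      simp only [← conv_sum_left, h.isRep_f_conv_antipode]
      rw [Finset.sum_eq_single u]
      · simp
      · intro r _ hr
        ext a
        simp [hr.symm, conv]
      · simp
    rw [← h1]
    refine Finset.sum_eq_zero fun s _ => ?_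
    rw [hσ]
    ext a
    simp [conv]
  have hη : ∀ i a, η i (HopfAlgebra.antipode ℂ (sA.star a)) = conj (η i a) := by
    intro i a
    have := LinearMap.congr_fun (sub_eq_zero.1 (hρ0 i)) (sA.star a)
    rw [sA.dualStar_apply, sA.star_star] at this
    exact this.symm
  refine ⟨hf, hη, ?_⟩
  rw [← h.quad_star_iff hA.irrep.1 hΛ hf, ← h.conj_quad_iff hA.irrep.1 hΛ hf hη]
  exact hrel.smulVec_quadVec

lemma InhomogeneousData.star_unique (h : InhomogeneousData Λ ι p f η T)
    {sB sB' : HopfStar B} (hext : ExtendsStar ι sA sB) (hp : ∀ i, sB.star (p i) = p i)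
    (hext' : ExtendsStar ι sA sB') (hp' : ∀ i, sB'.star (p i) = p i) : sB = sB' := by
  refine HopfStar.ext_star fun b => ?_
  have hb : b ∈ Algebra.adjoin ℂ (Set.range ι ∪ Set.range p) := h.generated ▸ Algebra.mem_top
  induction hb using Algebra.adjoin_induction with
  | mem x hx =>
    rcases hx with ⟨a, rfl⟩ | ⟨i, rfl⟩
    · rw [hext, hext']
    · rw [hp, hp']
  | algebraMap r => rw [sB.star_algebraMap, sB'.star_algebraMap]
  | add x y _ _ hx hy => rw [map_add, map_add, hx, hy]
  | mul x y _ _ hx hy => rw [sB.star_mul, sB'.star_mul, hx, hy]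

end StarStructure


/-! ### Linear algebra of a change of basis. -/

section ConjBy

variable {κ : Type*} [Fintype κ] [DecidableEq κ]
variable {D E F : Type*} [AddCommGroup D] [Module ℂ D] [AddCommGroup E] [Module ℂ E]
  [AddCommGroup F] [Module ℂ F]

lemma map_smulVec {lam mu : Type*} [Fintype mu] (L : D →ₗ[ℂ] E) (X : Matrix lam mu ℂ) (w : mu → D)
    (i : lam) : L (smulVec X w i) = smulVec X (fun k => L (w k)) i := by
  simp [smulVec, map_sum]

/-- The matrix `N X M`, where `N` and `M` are scalar matrices. -/
def conjBy (N M : Matrix κ κ ℂ) (X : κ → κ → D) (i j : κ) : D :=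
  smulVec N (fun k => smulVec M.transpose (X k) j) i

variable {N M : Matrix κ κ ℂ}

lemma map_conjBy (L : D →ₗ[ℂ] E) (X : κ → κ → D) (i j : κ) :
    L (conjBy N M X i j) = conjBy N M (fun k l => L (X k l)) i j := by
  simp only [conjBy, map_smulVec]

lemma conjBy_eq_sum (X : κ → κ → D) (i j : κ) :
    conjBy N M X i j = ∑ k, ∑ l, (N i k * M l j) • X k l := by
  simp only [conjBy, smulVec, Finset.smul_sum, smul_smul, Matrix.transpose_apply]

lemma conjBy_eq (X : κ → κ → D) (i j : κ) :
    conjBy N M X i j = smulVec M.transpose (fun l => smulVec N (fun k => X k l) i) j := by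
  simp only [conjBy_eq_sum, smulVec, Finset.smul_sum, smul_smul, Matrix.transpose_apply]
  rw [Finset.sum_comm]
  simp only [mul_comm]

/-- A contracted index is insensitive to the change of basis. A general bilinear `β` lets one
statement cover products, tensors and scalar actions. -/
lemma sum_smulVec_smulVec (hMN : M * N = 1) (β : D →ₗ[ℂ] F →ₗ[ℂ] E) (x : κ → D) (w : κ → F) :
    ∑ t, β (smulVec M.transpose x t) (smulVec N w t) = ∑ l, β (x l) (w l) := by
  have h1 : ∀ l, w l = smulVec M (smulVec N w) l := by
    intro l
    rw [smulVec_smulVec, hMN, one_smulVec]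
  conv_rhs => enter [2, l]; rw [h1]
  generalize smulVec N w = v
  simp only [smulVec, map_sum, LinearMap.sum_apply, map_smul, LinearMap.smul_apply,
    Matrix.transpose_apply]
  exact Finset.sum_comm

lemma sum_smulVec_left {lam mu : Type*} [Fintype lam] [Fintype mu] (β : D →ₗ[ℂ] F →ₗ[ℂ] E)
    (N : Matrix lam lam ℂ) (X : lam → mu → D) (w : mu → F) (i : lam) :
    ∑ l, β (smulVec N (fun k => X k l) i) (w l) = smulVec N (fun k => ∑ l, β (X k l) (w l)) i := by
  simp only [smulVec, map_sum, LinearMap.sum_apply, map_smul, LinearMap.smul_apply,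
    Finset.smul_sum]
  exact Finset.sum_comm

lemma conjBy_smulVec (hMN : M * N = 1) (β : D →ₗ[ℂ] F →ₗ[ℂ] E) (X : κ → κ → D) (w : κ → F)
    (i : κ) :
    ∑ t, β (conjBy N M X i t) (smulVec N w t) = smulVec N (fun k => ∑ t, β (X k t) (w t)) i := by
  simp only [conjBy_eq]
  rw [sum_smulVec_smulVec hMN, sum_smulVec_left]

lemma conjBy_conjBy (hMN : M * N = 1) (β : D →ₗ[ℂ] F →ₗ[ℂ] E) (X : κ → κ → D) (Y : κ → κ → F)
    (i j : κ) :
    ∑ t, β (conjBy N M X i t) (conjBy N M Y t j) =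
      conjBy N M (fun k l => ∑ t, β (X k t) (Y t l)) i j := by
  refine (conjBy_smulVec hMN β X (fun k => smulVec M.transpose (Y k) j) i).trans ?_
  rw [conjBy]
  congr 1
  funext k
  simp only [smulVec, map_sum, map_smul, Finset.smul_sum]
  exact Finset.sum_comm

lemma conjBy_one (hNM : N * M = 1) (e : D) (i j : κ) :
    conjBy N M (fun k l => if k = l then e else 0) i j = if i = j then e else 0 := by
  have h1 := congrFun (congrFun hNM i) j
  rw [Matrix.mul_apply, Matrix.one_apply] at h1
  simp only [conjBy_eq_sum, smul_ite, smul_zero, Finset.sum_ite_eq, Finset.mem_univ, if_true]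
  rw [← Finset.sum_smul, h1]
  split_ifs <;> simp

/-- This governs objects with two pairs of indices, such as `R` and `Λ ⊗ Λ`. -/
lemma conjBy_bilin (β : D →ₗ[ℂ] F →ₗ[ℂ] E) (N M : Matrix κ κ ℂ) (X : κ → κ → D) (Y : κ → κ → F)
    (i j k l : κ) :
    β (conjBy N M X i j) (conjBy N M Y k l) =
      conjBy (N ⊗ₖ N) (M ⊗ₖ M) (fun ab cd : κ × κ => β (X ab.1 cd.1) (Y ab.2 cd.2)) (i, k)
        (j, l) := by
  simp only [conjBy_eq_sum, map_sum, LinearMap.sum_apply, map_smul, LinearMap.smul_apply,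
    Fintype.sum_prod_type, Matrix.kroneckerMap_apply, Finset.smul_sum, smul_smul]
  refine (Finset.sum_congr rfl fun a _ => Finset.sum_comm).trans (Finset.sum_comm.trans ?_)
  refine Finset.sum_congr rfl fun a _ => Finset.sum_congr rfl fun b _ => Finset.sum_comm.trans ?_
  refine Finset.sum_congr rfl fun c _ => Finset.sum_congr rfl fun d _ => ?_
  congr 1
  ring

end ConjBy

/-! ### Invariance of the data under a change of basis. -/

section ChangeOfBasis

variable {I : Type*} [Fintype I] [DecidableEq I]
variable {A : Type*} [Ring A] [HopfAlgebra ℂ A] {B : Type*} [Ring B] [HopfAlgebra ℂ B]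
variable {Λ : Matrix I I A} {ι : A →ₐc[ℂ] B} {p : I → B}
variable {f : Matrix I I (Module.Dual ℂ A)} {η : I → Module.Dual ℂ A} {T : I × I → ℂ}
variable {N M : Matrix I I ℂ}

lemma adjoin_eq_top_of_forall_mem {B : Type*} [Ring B] [Algebra ℂ B] {S : Set B} {q p : I → B}
    (h : Algebra.adjoin ℂ (S ∪ Set.range p) = ⊤)
    (hp : ∀ i, p i ∈ Algebra.adjoin ℂ (S ∪ Set.range q)) :
    Algebra.adjoin ℂ (S ∪ Set.range q) = ⊤ := by
  rw [eq_top_iff, ← h, Algebra.adjoin_le_iff]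
  rintro x (hx | ⟨i, rfl⟩)
  · exact Algebra.subset_adjoin (Or.inl hx)
  · exact hp i

/-- Convolution `ρ ↦ a * ρ` as a linear map. -/
noncomputable def convRightDual (a : A) : Module.Dual ℂ A →ₗ[ℂ] A where
  toFun ρ := convRight a ρ
  map_add' ρ σ := convRight_add_right a ρ σ
  map_smul' z ρ := convRight_smul_right a z ρ

/-- Convolution `ρ ↦ ρ * a` as a linear map. -/
noncomputable def convLeftDual (a : A) : Module.Dual ℂ A →ₗ[ℂ] A where
  toFun ρ := convLeft ρ a
  map_add' ρ σ := convLeft_add_left a ρ σ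
  map_smul' z ρ := convLeft_smul_left a z ρ

lemma Rmat_conjBy (N M : Matrix I I ℂ) (Λ : Matrix I I A) (f : Matrix I I (Module.Dual ℂ A)) :
    Rmat (conjBy N M Λ) (conjBy N M f) = (N ⊗ₖ N) * Rmat Λ f * (M ⊗ₖ M) := by
  ext ⟨i, j⟩ ⟨s, m⟩
  refine (conjBy_bilin LinearMap.id N M f Λ i m j s).trans ?_
  rw [conjBy_eq, Matrix.mul_apply]
  simp only [smulVec, Matrix.mul_apply, Matrix.transpose_apply, Matrix.kroneckerMap_apply,
    LinearMap.id_apply, smul_eq_mul]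
  rw [Fintype.sum_prod_type, Fintype.sum_prod_type_right]
  refine Finset.sum_congr rfl fun a _ => Finset.sum_congr rfl fun b _ => ?_
  rw [mul_comm, mul_comm (M a m)]
  rfl

lemma Zmat_conjBy (N M : Matrix I I ℂ) (Λ : Matrix I I A) (η : I → Module.Dual ℂ A) :
    Zmat (conjBy N M Λ) (smulVec N η) = (N ⊗ₖ N) * Zmat Λ η * M := by
  ext ⟨i, j⟩ m
  refine (congrArg (smulVec (D := Module.Dual ℂ A) N η i)
    (conjBy_eq (fun a b => Λ a b) j m)).trans ?_
  simp only [Matrix.mul_apply, Matrix.kroneckerMap_apply, smulVec, LinearMap.sum_apply,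
    LinearMap.smul_apply, map_sum, map_smul, Fintype.sum_prod_type, smul_eq_mul, Finset.sum_mul,
    Finset.mul_sum, Matrix.transpose_apply]
  refine Finset.sum_congr rfl fun a _ => Finset.sum_comm.trans ?_
  refine Finset.sum_congr rfl fun b _ => Finset.sum_congr rfl fun c _ => ?_
  change M a m * (N j c * (N i b * η b (Λ c a))) = N i b * N j c * η b (Λ c a) * M a m
  ring


lemma quadVec_conjBy {D : Type*} [Ring D] [Algebra ℂ D] (hMN : M * N = 1) (Λ : Matrix I I A)
    (Z : Matrix (I × I) I ℂ) (T : I × I → ℂ) (j : A →ₐ[ℂ] D) (q : I → D) :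
    quadVec (conjBy N M Λ) ((N ⊗ₖ N) * Z * M) ((N ⊗ₖ N).mulVec T) j (smulVec N q) =
      smulVec (N ⊗ₖ N) (quadVec Λ Z T j q) := by
  have hMN2 : (M ⊗ₖ M) * (N ⊗ₖ N) = 1 := by
    rw [← Matrix.mul_kronecker_mul, hMN, Matrix.one_kronecker_one]
  have h1 : (fun ij : I × I => smulVec N q ij.1 * smulVec N q ij.2) =
      smulVec (N ⊗ₖ N) fun ij => q ij.1 * q ij.2 := by
    funext ij
    simp only [smulVec, Finset.sum_mul, Finset.mul_sum, smul_mul_smul_comm,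
      Fintype.sum_prod_type, Matrix.kroneckerMap_apply]
    exact Finset.sum_comm
  have h2 : smulVec ((N ⊗ₖ N) * Z * M) (smulVec N q) = smulVec (N ⊗ₖ N) (smulVec Z q) := by
    rw [smulVec_smulVec, Matrix.mul_assoc, hMN, Matrix.mul_one, smulVec_smulVec]
  have h3 : (fun ij : I × I => algebraMap ℂ D ((N ⊗ₖ N).mulVec T ij)) =
      smulVec (N ⊗ₖ N) fun ij => algebraMap ℂ D (T ij) := by
    funext ij
    simp only [smulVec, Matrix.mulVec, dotProduct, map_sum, map_mul, Algebra.smul_def]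
  have h4 : (fun ij : I × I => ∑ mn : I × I, (N ⊗ₖ N).mulVec T mn •
      j (conjBy N M Λ ij.1 mn.1 * conjBy N M Λ ij.2 mn.2)) =
      smulVec (N ⊗ₖ N) fun ij => ∑ mn : I × I, T mn • j (Λ ij.1 mn.1 * Λ ij.2 mn.2) := by
    funext ij
    have h5 := conjBy_smulVec hMN2 (LinearMap.lsmul ℂ D).flip
      (fun ab cd : I × I => j (Λ ab.1 cd.1 * Λ ab.2 cd.2)) T ij
    refine Eq.trans (Finset.sum_congr rfl fun mn _ => ?_) h5
    have h6 := map_conjBy (N := N ⊗ₖ N) (M := M ⊗ₖ M) j.toLinearMap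
      (fun ab cd : I × I => Λ ab.1 cd.1 * Λ ab.2 cd.2) ij mn
    have h7 := conjBy_bilin (LinearMap.mul ℂ A) N M Λ Λ ij.1 mn.1 ij.2 mn.2
    simp only [LinearMap.flip_apply, LinearMap.lsmul_apply]
    congr 1
    exact (congrArg j h7).trans h6
  have h5 := congrArg₂ (· - ·) (congrArg₂ (· + ·) (congrArg₂ (· - ·) h1 h2) h3) h4
  refine h5.trans ?_
  simp only [← smulVec_add, ← smulVec_sub]
  rfl

/-- Every axiom is a tensor identity, so the factors `M N = 1` cancel at contracted indices and the
free indices carry the transformation. -/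
lemma InhomogeneousData.changeOfBasis (h : InhomogeneousData Λ ι p f η T) (hMN : M * N = 1) :
    InhomogeneousData (conjBy N M Λ) ι (smulVec N p) (conjBy N M f) (smulVec N η)
      ((N ⊗ₖ N).mulVec T) := by
  have hNM : N * M = 1 := mul_eq_one_comm.1 hMN
  have hNM2 : (N ⊗ₖ N) * (M ⊗ₖ M) = 1 := by
    rw [← Matrix.mul_kronecker_mul, hNM, Matrix.one_kronecker_one]
  have hMN2 : (M ⊗ₖ M) * (N ⊗ₖ N) = 1 := by
    rw [← Matrix.mul_kronecker_mul, hMN, Matrix.one_kronecker_one]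
  have hp : ∀ i, p i = smulVec M (smulVec N p) i := fun i => by
    rw [smulVec_smulVec, hMN, one_smulVec]
  have hfa : ∀ a i j, conjBy N M f i j a = conjBy N M (fun k l => f k l a) i j := fun a i j =>
    map_conjBy (LinearMap.applyₗ a) f i j
  have hηa : ∀ a i, smulVec N η i a = smulVec N (fun k => η k a) i := fun a i =>
    map_smulVec (LinearMap.applyₗ a) N η i
  have hfr : ∀ a i j, convRight a (conjBy N M f i j) =
      conjBy N M (fun k l => convRight a (f k l)) i j := fun a i j =>
    map_conjBy (convRightDual a) f i j
  have hfl : ∀ a i j, convLeft (conjBy N M f i j) a =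
      conjBy N M (fun k l => convLeft (f k l) a) i j := fun a i j =>
    map_conjBy (convLeftDual a) f i j
  refine ⟨?_, h.injective, ?_, ?_, ?_, ?_, ?_, ?_, ?_, ?_, ⟨?_, ?_⟩, ?_, ?_⟩
  · refine adjoin_eq_top_of_forall_mem h.generated fun i => ?_
    rw [hp i, smulVec]
    have h1 : ∀ k, smulVec N p k ∈
        Algebra.adjoin ℂ (Set.range ι ∪ Set.range (smulVec N p)) := fun k =>
      Algebra.subset_adjoin (Or.inr (Set.mem_range_self k))
    exact sum_mem fun k _ => Subalgebra.smul_mem _ (h1 k) _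
  · intro i
    have h1 := map_smulVec (Coalgebra.comul (R := ℂ) (A := B)) N p i
    rw [h1]
    simp only [h.comul_p]
    have h2 := conjBy_smulVec hMN (TensorProduct.mk ℂ B B) (fun k l => ι (Λ k l)) p i
    have h3 := map_smulVec ((TensorProduct.mk ℂ B B).flip 1) N p i
    have h4 : ∀ k l, ι (conjBy N M Λ k l) = conjBy N M (fun k l => ι (Λ k l)) k l := fun k l =>
      map_conjBy (ι.toAlgHom.toLinearMap) Λ k l
    simp only [h4]
    refine Eq.trans ?_ (congrArg₂ (· + ·) h2 h3).symm
    exact congrFun (smulVec_add N (fun k => ∑ t, ι (Λ k t) ⊗ₜ[ℂ] p t) fun k => p k ⊗ₜ[ℂ] 1) i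
  · intro i
    rw [map_smulVec]
    simp [h.counit_p, smulVec]
  · by_contra! hcon
    obtain ⟨i, hi⟩ := h.exists_notMem
    apply hi
    rw [hp i, smulVec]
    have h1 : ∀ k, smulVec N p k ∈ ι.toAlgHom.range := hcon
    exact sum_mem fun k _ => Subalgebra.smul_mem ι.toAlgHom.range (h1 k) _
  · intro s t
    rw [hfa]
    simp only [h.f_one]
    exact conjBy_one hNM 1 s t
  · intro s t a b
    simp only [hfa, h.f_mul]
    exact (conjBy_conjBy hMN (LinearMap.mul ℂ ℂ) _ _ s t).symm
  · intro s
    rw [hηa]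
    simp [h.η_one, smulVec]
  · intro s a b
    simp only [hηa, hfa, h.η_mul]
    have h1 := conjBy_smulVec hMN (LinearMap.mul ℂ ℂ) (fun k l => f k l a) (fun l => η l b) s
    have h2 := map_smulVec ((LinearMap.mul ℂ ℂ).flip (Coalgebra.counit (R := ℂ) b)) N
      (fun k => η k a) s
    refine Eq.trans ?_ (congrArg₂ (· + ·) h2 h1).symm
    exact congrFun (smulVec_add N (fun k => η k a * Coalgebra.counit (R := ℂ) b)
      fun k => ∑ t, f k t a * η t b) s
  · intro s r a
    simp only [hfl, hfr]
    have h1 := conjBy_conjBy hMN (LinearMap.mul ℂ A) Λ (fun k l => convLeft (f k l) a) s r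
    have h2 := conjBy_conjBy hMN (LinearMap.mul ℂ A) (fun k l => convRight a (f k l)) Λ s r
    refine h1.trans (Eq.trans ?_ h2.symm)
    simp only [LinearMap.mul_apply', h.Λ_f]
  · intro s a
    have h1 := map_smulVec (LinearMap.mulRight ℂ (ι a)) N p s
    refine h1.trans ?_
    simp only [LinearMap.mulRight_apply, h.p_mul]
    have h2 : ∀ i j, ι (convRight a (conjBy N M f i j)) =
        conjBy N M (fun k l => ι (convRight a (f k l))) i j := fun i j =>
      map_conjBy (ι.toAlgHom.toLinearMap ∘ₗ convRightDual a) f i j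
    have h3 : ∀ i, ι (convRight a (smulVec N η i)) =
        smulVec N (fun k => ι (convRight a (η k))) i := fun i =>
      map_smulVec (ι.toAlgHom.toLinearMap ∘ₗ convRightDual a) N η i
    have h4 : ∀ i, convLeft (smulVec N η i) a = smulVec N (fun k => convLeft (η k) a) i := fun i =>
      map_smulVec (convLeftDual a) N η i
    have h5 := conjBy_smulVec hMN (LinearMap.mul ℂ B) (fun k l => ι (convRight a (f k l))) p s
    have h6 := conjBy_smulVec hMN (LinearMap.compr₂ (LinearMap.mul ℂ A) ι.toAlgHom.toLinearMap) Λ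
      (fun l => convLeft (η l) a) s
    have h7 := congrFun (smulVec_add N (fun k => ∑ t, ι (convRight a (f k t)) * p t)
      ((fun k => ι (convRight a (η k))) - fun k => ∑ t, ι (Λ k t * convLeft (η t) a))) s
    refine h7.trans ?_
    rw [smulVec_sub]
    refine congrArg₂ (· + ·) (h5.symm.trans ?_) (congrArg₂ (· - ·) (h3 s).symm (h6.symm.trans ?_))
    · exact Finset.sum_congr rfl fun t _ => congrArg (· * _) (h2 s t).symm
    · simp only [h4]
      rfl
  · intro kl
    have h1 : smulVec (Rmat (conjBy N M Λ) (conjBy N M f) - 1)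
        (quadVec (conjBy N M Λ) (Zmat (conjBy N M Λ) (smulVec N η)) ((N ⊗ₖ N).mulVec T)
          ι.toAlgHom (smulVec N p)) = 0 := by
      have h2 : Rmat (conjBy N M Λ) (conjBy N M f) - 1 =
          (N ⊗ₖ N) * (Rmat Λ f - 1) * (M ⊗ₖ M) := by
        rw [Rmat_conjBy, Matrix.mul_sub, Matrix.sub_mul, Matrix.mul_one, hNM2]
      rw [h2, Zmat_conjBy, quadVec_conjBy hMN, smulVec_smulVec, Matrix.mul_assoc, hMN2,
        Matrix.mul_one, ← smulVec_smulVec, h.relations.smulVec_quadVec, smulVec_zero]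
    exact congrFun h1 kl
  · rw [Rmat_conjBy]
    calc (N ⊗ₖ N) * Rmat Λ f * (M ⊗ₖ M) * ((N ⊗ₖ N) * Rmat Λ f * (M ⊗ₖ M)) =
          (N ⊗ₖ N) * Rmat Λ f * ((M ⊗ₖ M) * (N ⊗ₖ N)) * Rmat Λ f * (M ⊗ₖ M) := by
            simp only [Matrix.mul_assoc]
      _ = (N ⊗ₖ N) * (Rmat Λ f * Rmat Λ f) * (M ⊗ₖ M) := by
            rw [hMN2, Matrix.mul_one, Matrix.mul_assoc (N ⊗ₖ N)]
      _ = 1 := by rw [h.R_sq, Matrix.mul_one, hNM2]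
  · rw [Rmat_conjBy, Matrix.mulVec_mulVec, Matrix.mul_assoc, hMN2, Matrix.mul_one,
      ← Matrix.mulVec_mulVec, h.R_T, Matrix.mulVec_neg]

end ChangeOfBasis

/-! ### Replacing the generators by shifted multiples. -/

section Shift

variable {I : Type*} [Fintype I] [DecidableEq I]
variable {A : Type*} [Ring A] [HopfAlgebra ℂ A] {B : Type*} [Ring B] [HopfAlgebra ℂ B]
variable {Λ : Matrix I I A} {ι : A →ₐc[ℂ] B} {p q : I → B}
variable {f : Matrix I I (Module.Dual ℂ A)} {η : I → Module.Dual ℂ A} {T : I × I → ℂ}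

/-- The functionals `η` for the shifted generators. -/
noncomputable def shiftEta (c : ℂ) (h : I → ℂ) (f : Matrix I I (Module.Dual ℂ A))
    (η : I → Module.Dual ℂ A) (i : I) : Module.Dual ℂ A :=
  c⁻¹ • (η i + ∑ k, h k • f i k - h i • (Coalgebra.counit : A →ₗ[ℂ] ℂ))

/-- The constants `T` for the shifted generators. -/
noncomputable def shiftT (c : ℂ) (h : I → ℂ) (R : Matrix (I × I) (I × I) ℂ)
    (Z : Matrix (I × I) I ℂ) (T : I × I → ℂ) : I × I → ℂ :=
  (c ^ 2)⁻¹ • T + (2 * c ^ 2)⁻¹ • (1 - R).mulVec (-Z.mulVec h + fun ij => h ij.1 * h ij.2)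

/-- The coboundary `∑ j, h_j Λ_ij`. -/
noncomputable def actVec (Λ : Matrix I I A) (h : I → ℂ) (i : I) : A := ∑ j, h j • Λ i j

lemma shiftedGenerator_eq (c : ℂ) (h : I → ℂ) (i : I) :
    shiftedGenerator Λ ι p c h i = c • p i + algebraMap ℂ B (h i) - ι (actVec Λ h i) := by
  simp [shiftedGenerator, actVec, map_sum]

lemma convRight_shiftEta (c : ℂ) (h : I → ℂ) (i : I) (a : A) :
    convRight a (shiftEta c h f η i) =
      c⁻¹ • (convRight a (η i) + ∑ k, h k • convRight a (f i k) - h i • a) := by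
  simp only [shiftEta, convRight_smul_right, convRight_sub_right, convRight_add_right,
    convRight_sum_right, convRight_counit]

lemma convLeft_shiftEta (c : ℂ) (h : I → ℂ) (i : I) (a : A) :
    convLeft (shiftEta c h f η i) a =
      c⁻¹ • (convLeft (η i) a + ∑ k, h k • convLeft (f i k) a - h i • a) := by
  simp only [shiftEta, convLeft_smul_left, convLeft_sub_left, convLeft_add_left,
    convLeft_sum_left, convLeft_counit]

lemma eq_of_eq_shiftedGenerator {c : ℂ} (hc : c ≠ 0) {h : I → ℂ}
    (hp : ∀ i, p i = shiftedGenerator Λ ι q c h i) (i : I) :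
    q i = c⁻¹ • (p i - algebraMap ℂ B (h i) + ι (actVec Λ h i)) := by
  rw [hp, shiftedGenerator_eq, eq_inv_smul_iff₀ hc]
  abel

@[simp] lemma zero_smulVec {κ lam D : Type*} [Fintype lam] [AddCommGroup D] [Module ℂ D]
    (w : lam → D) : smulVec (0 : Matrix κ lam ℂ) w = 0 := by
  funext k
  simp [smulVec]

namespace InhomogeneousData

variable (d : InhomogeneousData Λ ι p f η T) {c : ℂ} (hc : c ≠ 0) {h : I → ℂ}
  (hp : ∀ i, p i = shiftedGenerator Λ ι q c h i)

include d hc hp in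
lemma shift_comul (hΛ : IsRep Λ) (i : I) : Coalgebra.comul (R := ℂ) (q i) =
    ∑ j, ι (Λ i j) ⊗ₜ[ℂ] q j + q i ⊗ₜ[ℂ] (1 : B) := by
  have h1 : Coalgebra.comul (R := ℂ) (ι (actVec Λ h i)) =
      ∑ j, ι (Λ i j) ⊗ₜ[ℂ] ι (actVec Λ h j) := by
    simp only [actVec, map_sum, map_smul, comul_apply_hom, (hΛ _ _).1, TensorProduct.map_tmul,
      TensorProduct.tmul_sum, TensorProduct.tmul_smul, Finset.smul_sum]
    exact Finset.sum_comm
  have h2 : ι (actVec Λ h i) = ∑ j, h j • ι (Λ i j) := by simp [actVec, map_sum]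
  simp only [eq_of_eq_shiftedGenerator hc hp, map_smul, map_add, map_sub, d.comul_p, h1,
    Bialgebra.comul_algebraMap, TensorProduct.tmul_smul, TensorProduct.tmul_add,
    TensorProduct.tmul_sub, ← TensorProduct.smul_tmul', TensorProduct.add_tmul,
    TensorProduct.sub_tmul, Finset.sum_add_distrib, Finset.sum_sub_distrib, ← Finset.smul_sum]
  rw [← smul_add]
  congr 1
  rw [h2, TensorProduct.sum_tmul]
  simp only [Algebra.algebraMap_eq_smul_one, TensorProduct.tmul_smul, TensorProduct.smul_tmul,
    Algebra.TensorProduct.one_def]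
  abel

-- Here `p` are the old and `q` the new generators. The commutator of `h - Λ h` with `A` is absorbed
-- into `η`; the cross terms match by the exchange relation `Λ_f`.
include d hc hp in
lemma shift_mul (s : I) (a : A) : q s * ι a = ∑ t, ι (convRight a (f s t)) * q t +
    (ι (convRight a (shiftEta c h f η s)) -
      ∑ t, ι (Λ s t * convLeft (shiftEta c h f η t) a)) := by
  have h1 : ∑ t, convRight a (f s t) * actVec Λ h t =
      ∑ t, ∑ k, h k • (Λ s t * convLeft (f t k) a) := by
    rw [Finset.sum_comm]
    simp only [actVec, Finset.mul_sum, mul_smul_comm]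
    rw [Finset.sum_comm]
    simp only [← Finset.smul_sum, d.Λ_f]
  have h2 : actVec Λ h s * a = ∑ t, h t • (Λ s t * a) := by
    simp [actVec, Finset.sum_mul]
  have h3 := congrArg ι h1
  have h4 := congrArg ι h2
  simp only [map_sum, map_mul, map_smul] at h3 h4
  simp only [eq_of_eq_shiftedGenerator hc hp, convRight_shiftEta, convLeft_shiftEta,
    smul_mul_assoc, mul_smul_comm, add_mul, sub_mul, mul_add, mul_sub, d.p_mul, map_add,
    map_sub, map_smul, map_mul, map_sum, Finset.mul_sum, Finset.sum_add_distrib,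
    Finset.sum_sub_distrib, ← Finset.smul_sum, ← smul_add, ← smul_sub, h3, h4]
  congr 1
  simp only [Algebra.algebraMap_eq_smul_one, smul_mul_assoc, mul_smul_comm, one_mul, mul_one]
  abel

include d in
lemma shift_eta_mul (s : I) (a b : A) : shiftEta c h f η s (a * b) =
    shiftEta c h f η s a * Coalgebra.counit (R := ℂ) b + ∑ t, f s t a * shiftEta c h f η t b := by
  simp only [shiftEta, LinearMap.smul_apply, LinearMap.sub_apply, LinearMap.add_apply,
    LinearMap.sum_apply, d.η_mul, d.f_mul, smul_eq_mul, Bialgebra.counit_mul, mul_add, mul_sub,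
    Finset.sum_add_distrib, Finset.sum_sub_distrib, Finset.mul_sum]
  have h1 : ∑ k, ∑ t, c⁻¹ * (h k * (f s t a * f t k b)) =
      ∑ t, ∑ k, f s t a * (c⁻¹ * (h k * f t k b)) := by
    rw [Finset.sum_comm]
    exact Finset.sum_congr rfl fun _ _ => Finset.sum_congr rfl fun _ _ => by ring
  have h2 : ∑ t, c⁻¹ * (f s t a * η t b) = ∑ t, f s t a * (c⁻¹ * η t b) :=
    Finset.sum_congr rfl fun _ _ => by ring
  have h3 : ∑ t, f s t a * (c⁻¹ * (h t * Coalgebra.counit (R := ℂ) b)) =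
      (∑ t, c⁻¹ * (h t * f s t a)) * Coalgebra.counit (R := ℂ) b := by
    rw [Finset.sum_mul]
    exact Finset.sum_congr rfl fun _ _ => by ring
  rw [h1, h2, h3]
  ring

include d in
lemma mulVec_shiftT : (Rmat Λ f).mulVec (shiftT c h (Rmat Λ f) (Zmat Λ η) T) =
    -shiftT c h (Rmat Λ f) (Zmat Λ η) T := by
  have h1 : Rmat Λ f * (1 - Rmat Λ f) = -(1 - Rmat Λ f) := by
    rw [Matrix.mul_sub, Matrix.mul_one, d.R_sq]
    abel
  rw [shiftT, Matrix.mulVec_add, Matrix.mulVec_smul, Matrix.mulVec_smul, Matrix.mulVec_mulVec, h1,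
    d.R_T, Matrix.neg_mulVec, smul_neg, smul_neg, neg_add]

/-- The combination `V_ij - Λ_im Λ_jn V_mn`. -/
noncomputable def bdry (Λ : Matrix I I A) (ι : A →ₐc[ℂ] B) (V : I × I → ℂ) : I × I → B :=
  fun ij => algebraMap ℂ B (V ij) - ∑ mn : I × I, V mn • ι (Λ ij.1 mn.1 * Λ ij.2 mn.2)

lemma bdry_add (V W : I × I → ℂ) : bdry Λ ι (V + W) = bdry Λ ι V + bdry Λ ι W := by
  funext ij
  simp only [bdry, Pi.add_apply, map_add, add_smul, Finset.sum_add_distrib]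
  abel

lemma bdry_smul (z : ℂ) (V : I × I → ℂ) : bdry Λ ι (z • V) = z • bdry Λ ι V := by
  funext ij
  simp only [bdry, Pi.smul_apply, smul_eq_mul, map_mul, mul_smul, ← Finset.smul_sum, smul_sub]
  rw [← Algebra.smul_def]

lemma bdry_sub (V W : I × I → ℂ) : bdry Λ ι (V - W) = bdry Λ ι V - bdry Λ ι W := by
  rw [eq_sub_iff_add_eq, ← bdry_add, sub_add_cancel]

include d in
lemma smulVec_bdry (hΛ : IsRep Λ) (V : I × I → ℂ) :
    smulVec (Rmat Λ f) (bdry Λ ι V) = bdry Λ ι ((Rmat Λ f).mulVec V) := by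
  have h1 : smulVec (Rmat Λ f) (fun ij => algebraMap ℂ B (V ij)) =
      fun ij => algebraMap ℂ B ((Rmat Λ f).mulVec V ij) := by
    funext ij
    simp only [smulVec, Matrix.mulVec, dotProduct, map_sum, map_mul, Algebra.smul_def]
  have h2 := d.smulVec_sum_mul hΛ ι.toAlgHom V
  refine (smulVec_sub (Rmat Λ f) (fun ij => algebraMap ℂ B (V ij)) _).trans ?_
  exact congrArg₂ (· - ·) h1 h2

lemma quadVec_eq_bdry (Z : Matrix (I × I) I ℂ) (T : I × I → ℂ) (p : I → B) (ij : I × I) :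
    quadVec Λ Z T ι.toAlgHom p ij = p ij.1 * p ij.2 - smulVec Z p ij + bdry Λ ι T ij :=
  add_sub_assoc _ _ _

-- Commuting `p_i` past `Λ_jl h_l` yields the matrix `R` from `f` and both terms in `Z` from `η`.
include d in
lemma p_mul_actVec (hΛ : IsRep Λ) (ij : I × I) :
    p ij.1 * ι (actVec Λ h ij.2) =
      smulVec (Rmat Λ f) (fun kt : I × I => ι (actVec Λ h kt.1) * p kt.2) ij +
      smulVec (Zmat Λ η) (fun k => ι (actVec Λ h k)) ij -
      ∑ mn : I × I, (Zmat Λ η).mulVec h mn • ι (Λ ij.1 mn.1 * Λ ij.2 mn.2) := by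
  obtain ⟨i, j⟩ := ij
  have h0 : ∀ l, p i * ι (Λ j l) = ∑ t, ∑ k, Rmat Λ f (i, j) (k, t) • (ι (Λ k l) * p t) +
      (∑ k, Zmat Λ η (i, j) k • ι (Λ k l) -
        ∑ t, ∑ k, Zmat Λ η (t, k) l • ι (Λ i t * Λ j k)) := by
    intro l
    rw [d.p_mul]
    simp only [hΛ.convRight, hΛ.convLeft, map_sum, Finset.mul_sum, Finset.sum_mul, map_smul,
      smul_mul_assoc, mul_smul_comm]
    rfl
  simp only [actVec, map_sum, map_smul, Finset.mul_sum, mul_smul_comm, h0, smul_add, smul_sub,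
    Finset.sum_add_distrib, Finset.sum_sub_distrib]
  rw [← add_sub_assoc]
  refine congrArg₂ (· - ·) (congrArg₂ (· + ·) ?_ ?_) ?_
  · simp only [smulVec, Fintype.sum_prod_type_right, Finset.smul_sum, Finset.sum_mul,
      smul_mul_assoc, smul_comm (h _)]
    rw [Finset.sum_comm]
    exact Finset.sum_congr rfl fun _ _ => Finset.sum_comm
  · simp only [smulVec, Finset.smul_sum, smul_comm (h _)]
    exact Finset.sum_comm
  · simp only [Fintype.sum_prod_type, Finset.smul_sum, Matrix.mulVec, dotProduct, Finset.sum_smul,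
      smul_smul]
    rw [Finset.sum_comm]
    refine Finset.sum_congr rfl fun _ _ => Finset.sum_comm.trans ?_
    exact Finset.sum_congr rfl fun _ _ => Finset.sum_congr rfl fun _ _ => by rw [mul_comm]

-- The substitution `c q = p - h + Λ h` in the quadratic expression gives the old expression, an
-- error of the form `(1 + R)(…)`, which `R - 1` annihilates because `R² = 1`, and a constant part.
-- The new constants `T'` are left free here, to be fitted later.
include d hc hp in
lemma shift_quadVec (hΛ : IsRep Λ) (T' : I × I → ℂ) :
    c ^ 2 • quadVec Λ (Zmat Λ (shiftEta c h f η)) T' ι.toAlgHom q =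
      quadVec Λ (Zmat Λ η) T ι.toAlgHom p +
      smulVec (1 + Rmat Λ f) (fun sk : I × I => ι (actVec Λ h sk.1) * p sk.2 -
        h sk.2 • (p sk.1 - algebraMap ℂ B (h sk.1) + ι (actVec Λ h sk.1))) +
      bdry Λ ι ((Zmat Λ η).mulVec h - (fun ij => h ij.1 * h ij.2) + (c ^ 2 • T' - T)) := by
  funext ij
  have hq : ∀ i, c • q i = p i - algebraMap ℂ B (h i) + ι (actVec Λ h i) := fun i => by
    rw [eq_of_eq_shiftedGenerator hc hp, smul_inv_smul₀ hc]
  have hZ : ∀ s, c * Zmat Λ (shiftEta c h f η) ij s = Zmat Λ η ij s +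
      ∑ k, Rmat Λ f ij (s, k) * h k - if ij.2 = s then h ij.1 else 0 := by
    intro s
    change c * (shiftEta c h f η ij.1 (Λ ij.2 s)) = _
    simp only [shiftEta, LinearMap.smul_apply, smul_eq_mul, mul_inv_cancel_left₀ hc,
      LinearMap.sub_apply, LinearMap.add_apply, LinearMap.sum_apply, (hΛ _ _).2,
      mul_comm (h _), ite_mul, one_mul, zero_mul]
    rfl
  have h1 : c ^ 2 • (q ij.1 * q ij.2) = (c • q ij.1) * (c • q ij.2) := by
    rw [smul_mul_smul_comm, sq]
  have h2 : c ^ 2 • smulVec (Zmat Λ (shiftEta c h f η)) q ij =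
      smulVec (Zmat Λ η) (fun s => c • q s) ij +
      smulVec (Rmat Λ f) (fun sk : I × I => h sk.2 • c • q sk.1) ij -
      h ij.1 • c • q ij.2 := by
    have h3 : ∀ s, c ^ 2 • Zmat Λ (shiftEta c h f η) ij s • q s =
        (c * Zmat Λ (shiftEta c h f η) ij s) • c • q s := fun s => by
      rw [smul_smul, smul_smul]
      congr 1
      ring
    simp only [smulVec, Finset.smul_sum, h3, hZ, sub_smul, add_smul, Finset.sum_sub_distrib,
      Finset.sum_add_distrib, Finset.sum_smul, ite_smul, zero_smul, Finset.sum_ite_eq,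
      Finset.mem_univ, if_true, Fintype.sum_prod_type, mul_smul]
  have h5 : ι (actVec Λ h ij.1) * ι (actVec Λ h ij.2) =
      ∑ mn : I × I, (h mn.1 * h mn.2) • ι (Λ ij.1 mn.1 * Λ ij.2 mn.2) := by
    simp only [actVec, map_sum, map_smul, Finset.sum_mul, Finset.mul_sum, smul_mul_smul_comm,
      Fintype.sum_prod_type, map_mul]
    exact Finset.sum_comm
  have h6 := d.p_mul_actVec (h := h) hΛ ij
  have h8 : smulVec (Zmat Λ η) (fun s => c • q s) ij = smulVec (Zmat Λ η) p ij -
      algebraMap ℂ B ((Zmat Λ η).mulVec h ij) +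
      smulVec (Zmat Λ η) (fun k => ι (actVec Λ h k)) ij := by
    have h9 : algebraMap ℂ B ((Zmat Λ η).mulVec h ij) =
        smulVec (Zmat Λ η) (fun k => algebraMap ℂ B (h k)) ij := by
      simp only [smulVec, Matrix.mulVec, dotProduct, map_sum, map_mul, Algebra.smul_def]
    simp only [hq]
    rw [h9, ← Pi.sub_apply, ← smulVec_sub, ← Pi.add_apply, ← smulVec_add]
    rfl
  have h10 : smulVec (1 + Rmat Λ f) (fun sk : I × I => ι (actVec Λ h sk.1) * p sk.2 -
        h sk.2 • c • q sk.1) ij = ι (actVec Λ h ij.1) * p ij.2 - h ij.2 • c • q ij.1 +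
      (smulVec (Rmat Λ f) (fun kt : I × I => ι (actVec Λ h kt.1) * p kt.2) ij -
        smulVec (Rmat Λ f) (fun sk : I × I => h sk.2 • c • q sk.1) ij) := by
    rw [add_smulVec, one_smulVec, ← Pi.sub_apply, ← smulVec_sub]
    rfl
  have h11 : bdry Λ ι ((Zmat Λ η).mulVec h - (fun ij => h ij.1 * h ij.2) + (c ^ 2 • T' - T)) ij =
      bdry Λ ι ((Zmat Λ η).mulVec h) ij - bdry Λ ι (fun ij => h ij.1 * h ij.2) ij +
        (c ^ 2 • bdry Λ ι T' ij - bdry Λ ι T ij) := by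
    rw [bdry_add, bdry_sub, bdry_sub, bdry_smul]
    rfl
  simp only [← hq]
  rw [Pi.smul_apply, Pi.add_apply, Pi.add_apply, h10, h11, quadVec_eq_bdry, quadVec_eq_bdry,
    smul_add, smul_sub, h1, h2, h8]
  simp only [hq]
  simp only [add_mul, sub_mul, mul_add, mul_sub, h5, h6, smul_add, smul_sub]
  simp only [bdry, Algebra.algebraMap_eq_smul_one, smul_mul_assoc, mul_smul_comm, one_mul, mul_one,
    smul_smul, mul_comm (h ij.2)]
  abel

include d hc hp in
lemma shift (hΛ : IsRep Λ) : InhomogeneousData Λ ι q f (shiftEta c h f η)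
    (shiftT c h (Rmat Λ f) (Zmat Λ η) T) where
  generated := by
    refine adjoin_eq_top_of_forall_mem d.generated fun i => ?_
    rw [hp, shiftedGenerator_eq]
    have h1 : q i ∈ Algebra.adjoin ℂ (Set.range ι ∪ Set.range q) :=
      Algebra.subset_adjoin (Or.inr ⟨i, rfl⟩)
    have h2 : ι (actVec Λ h i) ∈ Algebra.adjoin ℂ (Set.range ι ∪ Set.range q) :=
      Algebra.subset_adjoin (Or.inl ⟨_, rfl⟩)
    exact sub_mem (add_mem (Subalgebra.smul_mem _ h1 _) (Subalgebra.algebraMap_mem _ _)) h2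
  injective := d.injective
  comul_p := d.shift_comul hc hp hΛ
  counit_p i := by
    have h1 : Coalgebra.counit (R := ℂ) (actVec Λ h i) = h i := by
      simp [actVec, map_sum, (hΛ _ _).2]
    rw [eq_of_eq_shiftedGenerator hc hp, map_smul, map_add, map_sub, d.counit_p,
      counit_apply_hom, h1, Bialgebra.counit_algebraMap]
    simp
  exists_notMem := by
    obtain ⟨i, hi⟩ := d.exists_notMem
    refine ⟨i, fun hcon => hi ?_⟩
    rw [hp, shiftedGenerator_eq]
    have h1 : q i ∈ ι.toAlgHom.range := hcon
    have h2 : ι (actVec Λ h i) ∈ ι.toAlgHom.range := ⟨_, rfl⟩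
    exact sub_mem (add_mem (Subalgebra.smul_mem _ h1 _) (Subalgebra.algebraMap_mem _ _)) h2
  f_one := d.f_one
  f_mul := d.f_mul
  η_one s := by
    have h1 : ∑ k, h k * f s k 1 = h s := by simp [d.f_one]
    simp only [shiftEta, LinearMap.smul_apply, LinearMap.sub_apply, LinearMap.add_apply,
      LinearMap.sum_apply, smul_eq_mul, d.η_one, h1, Bialgebra.counit_one]
    ring
  η_mul := d.shift_eta_mul
  Λ_f := d.Λ_f
  relations := by
    refine ⟨d.shift_mul hc hp, fun kl => ?_⟩
    set T' := shiftT c h (Rmat Λ f) (Zmat Λ η) T with hT'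
    have hR1 : (Rmat Λ f - 1) * (1 + Rmat Λ f) = 0 := by
      rw [Matrix.sub_mul, Matrix.mul_add, Matrix.mul_one, d.R_sq, Matrix.one_mul]
      abel
    -- With `V = Z h - h ⊗ h`, the correction in `shiftT` is `-(1 - R)V/2`. Adding `V` leaves `(1 +
    -- R)V/2`, again killed by `R - 1`, while `T'` stays in the `-1` eigenspace of `R`.
    have hV : (Zmat Λ η).mulVec h - (fun ij => h ij.1 * h ij.2) + (c ^ 2 • T' - T) =
        (2 : ℂ)⁻¹ • (1 + Rmat Λ f).mulVec
          ((Zmat Λ η).mulVec h - (fun ij => h ij.1 * h ij.2)) := by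
      rw [hT', shiftT, smul_add, smul_inv_smul₀ (pow_ne_zero 2 hc), add_sub_cancel_left, smul_smul,
        mul_inv, mul_left_comm, mul_inv_cancel₀ (pow_ne_zero 2 hc), mul_one]
      set V := (Zmat Λ η).mulVec h - (fun ij => h ij.1 * h ij.2) with hV
      have h1 : -(Zmat Λ η).mulVec h + (fun ij => h ij.1 * h ij.2) = -V := by
        rw [hV]
        abel
      rw [h1, Matrix.mulVec_neg, Matrix.sub_mulVec, Matrix.add_mulVec, Matrix.one_mulVec]
      module
    have h1 : smulVec (Rmat Λ f - 1)
        (c ^ 2 • quadVec Λ (Zmat Λ (shiftEta c h f η)) T' ι.toAlgHom q) = 0 := by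
      rw [d.shift_quadVec hc hp hΛ, hV, bdry_smul, smulVec_add, smulVec_add,
        d.relations.smulVec_quadVec, smulVec_smulVec, hR1, smulVec_smul, Matrix.add_mulVec,
        Matrix.one_mulVec, bdry_add, ← d.smulVec_bdry hΛ]
      set W := bdry Λ ι ((Zmat Λ η).mulVec h - fun ij => h ij.1 * h ij.2)
      have h2 : W + smulVec (Rmat Λ f) W = smulVec (1 + Rmat Λ f) W := by
        rw [add_smulVec, one_smulVec]
      rw [h2, smulVec_smulVec, hR1, zero_smulVec, zero_smulVec]
      simp
    rw [smulVec_smul, smul_eq_zero_iff_right (pow_ne_zero 2 hc)] at h1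
    exact congrFun h1 kl
  R_sq := d.R_sq
  R_T := d.mulVec_shiftT

end InhomogeneousData

end Shift

/-! ### Transport along isomorphisms and the combined change of data. -/

section Transport

variable {I : Type*} [Fintype I] [DecidableEq I]
variable {A : Type*} [Ring A] [HopfAlgebra ℂ A] {B : Type*} [Ring B] [HopfAlgebra ℂ B]
variable {A' : Type*} [Ring A'] [HopfAlgebra ℂ A'] {B' : Type*} [Ring B'] [HopfAlgebra ℂ B']
variable {Λ : Matrix I I A} {ι : A →ₐc[ℂ] B} {p : I → B}
variable {f : Matrix I I (Module.Dual ℂ A)} {η : I → Module.Dual ℂ A} {T : I × I → ℂ}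

/-- Transport of a functional along an isomorphism. -/
noncomputable def transportDual (φA : A ≃ₐc[ℂ] A') : Module.Dual ℂ A →ₗ[ℂ] Module.Dual ℂ A' where
  toFun ρ := ρ ∘ₗ ((φA.symm : A' ≃ₐ[ℂ] A).toLinearMap)
  map_add' _ _ := rfl
  map_smul' _ _ := rfl

@[simp] lemma transportDual_apply (φA : A ≃ₐc[ℂ] A') (ρ : Module.Dual ℂ A) (a : A') :
    transportDual φA ρ a = ρ (φA.symm a) := rfl

lemma transportDual_apply_apply (φA : A ≃ₐc[ℂ] A') (ρ : Module.Dual ℂ A) (a : A) :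
    transportDual φA ρ (φA a) = ρ a := by
  rw [transportDual_apply, φA.symm_apply_apply]

lemma convRight_transportDual (φA : A ≃ₐc[ℂ] A') (ρ : Module.Dual ℂ A) (a : A) :
    convRight (φA a) (transportDual φA ρ) = φA (convRight a ρ) := by
  let r := Coalgebra.Repr.arbitrary ℂ a
  rw [convRight_repr r, convRight]
  have h1 : Coalgebra.comul (R := ℂ) (φA a) =
      ∑ k ∈ r.index, φA (r.left k) ⊗ₜ[ℂ] φA (r.right k) :=
    comul_apply_hom_repr (φA : A →ₐc[ℂ] A') r
  rw [h1]
  simp [map_sum]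

lemma convLeft_transportDual (φA : A ≃ₐc[ℂ] A') (ρ : Module.Dual ℂ A) (a : A) :
    convLeft (transportDual φA ρ) (φA a) = φA (convLeft ρ a) := by
  let r := Coalgebra.Repr.arbitrary ℂ a
  rw [convLeft_repr r, convLeft]
  have h1 : Coalgebra.comul (R := ℂ) (φA a) =
      ∑ k ∈ r.index, φA (r.left k) ⊗ₜ[ℂ] φA (r.right k) :=
    comul_apply_hom_repr (φA : A →ₐc[ℂ] A') r
  rw [h1]
  simp [map_sum]

lemma InhomogeneousData.transport (d : InhomogeneousData Λ ι p f η T) (φ : B ≃ₐc[ℂ] B')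
    (φA : A ≃ₐc[ℂ] A') (ι' : A' →ₐc[ℂ] B') (hι : ∀ a, φ (ι a) = ι' (φA a)) :
    InhomogeneousData (fun i j => φA (Λ i j)) ι' (fun i => φ (p i))
      (fun i j => transportDual φA (f i j)) (fun i => transportDual φA (η i)) T := by
  have hs : ∀ a', ∃ a, a' = φA a := fun a' => ⟨φA.symm a', (φA.apply_symm_apply a').symm⟩
  have hR : Rmat (A := A') (fun i j => φA (Λ i j)) (fun i j => transportDual φA (f i j)) =
      Rmat Λ f := by
    ext ij sm
    exact transportDual_apply_apply φA _ _
  have hZ : Zmat (A := A') (fun i j => φA (Λ i j)) (fun i => transportDual φA (η i)) =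
      Zmat Λ η := by
    ext ij sm
    exact transportDual_apply_apply φA _ _
  have hc : ∀ a, Coalgebra.counit (R := ℂ) (φA a) = Coalgebra.counit (R := ℂ) a := fun a =>
    counit_apply_hom (φA : A →ₐc[ℂ] A') a
  refine ⟨?_, ?_, ?_, ?_, ?_, ?_, ?_, ?_, ?_, ?_, ⟨?_, ?_⟩, ?_, ?_⟩
  · rw [eq_top_iff]
    suffices key : ∀ y, φ y ∈ Algebra.adjoin ℂ (Set.range ι' ∪ Set.range fun i => φ (p i)) by
      intro x _
      obtain ⟨y, rfl⟩ := φ.surjective x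
      exact key y
    intro y
    have h1 : y ∈ Algebra.adjoin ℂ (Set.range ι ∪ Set.range p) :=
      d.generated ▸ Algebra.mem_top
    induction h1 using Algebra.adjoin_induction with
    | mem x hx =>
      rcases hx with ⟨a, rfl⟩ | ⟨i, rfl⟩
      · exact Algebra.subset_adjoin (Or.inl ⟨φA a, (hι a).symm⟩)
      · exact Algebra.subset_adjoin (Or.inr ⟨i, rfl⟩)
    | algebraMap r =>
      rw [AlgHomClass.commutes φ]
      exact Subalgebra.algebraMap_mem _ _
    | add x y _ _ hx hy => rw [map_add]; exact add_mem hx hy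
    | mul x y _ _ hx hy => rw [map_mul]; exact mul_mem hx hy
  · intro a' b' hab
    obtain ⟨a, rfl⟩ := hs a'
    obtain ⟨b, rfl⟩ := hs b'
    rw [← hι, ← hι] at hab
    rw [d.injective (φ.injective hab)]
  · intro i
    refine (comul_apply_hom (φ : B →ₐc[ℂ] B') (p i)).trans ?_
    rw [d.comul_p, map_add, map_sum]
    refine congrArg₂ (· + ·) (Finset.sum_congr rfl fun j _ => ?_) ?_
    · exact congrArg (· ⊗ₜ[ℂ] φ (p j)) (hι (Λ i j))
    · exact congrArg (φ (p i) ⊗ₜ[ℂ] ·) (map_one φ)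
  · exact fun i => (counit_apply_hom (φ : B →ₐc[ℂ] B') (p i)).trans (d.counit_p i)
  · obtain ⟨i, hi⟩ := d.exists_notMem
    refine ⟨i, ?_⟩
    rintro ⟨a', ha⟩
    obtain ⟨a, rfl⟩ := hs a'
    rw [← hι] at ha
    exact hi ⟨a, φ.injective ha⟩
  · intro s t
    rw [transportDual_apply, map_one, d.f_one]
  · intro s t a b
    simp only [transportDual_apply, map_mul, d.f_mul]
  · intro s
    rw [transportDual_apply, map_one, d.η_one]
  · intro s a' b'
    obtain ⟨a, rfl⟩ := hs a'
    obtain ⟨b, rfl⟩ := hs b'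
    simp only [← map_mul, transportDual_apply_apply, d.η_mul, hc]
  · intro s r a'
    obtain ⟨a, rfl⟩ := hs a'
    simp only [convRight_transportDual, convLeft_transportDual, ← map_mul, ← map_sum, d.Λ_f]
  · intro s a'
    obtain ⟨a, rfl⟩ := hs a'
    have h1 := congrArg φ (d.p_mul s a)
    simp only [map_mul, map_add, map_sub, map_sum, hι] at h1
    refine h1.trans ?_
    simp only [convRight_transportDual, convLeft_transportDual]
    simp
  · intro kl
    have h1 := congrArg φ (congrFun d.relations.smulVec_quadVec kl)
    have h2 : ∀ ij, quadVec (A := A') (fun i j => φA (Λ i j)) (Zmat Λ η) T ι'.toAlgHom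
        (fun i => φ (p i)) ij = φ (quadVec Λ (Zmat Λ η) T ι.toAlgHom p ij) := by
      intro ij
      simp only [quadVec, map_add, map_sub, map_mul, map_sum, map_smul, AlgHomClass.commutes φ]
      simp [hι]
    rw [hR]
    have h4 : smulVec (Rmat Λ f - 1) (quadVec (A := A') (fun i j => φA (Λ i j)) (Zmat Λ η) T
        ι'.toAlgHom (fun i => φ (p i))) kl = 0 := by
      simp only [smulVec, h2, ← map_smul, ← map_sum]
      exact h1.trans (map_zero φ)
    rw [← hZ] at h4
    exact h4
  · rw [hR, d.R_sq]
  · rw [hR, d.R_T]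

lemma conjBy_eq_mul {D : Type*} [Ring D] [Algebra ℂ D] (N M : Matrix I I ℂ) (X : Matrix I I D)
    (i j : I) : conjBy N M X i j =
      (N.map (algebraMap ℂ D) * X * M.map (algebraMap ℂ D)) i j := by
  refine (conjBy_eq_sum (fun k l => X k l) i j).trans ?_
  simp only [Matrix.mul_apply, Matrix.map_apply, Finset.sum_mul]
  rw [Finset.sum_comm]
  refine Finset.sum_congr rfl fun l _ => Finset.sum_congr rfl fun k _ => ?_
  rw [Algebra.smul_def, map_mul, mul_assoc, mul_assoc, Algebra.commutes (M l j)]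

lemma Intertwines.conjBy_eq {φA : A ≃ₐc[ℂ] A'} {M : Matrix I I ℂ} {Λ' : Matrix I I A'}
    (hI : Intertwines φA M Λ Λ') (hM : IsUnit M) (i j : I) :
    conjBy M⁻¹ M (fun i j => φA (Λ i j)) i j = Λ' i j := by
  have hNM : M⁻¹ * M = 1 := Matrix.nonsing_inv_mul _ ((Matrix.isUnit_iff_isUnit_det _).1 hM)
  have h1 : M⁻¹.map (algebraMap ℂ A') * M.map (algebraMap ℂ A') = 1 := by
    rw [← Matrix.map_mul, hNM, Matrix.map_one _ (map_zero _) (map_one _)]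
  refine (conjBy_eq_mul M⁻¹ M (Λ.map φA) i j).trans ?_
  rw [hI, Matrix.mul_assoc, Matrix.mul_assoc, h1, Matrix.mul_one, ← Matrix.mul_assoc, h1,
    Matrix.one_mul]

lemma hatF_eq_conjBy (φA : A ≃ₐc[ℂ] A') (M : Matrix I I ℂ) (i j : I) :
    hatF φA M f i j = conjBy M⁻¹ M (fun i j => transportDual φA (f i j)) i j := by
  rw [conjBy_eq_sum]
  ext a
  simp [hatF]

/-- A shift by `M h` in the old basis is a shift by `h` in the new one, since `M⁻¹ f M h = (M⁻¹ f M)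
h` and `M⁻¹ M h = h`. -/
lemma hatEta_eq_shiftEta {φA : A ≃ₐc[ℂ] A'} {M : Matrix I I ℂ} (hNM : M⁻¹ * M = 1) (c : ℂ)
    (h : I → ℂ) (i : I) : hatEta φA M c h f η i =
      shiftEta c h (hatF φA M f) (smulVec M⁻¹ fun i => transportDual φA (η i)) i := by
  ext a
  obtain ⟨b, rfl⟩ : ∃ b, φA b = a := φA.surjective a
  have hc : Coalgebra.counit (R := ℂ) (φA b) = Coalgebra.counit (R := ℂ) b :=
    counit_apply_hom (φA : A →ₐc[ℂ] A') b
  have h1 : ∑ j, M⁻¹ i j * M.mulVec h j = h i := by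
    have := congrFun (congrArg (fun X : Matrix I I ℂ => X.mulVec h) hNM) i
    rwa [← Matrix.mulVec_mulVec, Matrix.one_mulVec] at this
  have h2 : ∑ j, M⁻¹ i j * ∑ k, M.mulVec h k * f j k b =
      ∑ k, h k * ∑ l, ∑ j, M⁻¹ i l * M j k * f l j b := by
    simp only [Matrix.mulVec, dotProduct, Finset.mul_sum, Finset.sum_mul]
    have e1 : ∀ l, ∑ j, ∑ k, M⁻¹ i l * (M j k * h k * f l j b) =
        ∑ k, ∑ j, h k * (M⁻¹ i l * M j k * f l j b) := fun l => by
      rw [Finset.sum_comm]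
      exact Finset.sum_congr rfl fun _ _ => Finset.sum_congr rfl fun _ _ => by ring
    rw [Finset.sum_congr rfl fun l _ => e1 l]
    exact Finset.sum_comm
  have h3 : ∀ x, φA.symm (φA x) = x := φA.symm_apply_apply
  simp only [hatEta, hatF, shiftEta, smulVec, Matrix.of_apply, LinearMap.comp_apply,
    LinearMap.smul_apply, LinearMap.add_apply, LinearMap.sub_apply, LinearMap.sum_apply,
    transportDual_apply, AlgEquiv.toLinearMap_apply, smul_eq_mul, mul_add, mul_sub,
    Finset.sum_add_distrib, Finset.sum_sub_distrib]
  have h4 : (φA.symm : A' ≃ₐ[ℂ] A) (φA b) = b := h3 b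
  have h5 : ∑ x, M⁻¹ i x * (M.mulVec h x * Coalgebra.counit (R := ℂ) b) =
      h i * Coalgebra.counit (R := ℂ) b := by
    rw [← h1, Finset.sum_mul]
    exact Finset.sum_congr rfl fun _ _ => (mul_assoc _ _ _).symm
  rw [h4, h3, h2, hc, h5]

/-- The data for the generators `p'` with `φ(p) = M (c p' + h - Λ' h)`. -/
theorem InhomogeneousData.changeOfData (d : InhomogeneousData Λ ι p f η T) (φ : B ≃ₐc[ℂ] B')
    (φA : A ≃ₐc[ℂ] A') {ι' : A' →ₐc[ℂ] B'} (hι : ∀ a, φ (ι a) = ι' (φA a)) {Λ' : Matrix I I A'}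
    (hΛ' : IsRep Λ') {M : Matrix I I ℂ} (hM : IsUnit M) (hI : Intertwines φA M Λ Λ') {c : ℂ}
    (hc : c ≠ 0) {h : I → ℂ} {p' : I → B'}
    (hp : ∀ i, smulVec M⁻¹ (fun i => φ (p i)) i = shiftedGenerator Λ' ι' p' c h i) :
    InhomogeneousData Λ' ι' p' (hatF φA M f) (hatEta φA M c h f η)
      (hatT M c h (Rmat Λ f) (Zmat Λ η) T) ∧ Rmat Λ' (hatF φA M f) = hatR M (Rmat Λ f) := by
  have hNM : M⁻¹ * M = 1 := Matrix.nonsing_inv_mul _ ((Matrix.isUnit_iff_isUnit_det _).1 hM)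
  have hMN : M * M⁻¹ = 1 := Matrix.mul_nonsing_inv _ ((Matrix.isUnit_iff_isUnit_det _).1 hM)
  -- The passage to the new data factors as transport along `φ`, the change of basis by `M⁻¹`, and
  -- the shift by `(c, h)`.
  have d2 := (d.transport φ φA ι' hι).changeOfBasis hMN
  have hΛe : conjBy M⁻¹ M (fun i j => φA (Λ i j)) = Λ' := by
    funext i j
    exact hI.conjBy_eq hM i j
  have hfe : conjBy M⁻¹ M (fun i j => transportDual φA (f i j)) = hatF φA M f := by
    funext i j
    exact (hatF_eq_conjBy φA M i j).symm
  have hR0 : Rmat (A := A') (fun i j => φA (Λ i j)) (fun i j => transportDual φA (f i j)) =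
      Rmat Λ f := by
    ext ij sm
    exact transportDual_apply_apply φA _ _
  have hZ0 : Zmat (A := A') (fun i j => φA (Λ i j)) (fun i => transportDual φA (η i)) =
      Zmat Λ η := by
    ext ij sm
    exact transportDual_apply_apply φA _ _
  have hR : Rmat Λ' (hatF φA M f) = hatR M (Rmat Λ f) := by
    have h1 := Rmat_conjBy (A := A') M⁻¹ M (fun i j => φA (Λ i j))
      (fun i j => transportDual φA (f i j))
    rw [hR0] at h1
    refine Eq.trans ?_ h1
    exact congrArg₂ Rmat hΛe.symm hfe.symm
  have hZ : Zmat Λ' (smulVec M⁻¹ fun i => transportDual φA (η i)) =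
      (M⁻¹ ⊗ₖ M⁻¹) * Zmat Λ η * M := by
    have h1 := Zmat_conjBy (A := A') M⁻¹ M (fun i j => φA (Λ i j))
      (fun i => transportDual φA (η i))
    rw [hZ0] at h1
    refine Eq.trans ?_ h1
    exact congrArg (Zmat · _) hΛe.symm
  have d2' : InhomogeneousData Λ' ι' (smulVec M⁻¹ fun i => φ (p i)) (hatF φA M f)
      (smulVec M⁻¹ fun i => transportDual φA (η i)) ((M⁻¹ ⊗ₖ M⁻¹).mulVec T) := by
    rw [hΛe, hfe] at d2
    exact d2
  have d3 := d2'.shift hc hp hΛ'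
  refine ⟨?_, hR⟩
  convert d3 using 1
  · funext i
    exact hatEta_eq_shiftEta hNM c h i
  · rw [hR, hZ, shiftT, hatT, ← Matrix.mulVec_mulVec, ← Matrix.mulVec_mulVec]

end Transport

/-! ### Adjoints of the generators. -/

section StarGenerators

variable {I : Type*} [Fintype I] [DecidableEq I]
variable {A : Type*} [Ring A] [HopfAlgebra ℂ A] {B : Type*} [Ring B] [HopfAlgebra ℂ B]
variable {Λ : Matrix I I A} {ι : A →ₐc[ℂ] B} {p : I → B}
variable {f : Matrix I I (Module.Dual ℂ A)} {η : I → Module.Dual ℂ A} {T : I × I → ℂ}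
variable {sA : HopfStar A} {sB : HopfStar B}

lemma ExtendsStar.comul_star_generator (hext : ExtendsStar ι sA sB)
    (hp : ∀ i, Coalgebra.comul (R := ℂ) (p i) =
      ∑ j, ι (Λ i j) ⊗ₜ[ℂ] p j + p i ⊗ₜ[ℂ] (1 : B)) (i : I) :
    Coalgebra.comul (R := ℂ) (sB.star (p i)) =
      ∑ j, ι (sA.star (Λ i j)) ⊗ₜ[ℂ] sB.star (p j) + sB.star (p i) ⊗ₜ[ℂ] (1 : B) := by
  rw [sB.comul_star, hp, map_add, map_sum, TensorProduct.map_tmul, sB.star_one]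
  congr 1
  exact Finset.sum_congr rfl fun j _ => by rw [TensorProduct.map_tmul, hext]

lemma ExtendsStar.star_shiftedGenerator (hext : ExtendsStar ι sA sB)
    (hΛ : ∀ i j, sA.star (Λ i j) = Λ i j) (m : ℂ) (n : I → ℂ) (i : I) :
    sB.star (shiftedGenerator Λ ι p m n i) =
      shiftedGenerator Λ ι (fun i => sB.star (p i)) (conj m) (fun i => conj (n i)) i := by
  simp [shiftedGenerator, map_sum, sB.star_smul, hext _, hΛ]

lemma InhomogeneousData.exists_selfAdjoint_shift (d : InhomogeneousData Λ ι p f η T)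
    (hA : IsHomogeneousPart Λ) (hΛ : ∀ i j, sA.star (Λ i j) = Λ i j)
    (hext : ExtendsStar ι sA sB) : ∃ (m : ℂ) (n : I → ℂ), m ≠ 0 ∧
      ∀ i, sB.star (shiftedGenerator Λ ι p m n i) = shiftedGenerator Λ ι p m n i := by
  have hx : ∀ i, Coalgebra.comul (R := ℂ) (sB.star (p i)) =
      ∑ j, ι (Λ i j) ⊗ₜ[ℂ] sB.star (p j) + sB.star (p i) ⊗ₜ[ℂ] (1 : B) := fun i => by
    rw [hext.comul_star_generator d.comul_p]
    simp only [hΛ]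
  obtain ⟨m, n, hmn⟩ := d.relations.exists_eq_shiftedGenerator (d.isPrimitiveExtension hA) hA
    d.generated hx
  -- The symmetric choice `p + p^*` has coefficient `1 + m` at `p`. When it degenerates, `i (p -
  -- p^*)` has coefficient `2i` instead.
  by_cases hm : m = -1
  · refine ⟨2 * Complex.I, fun i => -Complex.I * n i, by simp, fun i => ?_⟩
    have h1 : shiftedGenerator Λ ι p (2 * Complex.I) (fun i => -Complex.I * n i) i =
        Complex.I • (p i - sB.star (p i)) := by
      rw [hmn, hm]
      simp only [shiftedGenerator, mul_smul, map_mul, map_neg, ← Finset.smul_sum, smul_sub,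
        ← Algebra.smul_def, neg_mul, neg_smul, Finset.sum_neg_distrib]
      module
    rw [h1, sB.star_smul, map_sub, sB.star_star, Complex.conj_I, neg_smul, ← smul_neg, neg_sub]
  · refine ⟨1 + m, n, fun h0 => hm (eq_neg_of_add_eq_zero_right h0), fun i => ?_⟩
    have h1 : shiftedGenerator Λ ι p (1 + m) n i = p i + sB.star (p i) := by
      rw [hmn]
      simp only [shiftedGenerator, add_smul, one_smul]
      abel
    rw [h1, map_add, sB.star_star, add_comm]

lemma eq_shiftedGenerator_inv {q : I → B} {m : ℂ} (hm : m ≠ 0) {n : I → ℂ}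
    (hq : ∀ i, q i = shiftedGenerator Λ ι p m n i) (i : I) :
    p i = shiftedGenerator Λ ι q m⁻¹ (fun i => -(m⁻¹ * n i)) i := by
  simp only [shiftedGenerator, hq, map_mul, map_neg, mul_smul, neg_smul, ← Finset.smul_sum,
    ← Algebra.smul_def, Finset.sum_neg_distrib, smul_add, smul_sub, inv_smul_smul₀ hm]
  abel

/-- The matrix `Λ` is real if the generators are self-adjoint. -/
lemma InhomogeneousData.star_matrix (d : InhomogeneousData Λ ι p f η T)
    (hA : IsHomogeneousPart Λ) (hext : ExtendsStar ι sA sB) (hp : ∀ i, sB.star (p i) = p i)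
    (i j : I) : sA.star (Λ i j) = Λ i j := by
  obtain ⟨g, hg⟩ := (d.isPrimitiveExtension hA).exists_isDualFamily
  have h1 : ∀ i k, g k (p i) = if i = k then 1 else 0 := fun i k => by
    have := hg.apply_mul_gen k i 1
    simpa using this
  have h2 := hext.comul_star_generator d.comul_p i
  simp only [hp] at h2
  rw [d.comul_p] at h2
  -- The dual functional `g j` reads off the coefficient of `p_j` in two expressions for the
  -- coproduct of the self-adjoint `p_i`.
  have h3 := congrArg (fun t => TensorProduct.rid ℂ B ((g j).lTensor B t)) (add_right_cancel h2)
  simp only [map_sum, LinearMap.lTensor_tmul, TensorProduct.rid_tmul, h1, ite_smul, one_smul,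
    zero_smul, Finset.sum_ite_eq', Finset.mem_univ, if_true] at h3
  exact (d.injective h3).symm

end StarGenerators

/-! ### Isomorphisms preserve the homogeneous part and the first filtration level. -/

section Isomorphisms

variable {I J : Type*} [Fintype I] [DecidableEq I] [Fintype J] [DecidableEq J]
variable {A : Type*} [Ring A] [HopfAlgebra ℂ A] {B : Type*} [Ring B] [HopfAlgebra ℂ B]
variable {A' : Type*} [Ring A'] [HopfAlgebra ℂ A'] {B' : Type*} [Ring B'] [HopfAlgebra ℂ B']
variable {Λ : Matrix I I A} {ι : A →ₐc[ℂ] B} {p : I → B}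
variable {f : Matrix I I (Module.Dual ℂ A)} {η : I → Module.Dual ℂ A} {T : I × I → ℂ}
variable {Λ' : Matrix J J A'} {ι' : A' →ₐc[ℂ] B'} {p' : J → B'}
variable {f' : Matrix J J (Module.Dual ℂ A')} {η' : J → Module.Dual ℂ A'} {T' : J × J → ℂ}

lemma convLeft_hom_apply (φ : B →ₐc[ℂ] B') (ρ : Module.Dual ℂ B') (b : B) :
    convLeft ρ (φ b) = φ (convLeft (ρ ∘ₗ φ.toAlgHom.toLinearMap) b) := by
  let r := Coalgebra.Repr.arbitrary ℂ b
  rw [convLeft_repr r, convLeft, comul_apply_hom_repr φ r]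
  simp [map_sum]

/-- In `Δ(a p_i)` the terms whose right leg contains a generator have left leg in `A`; all other
terms have right leg in `A` and are killed by `ρ`. -/
lemma InhomogeneousData.convLeft_mem_range (d : InhomogeneousData Λ ι p f η T)
    {ρ : Module.Dual ℂ B} (hρ : ∀ a, ρ (ι a) = 0) {b : B} (hb : b ∈ firstFiltration ι p) :
    convLeft ρ b ∈ Set.range ι := by
  rw [← filt_two_eq_firstFiltration] at hb
  obtain ⟨a, c, rfl⟩ := exists_of_mem_filt_two hb
  have hι : ∀ a, convLeft ρ (ι a) = 0 := fun a => by
    rw [convLeft, comul_apply_hom_repr ι (Coalgebra.Repr.arbitrary ℂ a)]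
    simp [map_sum, hρ]
  change convLeftL ρ _ ∈ ι.toAlgHom.range
  rw [map_add, map_sum]
  refine add_mem (sum_mem fun i _ => ?_) ?_
  · let r := Coalgebra.Repr.arbitrary ℂ (a i)
    have h1 : convLeft ρ (ι (a i) * p i) =
        ∑ k ∈ r.index, ∑ j, ρ (ι (r.right k) * p j) • ι (r.left k * Λ i j) := by
      rw [convLeft, Bialgebra.comul_mul, comul_apply_hom_repr ι r, d.comul_p]
      simp [map_sum, Finset.sum_mul, Finset.mul_sum, mul_add, hρ]
      exact Finset.sum_comm
    have h2 : ∀ a, ι a ∈ ι.toAlgHom.range := fun a => ⟨a, rfl⟩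
    rw [convLeftL_apply, h1]
    exact sum_mem fun k _ => sum_mem fun j _ => Subalgebra.smul_mem _ (h2 _) _
  · rw [convLeftL_apply, hι]
    exact zero_mem _

/-- Contractions of `φ b` are images of contractions of `b` with functionals vanishing on `A`, hence
lie in `A'`; `mem_filt_two` then bounds the degree of `φ b`. -/
lemma InhomogeneousData.apply_mem_firstFiltration (d : InhomogeneousData Λ ι p f η T)
    (d' : InhomogeneousData Λ' ι' p' f' η' T') (hA' : IsHomogeneousPart Λ') (φ : B →ₐc[ℂ] B')
    (hφ : ∀ a, φ (ι a) ∈ Set.range ι') {b : B} (hb : b ∈ firstFiltration ι p) :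
    φ b ∈ firstFiltration ι' p' := by
  have hp' := d'.isPrimitiveExtension hA'
  obtain ⟨g, hg⟩ := hp'.exists_isDualFamily
  rw [← filt_two_eq_firstFiltration]
  refine d'.relations.mem_filt_two hp' hg (d'.generated ▸ Algebra.mem_top) fun k => ?_
  rw [convLeft_hom_apply]
  obtain ⟨a, ha⟩ := d.convLeft_mem_range (ρ := g k ∘ₗ φ.toAlgHom.toLinearMap) (fun a => by
    obtain ⟨a', ha'⟩ := hφ a
    change g k (φ (ι a)) = 0
    rw [← ha', hg.apply_hom]) hb
  rw [← ha]
  exact hφ a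

lemma InhomogeneousData.exists_apply_eq (d : InhomogeneousData Λ ι p f η T)
    (d' : InhomogeneousData Λ' ι' p' f' η' T') (hA : IsHomogeneousPart Λ)
    (hA' : IsHomogeneousPart Λ') (φ : B ≃ₐc[ℂ] B') (a : A) : φ (ι a) ∈ Set.range ι' :=
  d'.relations.apply_mem_range (d'.isPrimitiveExtension hA') d'.generated hA.completelyReducible
    (φ := (φ : B →ₐc[ℂ] B').comp ι) (φ.injective.comp d.injective) a

lemma exists_bialgHom_of_mem_range (hι' : Function.Injective ι') (ψ : A →ₐc[ℂ] B')
    (hψ : ∀ a, ψ a ∈ Set.range ι') : ∃ g : A →ₐc[ℂ] A', ∀ a, ι' (g a) = ψ a := by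
  choose g hg using hψ
  let G : A →ₐ[ℂ] A' :=
    { toFun := g
      map_one' := hι' (by rw [hg, map_one, map_one])
      map_mul' := fun a b => hι' (by rw [hg, map_mul, map_mul, hg, hg])
      map_zero' := hι' (by rw [hg, map_zero, map_zero])
      map_add' := fun a b => hι' (by rw [hg, map_add, map_add, hg, hg])
      commutes' := fun r => hι' (by rw [hg, AlgHomClass.commutes ψ, AlgHomClass.commutes ι']) }
  have hG : ∀ a, ι' (G a) = ψ a := hg
  refine ⟨BialgHom.ofAlgHom G ?_ ?_, hg⟩
  · refine AlgHom.ext fun a => ?_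
    change Coalgebra.counit (R := ℂ) (G a) = Coalgebra.counit (R := ℂ) a
    rw [← counit_apply_hom ι', hG, counit_apply_hom]
  · refine AlgHom.ext fun a => map_hom_injective hι' ?_
    change _ = TensorProduct.map ι'.toAlgHom.toLinearMap ι'.toAlgHom.toLinearMap
      (Coalgebra.comul (R := ℂ) (G a))
    let r := Coalgebra.Repr.arbitrary ℂ a
    have h1 := comul_apply_hom ι' (G a)
    refine Eq.trans ?_ h1
    rw [hG, comul_apply_hom_repr ψ r]
    change TensorProduct.map ι'.toAlgHom.toLinearMap ι'.toAlgHom.toLinearMap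
      (Algebra.TensorProduct.map G G (Coalgebra.comul (R := ℂ) a)) = _
    rw [← r.eq, map_sum, map_sum]
    refine Finset.sum_congr rfl fun k _ => ?_
    exact congrArg₂ (· ⊗ₜ[ℂ] ·) (hG _) (hG _)

/-- An isomorphism of inhomogeneous quantum groups restricts to the homogeneous parts. -/
lemma InhomogeneousData.exists_bialgEquiv (d : InhomogeneousData Λ ι p f η T)
    (d' : InhomogeneousData Λ' ι' p' f' η' T') (hA : IsHomogeneousPart Λ)
    (hA' : IsHomogeneousPart Λ') (φ : B ≃ₐc[ℂ] B') :
    ∃ φA : A ≃ₐc[ℂ] A', ∀ a, φ (ι a) = ι' (φA a) := by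
  obtain ⟨g, hg⟩ := exists_bialgHom_of_mem_range d'.injective ((φ : B →ₐc[ℂ] B').comp ι)
    (d.exists_apply_eq d' hA hA' φ)
  have hg' : ∀ a, ι' (g a) = φ (ι a) := hg
  refine ⟨BialgEquiv.ofBijective g ⟨fun a b hab => ?_, fun a' => ?_⟩, fun a => (hg a).symm⟩
  · apply d.injective
    apply φ.injective
    change φ (ι a) = φ (ι b)
    rw [← hg', ← hg', hab]
  · obtain ⟨a, ha⟩ := d'.exists_apply_eq d hA' hA φ.symm a'
    refine ⟨a, d'.injective ?_⟩
    rw [hg', ha]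
    exact φ.apply_symm_apply _

lemma map_conj_inv {M : Matrix I I ℂ} (hM : IsUnit M) (hMr : M.map conj = M) :
    M⁻¹.map conj = M⁻¹ := by
  have hMN : M * M⁻¹ = 1 := Matrix.mul_nonsing_inv _ ((Matrix.isUnit_iff_isUnit_det _).1 hM)
  have h1 : M * M⁻¹.map conj = 1 := by
    have h2 := congrArg (fun X : Matrix I I ℂ => X.map (starRingEnd ℂ)) hMN
    change (M * M⁻¹).map (starRingEnd ℂ) = (1 : Matrix I I ℂ).map (starRingEnd ℂ) at h2
    rw [Matrix.map_mul, hMr, Matrix.map_one _ (map_zero _) (map_one _)] at h2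
    exact h2
  exact (Matrix.inv_eq_right_inv h1).symm

lemma Intertwines.star_eq {Λ' : Matrix I I A'} {φA : A ≃ₐc[ℂ] A'} {M : Matrix I I ℂ}
    {sA : HopfStar A} {sA' : HopfStar A'} (hI : Intertwines φA M Λ Λ') (hM : IsUnit M)
    (hMr : M.map conj = M) (hs : IsStarIso sA sA' φA) (hΛ : ∀ i j, sA.star (Λ i j) = Λ i j)
    (i j : I) : sA'.star (Λ' i j) = Λ' i j := by
  have hN : ∀ i j, conj (M⁻¹ i j) = M⁻¹ i j := fun i j =>
    congrFun (congrFun (map_conj_inv hM hMr) i) j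
  have hM' : ∀ i j, conj (M i j) = M i j := fun i j => congrFun (congrFun hMr i) j
  rw [← hI.conjBy_eq hM, conjBy_eq_sum]
  simp only [map_sum, sA'.star_smul, map_mul, hN, hM', ← hs _, hΛ]

end Isomorphisms


/-! ### Reality of the parameters of a change of generators. -/

section RealChange

variable {I : Type*} [Fintype I] [DecidableEq I]
variable {A : Type*} [Ring A] [HopfAlgebra ℂ A] {B : Type*} [Ring B] [HopfAlgebra ℂ B]
variable {A' : Type*} [Ring A'] [HopfAlgebra ℂ A'] {B' : Type*} [Ring B'] [HopfAlgebra ℂ B']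
variable {Λ : Matrix I I A} {ι : A →ₐc[ℂ] B} {p : I → B}
variable {f : Matrix I I (Module.Dual ℂ A)} {η : I → Module.Dual ℂ A} {T : I × I → ℂ}
variable {Λ' : Matrix I I A'} {ι' : A' →ₐc[ℂ] B'} {p' : I → B'}
variable {f' : Matrix I I (Module.Dual ℂ A')} {η' : I → Module.Dual ℂ A'} {T' : I × I → ℂ}

lemma star_smulVec_inv {M : Matrix I I ℂ} (hM : IsUnit M) (hMr : M.map conj = M)
    {sB : HopfStar B} {x : I → B} (hx : ∀ i, sB.star (x i) = x i) (i : I) :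
    sB.star (smulVec M⁻¹ x i) = smulVec M⁻¹ x i := by
  have hN : ∀ i j, conj (M⁻¹ i j) = M⁻¹ i j := fun i j =>
    congrFun (congrFun (map_conj_inv hM hMr) i) j
  simp only [smulVec, map_sum, sB.star_smul, hN, hx]

lemma eq_smulVec_iff {M : Matrix I I ℂ} (hM : IsUnit M) (x y : I → B) :
    (∀ i, x i = ∑ j, M i j • y j) ↔ ∀ i, smulVec M⁻¹ x i = y i := by
  have hNM : M⁻¹ * M = 1 := Matrix.nonsing_inv_mul _ ((Matrix.isUnit_iff_isUnit_det _).1 hM)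
  have hMN : M * M⁻¹ = 1 := Matrix.mul_nonsing_inv _ ((Matrix.isUnit_iff_isUnit_det _).1 hM)
  rw [← funext_iff, ← funext_iff]
  change x = smulVec M y ↔ _
  constructor
  · rintro rfl
    rw [smulVec_smulVec, hNM, one_smulVec]
  · rintro rfl
    rw [smulVec_smulVec, hMN, one_smulVec]

/-- Self-adjoint shifts of self-adjoint generators have real parameters. -/
lemma InhomogeneousData.exists_real_shift (d' : InhomogeneousData Λ' ι' p' f' η' T')
    (hA' : IsHomogeneousPart Λ') {sA' : HopfStar A'} {sB' : HopfStar B'}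
    (hext : ExtendsStar ι' sA' sB') (hp' : ∀ i, sB'.star (p' i) = p' i) {x : I → B'} {m : ℂ}
    {n : I → ℂ} (hx : ∀ i, x i = shiftedGenerator Λ' ι' p' m n i)
    (hxs : ∀ i, sB'.star (x i) = x i) : ∃ (c : ℝ) (h : I → ℝ), m = c ∧
      ∀ i, x i = shiftedGenerator Λ' ι' p' c (fun k => (h k : ℂ)) i := by
  have hP := d'.isPrimitiveExtension hA'
  have hΛ' := d'.star_matrix hA' hext hp'
  have h1 : ∀ i, (conj m - m) • p' i + algebraMap ℂ B' (conj (n i) - n i) -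
      ∑ j, (conj (n j) - n j) • ι' (Λ' i j) = 0 := by
    -- Subtracting `x_i` from its adjoint gives a linear relation among the `p'_j` over `A'`, so the
    -- imaginary part of `m` vanishes and that of `n` is a `Λ'`-fixed vector.
    intro i
    have h2 := hxs i
    rw [hx, hext.star_shiftedGenerator hΛ'] at h2
    simp only [hp'] at h2
    rw [← sub_eq_zero] at h2
    rw [← h2]
    simp only [shiftedGenerator, sub_smul, map_sub, Finset.sum_sub_distrib]
    abel
  have h3 : ∀ i, (conj m - m) = 0 ∧
      algebraMap ℂ A' (conj (n i) - n i) - ∑ j, (conj (n j) - n j) • Λ' i j = 0 := by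
    intro i
    have h4 : ∑ j, ι' (if i = j then algebraMap ℂ A' (conj m - m) else 0) * p' j +
        ι' (algebraMap ℂ A' (conj (n i) - n i) - ∑ j, (conj (n j) - n j) • Λ' i j) = 0 := by
      rw [← h1 i, Finset.sum_eq_single i, if_pos rfl, AlgHomClass.commutes ι', ← Algebra.smul_def,
        map_sub, AlgHomClass.commutes ι', map_sum, add_sub_assoc]
      · simp only [map_smul]
      · intro j _ hj
        rw [if_neg hj.symm, map_zero, zero_mul]
      · simp
    obtain ⟨h5, h6⟩ := hP.linearIndependent h4
    refine ⟨?_, h6⟩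
    have h7 := congrArg (Coalgebra.counit (R := ℂ)) (h5 i)
    rwa [if_pos rfl, Bialgebra.counit_algebraMap, map_zero] at h7
  obtain ⟨i₀⟩ := hA'.irrep.2.1
  have hm : m = (m.re : ℂ) := (Complex.conj_eq_iff_re.1 (sub_eq_zero.1 (h3 i₀).1)).symm
  refine ⟨m.re, fun k => (n k).re, hm, fun i => ?_⟩
  -- Replacing `n` by its real part changes it by a `Λ'`-fixed vector, which does not affect `n - Λ'
  -- n`.
  have hn : ∀ k, ((n k).re : ℂ) = n k + (2 : ℂ)⁻¹ * (conj (n k) - n k) := fun k => by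
    rw [Complex.re_eq_add_conj]
    ring
  have h8 : algebraMap ℂ B' (conj (n i) - n i) - ∑ j, (conj (n j) - n j) • ι' (Λ' i j) = 0 := by
    have := congrArg ι' (h3 i).2
    rw [map_sub, AlgHomClass.commutes ι', map_sum, map_zero] at this
    simpa only [map_smul] using this
  rw [hx, ← hm]
  simp only [shiftedGenerator, hn, add_smul, mul_smul, Finset.sum_add_distrib, map_add, map_mul]
  rw [← Finset.smul_sum, ← Algebra.smul_def, sub_eq_zero.1 h8]
  abel

end RealChange

end InhomQG

/-! ### Assembly of the theorem. -/

theorem proposition4p5 {I : Type w} [Fintype I] [DecidableEq I]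
    {A : Type u} [Ring A] [HopfAlgebra ℂ A] {B : Type v} [Ring B] [HopfAlgebra ℂ B]
    (Λ : Matrix I I A) (ι : A →ₐc[ℂ] B) (p : I → B)
    (f : Matrix I I (Module.Dual ℂ A)) (η : I → Module.Dual ℂ A) (T : I × I → ℂ)
    (hG : IsInhomogeneousQG Λ ι p f η T)
    (sA : HopfStar A) (hΛ : ∀ i j, sA.star (Λ i j) = Λ i j) :
    -- 1) self-adjoint generators
    (∀ sB : HopfStar B, ExtendsStar ι sA sB →
      ∃ (m : ℂ) (n : I → ℂ), m ≠ 0 ∧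
        (∀ i, sB.star (shiftedGenerator Λ ι p m n i) = shiftedGenerator Λ ι p m n i) ∧
        ∃ (B' : Type v) (_ : Ring B') (_ : HopfAlgebra ℂ B') (ι' : A →ₐc[ℂ] B') (p' : I → B')
          (f' : Matrix I I (Module.Dual ℂ A)) (η' : I → Module.Dual ℂ A) (T' : I × I → ℂ)
          (sB' : HopfStar B') (φ : B ≃ₐc[ℂ] B'),
          IsInhomogeneousQG Λ ι' p' f' η' T' ∧ ExtendsStar ι' sA sB' ∧ IsStarIso sB sB' φ ∧
          (∀ a, φ (ι a) = ι' a) ∧ (∀ i, φ (shiftedGenerator Λ ι p m n i) = p' i) ∧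
          ∀ i, sB'.star (p' i) = p' i) ∧
    -- 2) existence and uniqueness of the `*`-structure with self-adjoint `p_i`
    ((∃ sB : HopfStar B, ExtendsStar ι sA sB ∧ ∀ i, sB.star (p i) = p i) ↔
      (∀ i j a, f i j (HopfAlgebra.antipode ℂ (sA.star a)) = conj (f i j a)) ∧
      (∀ i a, η i (HopfAlgebra.antipode ℂ (sA.star a)) = conj (η i a)) ∧
      IsMor (1 : Matrix Unit Unit A) (Λ ⊗ₖ Λ)
        (Matrix.of fun ij _ => conj (T (ij.2, ij.1)) - T ij)) ∧
    (∀ sB sB' : HopfStar B, ExtendsStar ι sA sB → (∀ i, sB.star (p i) = p i) →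
      ExtendsStar ι sA sB' → (∀ i, sB'.star (p i) = p i) → sB = sB') ∧
    -- 3) isomorphisms in the `*`-setting
    (∀ sB : HopfStar B, ExtendsStar ι sA sB → (∀ i, sB.star (p i) = p i) →
      -- 3.1)
      (∀ {J : Type w'} [Fintype J] [DecidableEq J] {A' : Type u'} [Ring A'] [HopfAlgebra ℂ A']
        {B' : Type v'} [Ring B'] [HopfAlgebra ℂ B'] (Λ' : Matrix J J A') (ι' : A' →ₐc[ℂ] B')
        (p' : J → B') (f' : Matrix J J (Module.Dual ℂ A')) (η' : J → Module.Dual ℂ A')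
        (T' : J × J → ℂ) (sA' : HopfStar A') (sB' : HopfStar B') (φ : B ≃ₐc[ℂ] B'),
        IsInhomogeneousQG Λ' ι' p' f' η' T' → ExtendsStar ι' sA' sB' →
        (∀ i, sB'.star (p' i) = p' i) → IsStarIso sB sB' φ →
          φ '' Set.range ι = Set.range ι' ∧
          φ '' (firstFiltration ι p : Set B) = (firstFiltration ι' p' : Set B') ∧
          (∀ i j, sA'.star (Λ' i j) = Λ' i j) ∧
          ∃ φA : A ≃ₐc[ℂ] A', IsStarIso sA sA' φA ∧ ∀ a, φ (ι a) = ι' (φA a)) ∧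
      -- 3.2)
      (∀ {A' : Type u'} [Ring A'] [HopfAlgebra ℂ A']
        {B' : Type v'} [Ring B'] [HopfAlgebra ℂ B'] (Λ' : Matrix I I A') (ι' : A' →ₐc[ℂ] B')
        (p' : I → B') (f' : Matrix I I (Module.Dual ℂ A')) (η' : I → Module.Dual ℂ A')
        (T' : I × I → ℂ) (sA' : HopfStar A') (sB' : HopfStar B') (φ : B ≃ₐc[ℂ] B')
        (φA : A ≃ₐc[ℂ] A') (M : Matrix I I ℂ),
        IsInhomogeneousQG Λ' ι' p' f' η' T' → ExtendsStar ι' sA' sB' →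
        (∀ i, sB'.star (p' i) = p' i) → IsStarIso sB sB' φ → (∀ a, φ (ι a) = ι' (φA a)) →
        IsUnit M → M.map conj = M → Intertwines φA M Λ Λ' →
          (∀ i j, sA'.star (Λ' i j) = Λ' i j) ∧
          ∃ (c : ℝ) (h : I → ℝ), c ≠ 0 ∧
            (∀ i, φ (p i) = ∑ j, M i j •
              shiftedGenerator Λ' ι' p' (c : ℂ) (fun k => (h k : ℂ)) j) ∧
            Rmat Λ' (hatF φA M f) = hatR M (Rmat Λ f) ∧
            IsInhomogeneousQG Λ' ι' p' (hatF φA M f)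
              (hatEta φA M (c : ℂ) (fun k => (h k : ℂ)) f η)
              (hatT M (c : ℂ) (fun k => (h k : ℂ)) (Rmat Λ f) (Zmat Λ η) T)) ∧
      -- 3.3)
      (∀ {A' : Type u'} [Ring A'] [HopfAlgebra ℂ A'] (Λ' : Matrix I I A') (sA' : HopfStar A')
        (φA : A ≃ₐc[ℂ] A') (M : Matrix I I ℂ) (c : ℝ) (h : I → ℝ),
        IsHomogeneousPart Λ' → IsStarIso sA sA' φA → IsUnit M → M.map conj = M →
        Intertwines φA M Λ Λ' → c ≠ 0 →
          (∀ i j, sA'.star (Λ' i j) = Λ' i j) ∧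
          ∃ (B' : Type v) (_ : Ring B') (_ : HopfAlgebra ℂ B') (ι' : A' →ₐc[ℂ] B') (p' : I → B')
            (sB' : HopfStar B') (φ : B ≃ₐc[ℂ] B'),
            IsInhomogeneousQG Λ' ι' p' (hatF φA M f)
              (hatEta φA M (c : ℂ) (fun k => (h k : ℂ)) f η)
              (hatT M (c : ℂ) (fun k => (h k : ℂ)) (Rmat Λ f) (Zmat Λ η) T) ∧
            Rmat Λ' (hatF φA M f) = hatR M (Rmat Λ f) ∧
            ExtendsStar ι' sA' sB' ∧ (∀ i, sB'.star (p' i) = p' i) ∧ IsStarIso sB sB' φ ∧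
            (∀ a, φ (ι a) = ι' (φA a)) ∧
            ∀ i, φ (p i) = ∑ j, M i j •
              shiftedGenerator Λ' ι' p' (c : ℂ) (fun k => (h k : ℂ)) j)) := by
  have d := hG.data
  have hA := hG.toIsHomogeneousPart
  refine ⟨?_, ⟨?_, ?_⟩, ?_, ?_⟩
  · intro sB hext
    obtain ⟨m, n, hm, hs⟩ := d.exists_selfAdjoint_shift hA hΛ hext
    refine ⟨m, n, hm, hs, ?_⟩
    -- The new quantum group is `B` itself with the shifted generators, and the isomorphism is the
    -- identity. The shift lemma expects old generators in terms of new ones, hence the inverse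
    -- parameters.
    have d' := d.shift (inv_ne_zero hm) (eq_shiftedGenerator_inv (n := n) hm fun _ => rfl) hA.irrep.1
    exact ⟨B, _, _, ι, shiftedGenerator Λ ι p m n, _, _, _, sB, BialgEquiv.refl ℂ B,
      d'.isInhomogeneousQG hA, hext, fun _ => rfl, fun _ => rfl, fun _ => rfl, hs⟩
  · rintro ⟨sB, hext, hp⟩
    exact d.star_conditions hA hΛ hext hp
  · rintro ⟨hf, hη, hT⟩
    exact d.exists_star hA hΛ hf hη hT
  · intro sB sB' hext hp hext' hp'
    exact d.star_unique hext hp hext' hp'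
  · intro sB hext hp
    refine ⟨?_, ?_, ?_⟩
    · intro J _ _ A' _ _ B' _ _ Λ' ι' p' f' η' T' sA' sB' φ hG' hext' hp' hs
      have d' := hG'.data
      have hA' := hG'.toIsHomogeneousPart
      obtain ⟨φA, hφA⟩ := d.exists_bialgEquiv d' hA hA' φ
      have hsymm : ∀ a', φ.symm (ι' a') = ι (φA.symm a') := fun a' => by
        apply φ.injective
        refine Eq.trans ?_ (hφA _).symm
        exact (φ.apply_symm_apply _).trans (congrArg ι' (φA.apply_symm_apply a').symm)
      refine ⟨?_, ?_, d'.star_matrix hA' hext' hp', φA, fun a => ?_, hφA⟩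
      · ext y
        constructor
        · rintro ⟨_, ⟨a, rfl⟩, rfl⟩
          exact ⟨φA a, (hφA a).symm⟩
        · rintro ⟨a', rfl⟩
          exact ⟨ι (φA.symm a'), ⟨_, rfl⟩, (hφA _).trans
            (congrArg ι' (φA.apply_symm_apply a'))⟩
      · ext y
        constructor
        · rintro ⟨b, hb, rfl⟩
          exact d.apply_mem_firstFiltration d' hA' (φ : B →ₐc[ℂ] B')
            (fun a => ⟨φA a, (hφA a).symm⟩) hb
        · intro hy
          exact ⟨φ.symm y, d'.apply_mem_firstFiltration d hA (φ.symm : B' →ₐc[ℂ] B)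
            (fun a' => ⟨φA.symm a', (hsymm a').symm⟩) hy, φ.apply_symm_apply y⟩
      · apply d'.injective
        rw [← hφA, ← hext, hs, hφA, hext']
    · intro A' _ _ B' _ _ Λ' ι' p' f' η' T' sA' sB' φ φA M hG' hext' hp' hs hφA hM hMr hI
      have d' := hG'.data
      have hA' := hG'.toIsHomogeneousPart
      have hMN : M * M⁻¹ = 1 := Matrix.mul_nonsing_inv _ ((Matrix.isUnit_iff_isUnit_det _).1 hM)
      have d2 := (d.transport φ φA ι' hφA).changeOfBasis hMN
      have hy : ∀ i, Coalgebra.comul (R := ℂ) (smulVec M⁻¹ (fun i => φ (p i)) i) =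
          ∑ j, ι' (Λ' i j) ⊗ₜ[ℂ] smulVec M⁻¹ (fun i => φ (p i)) j +
            smulVec M⁻¹ (fun i => φ (p i)) i ⊗ₜ[ℂ] (1 : B') := by
        intro i
        simp only [← hI.conjBy_eq hM]
        exact d2.comul_p i
      obtain ⟨m, n, hmn⟩ := d'.relations.exists_eq_shiftedGenerator (d'.isPrimitiveExtension hA')
        hA' d'.generated hy
      have hys : ∀ i, sB'.star (smulVec M⁻¹ (fun i => φ (p i)) i) =
          smulVec M⁻¹ (fun i => φ (p i)) i :=
        star_smulVec_inv hM hMr fun i => by rw [← hs, hp]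
      obtain ⟨c, h, hmc, hc⟩ := d'.exists_real_shift hA' hext' hp' hmn hys
      -- If `c` were zero, every component of `M⁻¹ φ(p)` would lie in `A'`, contrary to the data
      -- transported along `φ`.
      have hc0 : (c : ℂ) ≠ 0 := by
        intro h0
        obtain ⟨i, hi⟩ := d2.exists_notMem
        apply hi
        rw [hc, h0, shiftedGenerator_eq, zero_smul, zero_add, ← AlgHomClass.commutes ι', ← map_sub]
        exact ⟨_, rfl⟩
      obtain ⟨d3, hR⟩ := d.changeOfData φ φA hφA hA'.irrep.1 hM hI hc0 hc
      exact ⟨d'.star_matrix hA' hext' hp', c, h, Complex.ofReal_ne_zero.1 hc0,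
        (eq_smulVec_iff hM _ _).2 hc, hR, d3.isInhomogeneousQG hA'⟩
    · intro A' _ _ Λ' sA' φA M c h hA' hs hM hMr hI hc
      have hc0 : (c : ℂ) ≠ 0 := Complex.ofReal_ne_zero.2 hc
      have hΛ' := hI.star_eq hM hMr hs hΛ
      -- The required object is again `B`, with `A'` embedded through `φA⁻¹` and `φ` the identity;
      -- only the generators change.
      let ι' : A' →ₐc[ℂ] B := ι.comp (φA.symm : A' →ₐc[ℂ] A)
      let y : I → B := smulVec M⁻¹ p
      -- These parameters solve `y = c p' + h - Λ' h` for `p'`; they are real, so `p'` is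
      -- self-adjoint along with `y`.
      let p' : I → B := shiftedGenerator Λ' ι' y (c : ℂ)⁻¹ fun i => -((c : ℂ)⁻¹ * h i)
      have hι : ∀ a, BialgEquiv.refl ℂ B (ι a) = ι' (φA a) := fun a =>
        congrArg ι (φA.symm_apply_apply a).symm
      have hy : ∀ i, y i = shiftedGenerator Λ' ι' p' (c : ℂ) (fun k => (h k : ℂ)) i := by
        intro i
        have h1 := eq_shiftedGenerator_inv (p := y) (inv_ne_zero hc0) (fun i => (rfl : p' i = _)) i
        rw [h1, inv_inv]
        congr 1
        funext k
        rw [mul_neg, neg_neg, mul_inv_cancel_left₀ hc0]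
      have hext' : ExtendsStar ι' sA' sB := by
        intro a'
        obtain ⟨a, rfl⟩ : ∃ a, φA a = a' := φA.surjective a'
        rw [← hs, ← hι, ← hι]
        exact hext a
      obtain ⟨d3, hR⟩ := d.changeOfData (BialgEquiv.refl ℂ B) φA hι hA'.irrep.1 hM hI hc0 hy
      refine ⟨hΛ', B, _, _, ι', p', sB, BialgEquiv.refl ℂ B, d3.isInhomogeneousQG hA', hR, hext',
        fun i => ?_, fun _ => rfl, hι, (eq_smulVec_iff hM _ _).2 hy⟩
      have hys : ∀ i, sB.star (y i) = y i := star_smulVec_inv hM hMr hp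
      refine (hext'.star_shiftedGenerator hΛ' _ _ i).trans ?_
      simp [hys, p']
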